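/- Let $\mathbb T=\mathbb R/2\pi\mathbb Z$ and let $V\in\mathcal C^{1,1}(\mathbb T)$ be real-valued (differentiable with Lipschitz derivative) and normalized so that $\mu_0^V(dx):=e^{-V(x)}\frac{dx}{2\pi}$ is a probability measure. For $\beta\ge 0$ and a probability measure $\mu$ on $\mathbb T$ set $$F_\beta^V(\mu)=\beta\iint\log\Big|\sin\Big(\frac{x-y}2\Big)\Big|^{-1}\mu(dx)\mu(dy)+\mathcal K(\mu\,|\,\mu_0^V)\in[0,+\infty],$$ where $\mathcal K$ is the relative entropy, and let $\mu_\beta^V$ be the minimizer of $F_\beta^V$, with density $\mu_\beta^V(x)$ with respect to $dx$. Let $H^1(\mathbb T)$ be the space of $\psi\in L^2(\mathbb T)$ whose weak derivative $\psi'$ is in $L^2(\mathbb T)$, and let $$\mathcal H_\beta=\Big\{\psi\in H^1(\mathbb T):\int\psi\,d\mu_\beta^V=0\Big\},\qquad \langle\phi,\psi\rangle_{\mathcal H_\beta}=\int\phi'\psi'\,d\mu_\beta^V .$$ Let $$\mathscr L_\beta\phi=-\phi''-2\pi\beta H(\mu_\beta^V\phi')-(\log\mu_\beta^V)'\phi',\qquad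 Hf(x)=-\mathrm{p.v.}\int_{\mathbb T}\frac{f(t)}{\tan\frac{x-t}2}\frac{dt}{2\pi},$$ where the principal value is the limit as $\varepsilon\to0$ of the integral over $|e^{ix}-e^{it}|>\varepsilon$. For $f\in\mathcal H_\beta$ let $\mathscr L_\beta^{-1}f$ denote the $\phi\in\mathcal H_\beta$ with $\phi''\in L^2(\mathbb T)$ such that $\mathscr L_\beta\phi=f$ a.e. up to an additive constant (which the inner product of $\mathcal H_\beta$ does not see). For $\psi\in H^1(\mathbb T)$ put $\psi_\beta=\psi-\int\psi\,d\mu_\beta^V$ and $$\sigma_\beta^V(\psi)=\langle\psi_\beta,\mathscr L_\beta^{-1}\psi_\beta\rangle_{\mathcal H_\beta}^{1/2}.$$ Then these objects are well defined for every $\beta\ge0$: $F_\beta^V$ has exactly one minimizer, and for every $f\in\mathcal H_\beta$ the function $\mathscr L_\beta^{-1}f$ exists, is unique up to a null set, and satisfies $\langle f,\mathscr L_\beta^{-1}f\rangle_{\mathcal H_\beta}\ge0$. Moreover, for every $\psi\in H^1(\mathbb T)$, $$\lim_{\beta\to0^+}\sigma_\beta^V(\psi)=\sigma_0^V(\psi)=\Big\|\psi-\int\psi\,d\mu_0^V\Big\|_{L^2(\mu_0^V)}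 .$$ -/

import Mathlib

open MeasureTheory Filter Topology
open scoped ENNReal ContDiff

noncomputable section

namespace HighTemp

instance fact_two_pi_pos : Fact (0 < 2 * Real.pi) := ⟨Real.two_pi_pos⟩

/-- The torus `ℝ / 2πℤ`. Its `volume` is Lebesgue measure `dx`, of total mass `2π`. -/
abbrev Torus : Type := AddCircle (2 * Real.pi)

/-! ### Trigonometric kernels on the torus -/

theorem abs_sin_half_periodic :
    Function.Periodic (fun x : ℝ => |Real.sin (x / 2)|) (2 * Real.pi) := by
  intro x
  have h : (x + 2 * Real.pi) / 2 = x / 2 + Real.pi := by ring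
  simp [h, Real.sin_add_pi]

theorem cot_half_periodic :
    Function.Periodic (fun x : ℝ => 1 / Real.tan (x / 2)) (2 * Real.pi) := by
  intro x
  have h : (x + 2 * Real.pi) / 2 = x / 2 + Real.pi := by ring
  simp [h, Real.tan_add_pi]

/-- The function `θ ↦ |sin (θ / 2)|`; thus `|e^{ix} - e^{iy}| = 2 * absSinHalf (x - y)`. -/
def absSinHalf : Torus → ℝ := abs_sin_half_periodic.lift

/-- The function `θ ↦ 1 / tan (θ / 2)`. (At `θ = π` Lean's `1 / tan (π / 2)` is `0`, the true value
of the cotangent; the value at the pole `θ = 0` is never used.) -/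
def cotHalf : Torus → ℝ := cot_half_periodic.lift

/-- The logarithmic kernel `θ ↦ log |sin (θ / 2)|⁻¹ ∈ [0, ∞]`. -/
def logKernel (θ : Torus) : ℝ≥0∞ :=
  open Classical in if θ = 0 then ⊤ else ENNReal.ofReal (-Real.log (absSinHalf θ))

/-! ### The equilibrium measure -/

/-- The measure `μ₀^V (dx) = e^{-V(x)} dx / 2π`. -/
def refMeasure (V : Torus → ℝ) : Measure Torus :=
  (volume : Measure Torus).withDensity fun x => ENNReal.ofReal (Real.exp (-V x) / (2 * Real.pi))

/-- The logarithmic energy of a measure. -/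
def logEnergy (μ : Measure Torus) : ℝ≥0∞ := ∫⁻ x, ∫⁻ y, logKernel (x - y) ∂μ ∂μ

/-- The functional `F_β^V(μ) = β 𝓔(μ) + K(μ | μ₀^V)` on probability measures. -/
def freeEnergy (β : ℝ) (V : Torus → ℝ) (μ : ProbabilityMeasure Torus) : ℝ≥0∞ :=
  ENNReal.ofReal β * logEnergy (μ : Measure Torus)
    + InformationTheory.klDiv (μ : Measure Torus) (refMeasure V)

/-- `μ` is a minimizer of `F_β^V` over all probability measures on the torus. -/
def IsEquilibrium (β : ℝ) (V : Torus → ℝ) (μ : ProbabilityMeasure Torus) : Prop :=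
  ∀ ν : ProbabilityMeasure Torus, freeEnergy β V μ ≤ freeEnergy β V ν

/-- The equilibrium measure `μ_β^V`: the minimizer of `F_β^V`. -/
def eqMeasure (β : ℝ) (V : Torus → ℝ) : ProbabilityMeasure Torus :=
  Classical.epsilon (IsEquilibrium β V)

/-- The density `x ↦ μ_β^V(x)` of the equilibrium measure with respect to `dx`. -/
def eqDensity (β : ℝ) (V : Torus → ℝ) (x : Torus) : ℝ :=
  ((eqMeasure β V : Measure Torus).rnDeriv volume x).toReal

/-! ### Derivatives and Sobolev functions on the torus -/

/-- The classical derivative of a function on the torus. -/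
def circDeriv (f : Torus → ℝ) (x : Torus) : ℝ := deriv (fun t : ℝ => f (x + (t : Torus))) 0

/-- The class `C^{1,1}`: differentiable, with Lipschitz derivative. -/
def IsC11 (V : Torus → ℝ) : Prop :=
  Differentiable ℝ (fun t : ℝ => V (t : Torus)) ∧ ∃ K, LipschitzWith K (circDeriv V)

/-- `g` is a square integrable weak (distributional) derivative of `f`. -/
def HasWeakDeriv (f g : Torus → ℝ) : Prop :=
  MemLp g 2 volume ∧ ∀ η : Torus → ℝ, ContDiff ℝ ∞ (fun t : ℝ => η (t : Torus)) →
    ∫ x, f x * circDeriv η x = -∫ x, g x * η x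

/-- The Sobolev space `H¹`: square integrable functions with square integrable weak derivative. -/
def MemH1 (f : Torus → ℝ) : Prop := MemLp f 2 volume ∧ ∃ g, HasWeakDeriv f g

/-- The weak derivative of a function in `H¹` (well defined up to a null set). -/
def weakDeriv (f : Torus → ℝ) : Torus → ℝ := Classical.epsilon (HasWeakDeriv f)

/-! ### The operator and the variance -/

/-- The Hilbert transform
`H f (x) = - p.v. ∫ f(t) / tan ((x - t) / 2) dt / 2π`, where the principal value is the limit as
`ε → 0` of the integral over `|e^{ix} - e^{it}| > ε`. -/
def hilbert (f : Torus → ℝ) (x : Torus) : ℝ :=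
  -limUnder (𝓝[>] (0 : ℝ)) fun ε : ℝ =>
    (∫ t in {t : Torus | ε < 2 * absSinHalf (x - t)}, f t * cotHalf (x - t)) / (2 * Real.pi)

/-- The operator `𝓛_β φ = -φ'' - 2πβ H(μ_β^V φ') - (log μ_β^V)' φ'`, with weak derivatives. -/
def opL (β : ℝ) (V : Torus → ℝ) (φ : Torus → ℝ) (x : Torus) : ℝ :=
  -weakDeriv (weakDeriv φ) x
    - 2 * Real.pi * β * hilbert (fun t => eqDensity β V t * weakDeriv φ t) x
    - weakDeriv (fun t => Real.log (eqDensity β V t)) x * weakDeriv φ x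

/-- The subtraction of the mean, `ψ - ∫ ψ dμ_β^V`. -/
def center (β : ℝ) (V : Torus → ℝ) (ψ : Torus → ℝ) (x : Torus) : ℝ :=
  ψ x - ∫ y, ψ y ∂(eqMeasure β V : Measure Torus)

/-- The space `ℋ_β`: functions in `H¹` with mean zero under `μ_β^V`. -/
def MemHilb (β : ℝ) (V : Torus → ℝ) (f : Torus → ℝ) : Prop :=
  MemH1 f ∧ ∫ x, f x ∂(eqMeasure β V : Measure Torus) = 0

/-- The inner product `⟨f, g⟩ = ∫ f' g' dμ_β^V` of `ℋ_β`. -/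
def innerHilb (β : ℝ) (V : Torus → ℝ) (f g : Torus → ℝ) : ℝ :=
  ∫ x, weakDeriv f x * weakDeriv g x ∂(eqMeasure β V : Measure Torus)

/-- `φ = 𝓛_β⁻¹ f` in `ℋ_β`: `φ ∈ ℋ_β` has two square integrable weak derivatives and `𝓛_β φ` is
`f` up to an additive constant. The constant is invisible to the inner product of `ℋ_β` (which
only sees derivatives): `𝓛_β` acts on `ℋ_β` after subtraction of the mean of `𝓛_β φ`, which
need not vanish. -/
def IsInvL (β : ℝ) (V : Torus → ℝ) (f φ : Torus → ℝ) : Prop :=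
  MemHilb β V φ ∧ MemH1 (weakDeriv φ) ∧
    ∃ c : ℝ, ∀ᵐ x ∂(volume : Measure Torus), opL β V φ x = f x + c

/-- The inverse operator `𝓛_β⁻¹` on `ℋ_β`. -/
def invL (β : ℝ) (V : Torus → ℝ) (f : Torus → ℝ) : Torus → ℝ :=
  Classical.epsilon (IsInvL β V f)

/-- The limiting standard deviation `σ_β^V(ψ) = ⟨ψ_β, 𝓛_β⁻¹ ψ_β⟩^{1/2}`, `ψ_β = ψ - ∫ ψ dμ_β^V`. -/
def sigma (β : ℝ) (V : Torus → ℝ) (ψ : Torus → ℝ) : ℝ :=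
  Real.sqrt (innerHilb β V (center β V ψ) (invL β V (center β V ψ)))

end HighTemp

end

set_option linter.unusedSectionVars false

noncomputable section

namespace HighTemp

/-! ### Calculus on the torus -/

/-! Everything rests on the positive definiteness of the logarithmic kernel. Since -log|sin(θ/2)| =
-(1/2) log(1 - cos²(θ/2)), the kernel is the sum over n ≥ 0 of cos²(θ/2)^(n+1) / (2(n+1)), and each
power of cos²((x-y)/2) is a finite sum of products a(x)a(y). This gives ∫ w (pot w) ≥ 0 for w in L²
(`integral_mul_pot_nonneg`) and 2E(μ,ν) ≤ E(μ,μ) + E(ν,ν) for measures, infinite energies included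
(`two_mutualEnergy_le`).

Minimizer. The energy is therefore midpoint convex, while the relative entropy is strongly convex
with gap measured by the L² distance of the square roots of the densities (`klFun_midpoint`,
`freeEnergy_midpoint`). Two minimizers must coincide; along a minimizing sequence the square roots
are Cauchy in L²(μ₀), and Fatou's lemma shows that the limit is a minimizer. Perturbing the
minimizer towards uniform distributions on sublevel sets yields the Euler–Lagrange equation p = ρ
exp(C - 2β pot p), with ρ the density of μ₀ and 0 ≤ C = O(β) (`exists_eqDensity_eq`). Hence p lies
between positive constants, and a difference quotient argument, in which the interaction has the
favourable sign, gives log p = Λ in H¹ (`exists_hasPrim_log_eqDensity`).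

Inverse operator. Put u = p φ' and w = u'. The local terms of the operator combine to -w/p, and
integration by parts against the truncated kernel shows H u = (pot w)/π (`hilbert_eq`). The equation
𝓛φ = f + c thus becomes w/p + 2β pot w = -(f + c) with ∫ w = 0, whose bilinear form on L² is
coercive for every β ≥ 0. Lax–Milgram gives existence, positivity gives uniqueness, and ⟨f, φ⟩ = -∫
f w = ∫ w²/p + 2β ∫ w (pot w) ≥ 0.

Limit. For f = ψ - ∫ ψ p the equation reads w = -p(ψ + c + 2β pot w). Testing it with w bounds ‖w‖
in L² uniformly for β in [0,1], and eliminating c by ∫ w = 0 gives σ² = Var_p(ψ) + 2β Cov_p(ψ, pot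
w) = Var_p(ψ) + O(β) (`exists_abs_sigmaSq_sub_le`). Finally p → ρ uniformly by the Euler–Lagrange
equation. -/

theorem coe_two_pi : ((2 * Real.pi : ℝ) : Torus) = 0 := AddCircle.coe_period _

theorem coe_add_two_pi (t : ℝ) : ((t + 2 * Real.pi : ℝ) : Torus) = t :=
  AddCircle.coe_add_period _ t

theorem periodic_coe {E : Type*} (F : Torus → E) :
    Function.Periodic (fun t : ℝ => F t) (2 * Real.pi) := fun t => by
  simp only [coe_add_two_pi]

/-- The line is a countable union of fundamental intervals, on each of which the projection
preserves measure. -/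
theorem ae_real_of_ae_torus {P : Torus → Prop} (h : ∀ᵐ x : Torus, P x) :
    ∀ᵐ t : ℝ, P (t : Torus) := by
  have key : ∀ n : ℤ, ∀ᵐ t ∂(volume.restrict (Set.Ioc (0 + n • (2 * Real.pi))
      (0 + (n + 1) • (2 * Real.pi)))), P ((t : ℝ) : Torus) := by
    intro n
    have h1 := (AddCircle.measurePreserving_mk (2 * Real.pi)
      (0 + n • (2 * Real.pi))).quasiMeasurePreserving.ae h
    have e : (0 : ℝ) + (n + 1) • (2 * Real.pi) = 0 + n • (2 * Real.pi) + 2 * Real.pi := by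
      rw [add_zsmul, one_zsmul]; ring
    rw [e]
    exact h1
  rw [← ae_restrict_iUnion_iff] at key
  rwa [iUnion_Ioc_add_zsmul Real.two_pi_pos 0, Measure.restrict_univ] at key

theorem intervalIntegrable_coe {E : Type*} [NormedAddCommGroup E] {g : Torus → E}
    (hg : Integrable g) (a b : ℝ) :
    IntervalIntegrable (fun t : ℝ => g t) volume a b := by
  refine (periodic_coe g).intervalIntegrable₀ Real.two_pi_pos.ne' ?_ a b
  rw [intervalIntegrable_iff_integrableOn_Ioc_of_le Real.two_pi_pos.le]
  have := (AddCircle.measurePreserving_mk (2 * Real.pi) 0).integrable_comp_of_integrable hg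
  simp only [zero_add] at this
  exact this

theorem intervalIntegral_coe {E : Type*} [NormedAddCommGroup E] [NormedSpace ℝ E]
    (g : Torus → E) : ∫ t in (0 : ℝ)..(2 * Real.pi), g t = ∫ x : Torus, g x := by
  have := AddCircle.intervalIntegral_preimage (2 * Real.pi) 0 g
  simpa using this

theorem continuous_of_continuous_coe {E : Type*} [TopologicalSpace E] {F : Torus → E}
    (h : Continuous fun t : ℝ => F t) : Continuous F :=
  (QuotientAddGroup.isQuotientMap_mk (N := AddSubgroup.zmultiples (2 * Real.pi))).continuous_iff.2 h

theorem continuous_coe_torus : Continuous fun t : ℝ => (t : Torus) :=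
  AddCircle.continuous_mk' _

theorem memLp_of_continuous {F : Torus → ℝ} (h : Continuous F) (p : ℝ≥0∞) :
    MemLp F p volume := by
  obtain ⟨C, hC⟩ := isCompact_univ.exists_bound_of_continuousOn h.continuousOn
  exact MemLp.of_bound h.aestronglyMeasurable C (ae_of_all _ fun x => hC x (Set.mem_univ x))

theorem exists_bound_of_continuous {F : Torus → ℝ} (h : Continuous F) :
    ∃ C, 0 ≤ C ∧ ∀ x, |F x| ≤ C := by
  obtain ⟨C, hC⟩ := isCompact_univ.exists_bound_of_continuousOn h.continuousOn
  exact ⟨C, (abs_nonneg _).trans (hC 0 (Set.mem_univ _)), fun x => hC x (Set.mem_univ x)⟩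

theorem MemLp.mul_continuous {F g : Torus → ℝ} (hF : Continuous F) (hg : MemLp g 2 volume) :
    MemLp (fun x => F x * g x) 2 volume := by
  obtain ⟨C, -, hC⟩ := exists_bound_of_continuous hF
  exact hg.of_le_mul (c := C) (hF.aestronglyMeasurable.mul hg.1) (ae_of_all _ fun x => by
    rw [norm_mul]; gcongr; exact hC x)

/-! ### Primitives of square integrable functions -/

/-- `F` is a primitive of the square integrable function `g`. -/
def HasPrim (F g : Torus → ℝ) : Prop :=
  MemLp g 2 volume ∧ ∀ a b : ℝ, F b - F a = ∫ t in a..b, g t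

theorem integrable_of_memLp_two {g : Torus → ℝ} (h : MemLp g 2 volume) : Integrable g :=
  h.integrable (by norm_num)

namespace HasPrim

variable {F G f g : Torus → ℝ}

theorem integrable (h : HasPrim F f) : Integrable f := integrable_of_memLp_two h.1

theorem intervalIntegrable (h : HasPrim F f) (a b : ℝ) :
    IntervalIntegrable (fun t : ℝ => f t) volume a b := intervalIntegrable_coe h.integrable a b

theorem eq_integral (h : HasPrim F f) (c t : ℝ) : F t = F c + ∫ s in c..t, f s := by
  rw [← h.2 c t]; ring

theorem ac (h : HasPrim F f) (a b : ℝ) :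
    AbsolutelyContinuousOnInterval (fun t : ℝ => F t) a b := by
  have h1 := (h.intervalIntegrable a b).absolutelyContinuousOnInterval_intervalIntegral
    (c := a) (by simp)
  have h2 : AbsolutelyContinuousOnInterval (fun _ : ℝ => F a) a b :=
    ((LipschitzWith.const (F a)).lipschitzOnWith (s := Set.uIcc a b)).absolutelyContinuousOnInterval
  have h3 := h2.fun_add h1
  rwa [show (fun t : ℝ => F t) = fun t : ℝ => F a + ∫ s in a..t, f s from
    funext fun t => h.eq_integral a t]

theorem continuous (h : HasPrim F f) : Continuous F := by
  refine continuous_of_continuous_coe ?_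
  rw [show (fun t : ℝ => F t) = fun t : ℝ => F (0 : ℝ) + ∫ s in (0 : ℝ)..t, f s from
    funext fun t => h.eq_integral 0 t]
  exact continuous_const.add
    (intervalIntegral.continuous_primitive (fun a b => h.intervalIntegrable a b) 0)

theorem ae_hasDerivAt (h : HasPrim F f) :
    ∀ᵐ t : ℝ, HasDerivAt (fun t : ℝ => F t) (f t) t := by
  have hl : LocallyIntegrable (fun t : ℝ => f t) volume := by
    intro x
    refine ⟨Set.Icc (x - 1) (x + 1), Icc_mem_nhds (by linarith) (by linarith), ?_⟩
    rw [← intervalIntegrable_iff_integrableOn_Icc_of_le (by linarith)]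
    exact h.intervalIntegrable _ _
  filter_upwards [_root_.LocallyIntegrable.ae_hasDerivAt_integral hl] with x hx
  have := (hx 0).const_add (F (0 : ℝ))
  rwa [show (fun t : ℝ => F t) = fun t : ℝ => F (0 : ℝ) + ∫ s in (0 : ℝ)..t, f s from
    funext fun t => h.eq_integral 0 t]

/-- The fundamental theorem of calculus for absolutely continuous functions. Products, exponentials
and the truncated kernel enter the calculus of primitives through this criterion. -/
theorem of_ac (hac : ∀ a b : ℝ, AbsolutelyContinuousOnInterval (fun t : ℝ => F t) a b)
    (hd : ∀ᵐ t : ℝ, HasDerivAt (fun t : ℝ => F t) (f t) t) (hf : MemLp f 2 volume) :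
    HasPrim F f := by
  refine ⟨hf, fun a b => ?_⟩
  rw [← (hac a b).integral_deriv_eq_sub]
  refine intervalIntegral.integral_congr_ae ?_
  filter_upwards [hd] with t ht _ using ht.deriv

theorem memLp (h : HasPrim F f) (p : ℝ≥0∞) : MemLp F p volume := memLp_of_continuous h.continuous p

theorem mul (hF : HasPrim F f) (hG : HasPrim G g) :
    HasPrim (fun x => F x * G x) (fun x => F x * g x + G x * f x) := by
  refine of_ac (fun a b => (hF.ac a b).fun_mul (hG.ac a b)) ?_
    ((MemLp.mul_continuous hF.continuous hG.1).add (MemLp.mul_continuous hG.continuous hF.1))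
  filter_upwards [hF.ae_hasDerivAt, hG.ae_hasDerivAt] with t h1 h2
  exact (h1.mul h2).congr_deriv (by ring)

theorem exp (hF : HasPrim F f) :
    HasPrim (fun x => Real.exp (F x)) (fun x => Real.exp (F x) * f x) := by
  obtain ⟨C, hC0, hC⟩ := exists_bound_of_continuous hF.continuous
  refine of_ac (fun a b => ?_) ?_
    (MemLp.mul_continuous (Real.continuous_exp.comp hF.continuous) hF.1)
  · have hL : ∀ x y : Torus, dist (Real.exp (F x)) (Real.exp (F y)) ≤
        Real.exp C * dist (F x) (F y) := by
      intro x y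
      have hconv : Convex ℝ (Set.Icc (-C) C) := convex_Icc _ _
      have := hconv.norm_image_sub_le_of_norm_deriv_le (f := Real.exp) (C := Real.exp C)
        (fun z _ => Real.differentiableAt_exp) (fun z hz => by
          rw [Real.deriv_exp, Real.norm_eq_abs, abs_of_pos (Real.exp_pos _)]
          exact Real.exp_le_exp.2 hz.2) (abs_le.1 (hC y)) (abs_le.1 (hC x))
      simpa [dist_eq_norm] using this
    -- The exponential is e^C-Lipschitz on [-C, C], which contains the range of `F`, so the
    -- variation sums of exp ∘ F are dominated by those of e^C F.
    have h0 := (hF.ac a b).const_mul (Real.exp C)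
    unfold AbsolutelyContinuousOnInterval at h0 ⊢
    refine squeeze_zero (fun _ => Finset.sum_nonneg fun i _ => dist_nonneg) (fun E =>
      Finset.sum_le_sum fun i _ => ?_) h0
    refine (hL _ _).trans_eq ?_
    rw [Real.dist_eq, Real.dist_eq, ← mul_sub, abs_mul, abs_of_pos (Real.exp_pos _)]
  · filter_upwards [hF.ae_hasDerivAt] with t ht
    exact ht.exp

theorem const_mul (hF : HasPrim F f) (c : ℝ) :
    HasPrim (fun x => c * F x) (fun x => c * f x) :=
  ⟨hF.1.const_mul c, fun a b => by
    rw [intervalIntegral.integral_const_mul, ← hF.2, mul_sub]⟩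

theorem neg (hF : HasPrim F f) : HasPrim (fun x => -F x) (fun x => -f x) := by
  simpa using hF.const_mul (-1)

theorem add (hF : HasPrim F f) (hG : HasPrim G g) :
    HasPrim (fun x => F x + G x) (fun x => f x + g x) :=
  ⟨hF.1.add hG.1, fun a b => by
    rw [intervalIntegral.integral_add (hF.intervalIntegrable a b) (hG.intervalIntegrable a b),
      ← hF.2, ← hG.2]; ring⟩

theorem sub (hF : HasPrim F f) (hG : HasPrim G g) :
    HasPrim (fun x => F x - G x) (fun x => f x - g x) := by
  simpa [sub_eq_add_neg] using hF.add hG.neg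

theorem add_const (hF : HasPrim F f) (c : ℝ) : HasPrim (fun x => F x + c) f :=
  ⟨hF.1, fun a b => by rw [← hF.2]; ring⟩

theorem congr (hF : HasPrim F f) (h : f =ᵐ[volume] g) : HasPrim F g := by
  refine ⟨(memLp_congr_ae h).1 hF.1, fun a b => ?_⟩
  rw [hF.2]
  refine intervalIntegral.integral_congr_ae ?_
  filter_upwards [ae_real_of_ae_torus h] with t ht _ using ht

theorem integral_eq_zero (hF : HasPrim F f) : ∫ x, f x = 0 := by
  rw [← intervalIntegral_coe, ← hF.2, coe_two_pi]
  simp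

theorem integral_mul_eq (hF : HasPrim F f) (hG : HasPrim G g) :
    ∫ x, F x * g x = -∫ x, f x * G x := by
  have h := (hF.mul hG).integral_eq_zero
  rw [integral_add (integrable_of_memLp_two (MemLp.mul_continuous hF.continuous hG.1))
    (integrable_of_memLp_two (MemLp.mul_continuous hG.continuous hF.1))] at h
  simp only [mul_comm (f _)]
  linarith

theorem eq_const (hF : HasPrim F f) (h : f =ᵐ[volume] 0) (x : Torus) : F x = F 0 := by
  induction x using QuotientAddGroup.induction_on with
  | H t =>
    have := (hF.congr h).eq_integral 0 t
    simpa using this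

theorem sub_eq_const (hF : HasPrim F f) (hG : HasPrim G g) (h : f =ᵐ[volume] g) (x : Torus) :
    F x - G x = F 0 - G 0 := by
  refine (hF.sub hG).eq_const ?_ x
  filter_upwards [h] with y hy
  simp [hy]

end HasPrim

/-- The function on the torus with a given periodic lift. -/
def ofPeriodic {F : ℝ → ℝ} (h : Function.Periodic F (2 * Real.pi)) : Torus → ℝ := h.lift

@[simp] theorem ofPeriodic_coe {F : ℝ → ℝ} (h : Function.Periodic F (2 * Real.pi)) (t : ℝ) :
    ofPeriodic h (t : Torus) = F t := h.lift_coe t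

/-- Mean zero is exactly what makes the integral from 0 to t a periodic function of t. -/
theorem exists_hasPrim {g : Torus → ℝ} (hg : MemLp g 2 volume) (h0 : ∫ x, g x = 0) :
    ∃ F, HasPrim F g := by
  have hi := fun a b => intervalIntegrable_coe (integrable_of_memLp_two hg) a b
  have hper : Function.Periodic (fun t : ℝ => ∫ s in (0 : ℝ)..t, g s) (2 * Real.pi) := by
    intro t
    have h1 := (periodic_coe g).intervalIntegral_add_eq_add 0 t hi
    simp only [zero_add] at h1
    simp only
    rw [h1, intervalIntegral_coe, h0, add_zero]
  refine ⟨ofPeriodic hper, hg, fun a b => ?_⟩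
  simp only [ofPeriodic_coe]
  exact intervalIntegral.integral_interval_sub_left (hi _ _) (hi _ _)

/-! ### Smooth test functions on the torus. -/

theorem circDeriv_coe (η : Torus → ℝ) (t : ℝ) :
    circDeriv η t = deriv (fun s : ℝ => η s) t := by
  unfold circDeriv
  simp only [← AddCircle.coe_add]
  rw [deriv_comp_const_add (f := fun s : ℝ => η s)]
  simp

/-- Smooth functions on the torus. -/
def Smooth (η : Torus → ℝ) : Prop := ContDiff ℝ ∞ (fun t : ℝ => η (t : Torus))

theorem Smooth.continuous {η : Torus → ℝ} (h : Smooth η) : Continuous η :=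
  continuous_of_continuous_coe (ContDiff.continuous h)

theorem Smooth.continuous_circDeriv {η : Torus → ℝ} (h : Smooth η) :
    Continuous (circDeriv η) := by
  refine continuous_of_continuous_coe ?_
  simp only [circDeriv_coe]
  exact ContDiff.continuous_deriv h (by norm_cast)

theorem Smooth.hasDerivAt {η : Torus → ℝ} (h : Smooth η) (t : ℝ) :
    HasDerivAt (fun s : ℝ => η s) (circDeriv η t) t := by
  rw [circDeriv_coe]
  exact (ContDiff.differentiable h (by norm_num) t).hasDerivAt

theorem Smooth.hasPrim {η : Torus → ℝ} (h : Smooth η) : HasPrim η (circDeriv η) := by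
  refine ⟨memLp_of_continuous h.continuous_circDeriv 2, fun a b => ?_⟩
  rw [intervalIntegral.integral_eq_sub_of_hasDerivAt (f := fun s : ℝ => η s)
    (fun t _ => h.hasDerivAt t)
    (intervalIntegrable_coe (integrable_of_memLp_two
      (memLp_of_continuous h.continuous_circDeriv 2)) a b)]

/-! ### Weak derivatives -/

theorem sq_integral_mul_le {α : Type*} [MeasurableSpace α] {μ : Measure α} {f g : α → ℝ}
    (hf : MemLp f 2 μ) (hg : MemLp g 2 μ) :
    (∫ x, f x * g x ∂μ) ^ 2 ≤ (∫ x, f x ^ 2 ∂μ) * ∫ x, g x ^ 2 ∂μ := by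
  have hquad : ∀ c : ℝ, 0 ≤ (∫ x, f x ^ 2 ∂μ) * (c * c) + (2 * ∫ x, f x * g x ∂μ) * c
      + ∫ x, g x ^ 2 ∂μ := by
    intro c
    have h0 : 0 ≤ ∫ x, (c * f x + g x) ^ 2 ∂μ := integral_nonneg fun x => sq_nonneg _
    have h1 : ∀ x, (c * f x + g x) ^ 2 = c * c * f x ^ 2 + 2 * c * (f x * g x) + g x ^ 2 :=
      fun x => by ring
    simp_rw [h1] at h0
    have hfg : Integrable (fun x => f x * g x) μ := hf.integrable_mul hg
    have hs : Integrable (fun x => c * c * f x ^ 2 + 2 * c * (f x * g x)) μ :=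
      (hf.integrable_sq.const_mul _).add (hfg.const_mul _)
    rw [integral_add hs hg.integrable_sq,
      integral_add (hf.integrable_sq.const_mul _) (hfg.const_mul _), integral_const_mul,
      integral_const_mul] at h0
    linarith
  have hd := discrim_le_zero hquad
  rw [discrim] at hd
  nlinarith

theorem abs_integral_mul_le {α : Type*} [MeasurableSpace α] {μ : Measure α} {f g : α → ℝ}
    (hf : MemLp f 2 μ) (hg : MemLp g 2 μ) :
    |∫ x, f x * g x ∂μ| ≤ Real.sqrt (∫ x, f x ^ 2 ∂μ) * Real.sqrt (∫ x, g x ^ 2 ∂μ) := by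
  rw [← Real.sqrt_mul (integral_nonneg fun x => sq_nonneg _)]
  exact Real.abs_le_sqrt (sq_integral_mul_le hf hg)

/-- The function `cos (n x)` on the torus. -/
def cosT (n : ℤ) (x : Torus) : ℝ := (fourier n x).re

/-- The function `sin (n x)` on the torus. -/
def sinT (n : ℤ) (x : Torus) : ℝ := (fourier n x).im

theorem fourier_coe_real (n : ℤ) (t : ℝ) :
    fourier n (t : Torus) = Complex.exp ((n * t : ℝ) * Complex.I) := by
  rw [fourier_coe_apply]
  congr 1
  have : (Real.pi : ℂ) ≠ 0 := by exact_mod_cast Real.pi_ne_zero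
  push_cast
  field_simp

theorem cosT_coe (n : ℤ) (t : ℝ) : cosT n (t : Torus) = Real.cos (n * t) := by
  rw [cosT, fourier_coe_real, Complex.exp_ofReal_mul_I_re]

theorem sinT_coe (n : ℤ) (t : ℝ) : sinT n (t : Torus) = Real.sin (n * t) := by
  rw [sinT, fourier_coe_real, Complex.exp_ofReal_mul_I_im]

theorem smooth_cosT (n : ℤ) : Smooth (cosT n) := by
  unfold Smooth
  simp only [cosT_coe]
  fun_prop

theorem smooth_sinT (n : ℤ) : Smooth (sinT n) := by
  unfold Smooth
  simp only [sinT_coe]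
  fun_prop

theorem circDeriv_cosT (n : ℤ) (x : Torus) : circDeriv (cosT n) x = -(n * sinT n x) := by
  induction x using QuotientAddGroup.induction_on with
  | H t =>
    rw [circDeriv_coe, sinT_coe]
    simp only [cosT_coe]
    have h := ((hasDerivAt_id t).const_mul (n : ℝ)).cos
    simp only [id, mul_one] at h
    rw [h.deriv]; ring

theorem circDeriv_sinT (n : ℤ) (x : Torus) : circDeriv (sinT n) x = n * cosT n x := by
  induction x using QuotientAddGroup.induction_on with
  | H t =>
    rw [circDeriv_coe, cosT_coe]
    simp only [sinT_coe]
    have h := ((hasDerivAt_id t).const_mul (n : ℝ)).sin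
    simp only [id, mul_one] at h
    rw [h.deriv]; ring

theorem integrable_mul_of_continuous {F g : Torus → ℝ} (hF : Continuous F)
    (hg : MemLp g 2 volume) : Integrable (fun x => g x * F x) := by
  simpa only [mul_comm] using integrable_of_memLp_two (MemLp.mul_continuous hF hg)

/-- The real and imaginary parts of the Fourier coefficients are the given integrals up to
normalization, and an L² function is the sum of its Fourier series. -/
theorem ae_eq_zero_of_integral_trig {d : Torus → ℝ} (hd : MemLp d 2 volume)
    (hc : ∀ n, ∫ x, d x * cosT n x = 0) (hs : ∀ n, ∫ x, d x * sinT n x = 0) :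
    d =ᵐ[volume] 0 := by
  have hD : MemLp (fun x => (d x : ℂ)) 2 (volume : Measure Torus) := hd.ofReal
  have hD' : MemLp (fun x => (d x : ℂ)) 2 (AddCircle.haarAddCircle : Measure Torus) :=
    hD.haarAddCircle
  have hcoef : ∀ n : ℤ, fourierCoeff (fun x : Torus => (d x : ℂ)) n = 0 := by
    intro n
    rw [fourierCoeff, AddCircle.integral_haarAddCircle]
    have e : ∀ t : Torus, fourier (-n) t • (d t : ℂ) =
        ((d t * cosT (-n) t : ℝ) : ℂ) + ((d t * sinT (-n) t : ℝ) : ℂ) * Complex.I := by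
      intro t
      rw [cosT, sinT, smul_eq_mul]
      conv_lhs => rw [← Complex.re_add_im (fourier (-n) t)]
      push_cast; ring
    simp_rw [e]
    rw [integral_add, integral_mul_const, integral_complex_ofReal, integral_complex_ofReal, hc, hs]
    · simp
    · exact (integrable_mul_of_continuous (smooth_cosT _).continuous hd).ofReal
    · exact (integrable_mul_of_continuous (smooth_sinT _).continuous hd).ofReal.mul_const _
  have hsum := hasSum_fourier_series_L2 (hD'.toLp _)
  have h0 : ∀ n, fourierCoeff (hD'.toLp (fun x => (d x : ℂ))) n = 0 := fun n => by
    rw [← hcoef n]; exact congrFun (fourierCoeff_congr_ae hD'.coeFn_toLp) n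
  simp only [h0, zero_smul] at hsum
  have hz : hD'.toLp _ = 0 := (hsum.unique hasSum_zero)
  have hz' := (MemLp.toLp_eq_toLp_iff hD' (MemLp.zero (ε := ℂ))).1 (by rw [hz]; rfl)
  have hz2 : (fun x => (d x : ℂ)) =ᵐ[(volume : Measure Torus)] fun _ => 0 := by
    rw [AddCircle.volume_eq_smul_haarAddCircle]
    exact Measure.ae_smul_measure hz' _
  filter_upwards [hz2] with x hx
  exact_mod_cast hx

theorem cosT_zero (x : Torus) : cosT 0 x = 1 := by simp [cosT]

theorem sinT_zero (x : Torus) : sinT 0 x = 0 := by simp [sinT]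

theorem volume_real_univ_torus : (volume : Measure Torus).real Set.univ = 2 * Real.pi := by
  rw [measureReal_def, AddCircle.measure_univ, ENNReal.toReal_ofReal Real.two_pi_pos.le]

/-- For n ≠ 0, cos(nx) and sin(nx) are themselves derivatives up to a factor ±n, so the hypothesis
kills every nonconstant mode; subtracting the mean kills the remaining one. -/
theorem ae_const_of_integral_circDeriv {d : Torus → ℝ} (hd : MemLp d 2 volume)
    (h : ∀ η, Smooth η → ∫ x, d x * circDeriv η x = 0) : ∃ c, d =ᵐ[volume] fun _ => c := by
  set c := (∫ x, d x) / (2 * Real.pi) with hc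
  have hpi := Real.two_pi_pos.ne'
  have hdc : MemLp (fun x => d x - c) 2 volume := hd.sub (memLp_const c)
  have hcos : ∀ n : ℤ, n ≠ 0 → ∀ e : Torus → ℝ, (∀ η, Smooth η → ∫ x, e x * circDeriv η x = 0) →
      ∫ x, e x * cosT n x = 0 := by
    intro n hn e he
    have := he _ (smooth_sinT n)
    simp only [circDeriv_sinT, mul_left_comm _ (n : ℝ), integral_const_mul] at this
    exact (mul_eq_zero.1 this).resolve_left (by exact_mod_cast hn)
  have hsin : ∀ n : ℤ, n ≠ 0 → ∀ e : Torus → ℝ, (∀ η, Smooth η → ∫ x, e x * circDeriv η x = 0) →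
      ∫ x, e x * sinT n x = 0 := by
    intro n hn e he
    have := he _ (smooth_cosT n)
    simp only [circDeriv_cosT, mul_neg, mul_left_comm _ (n : ℝ), integral_neg, integral_const_mul,
      neg_eq_zero] at this
    exact (mul_eq_zero.1 this).resolve_left (by exact_mod_cast hn)
  have hconst : ∀ η, Smooth η → ∫ x, (d x - c) * circDeriv η x = 0 := by
    intro η hη
    simp only [sub_mul]
    rw [integral_sub (integrable_mul_of_continuous hη.continuous_circDeriv hd)
      ((integrable_of_memLp_two hη.hasPrim.1).const_mul c), h η hη, integral_const_mul,
      hη.hasPrim.integral_eq_zero]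
    simp
  have h0 : (fun x => d x - c) =ᵐ[volume] 0 := by
    refine ae_eq_zero_of_integral_trig hdc (fun n => ?_) (fun n => ?_)
    · rcases eq_or_ne n 0 with rfl | hn
      · simp only [cosT_zero, mul_one]
        rw [integral_sub (integrable_of_memLp_two hd) (integrable_const c), integral_const,
          volume_real_univ_torus, smul_eq_mul, hc]
        field_simp
        ring
      · exact hcos n hn _ hconst
    · rcases eq_or_ne n 0 with rfl | hn
      · simp [sinT_zero]
      · exact hsin n hn _ hconst
  refine ⟨c, ?_⟩
  filter_upwards [h0] with x hx
  simpa [sub_eq_zero] using hx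

theorem ae_eq_zero_of_integral_smooth {d : Torus → ℝ} (hd : MemLp d 2 volume)
    (h : ∀ η, Smooth η → ∫ x, d x * η x = 0) : d =ᵐ[volume] 0 :=
  ae_eq_zero_of_integral_trig hd (fun n => h _ (smooth_cosT n)) (fun n => h _ (smooth_sinT n))

/-! ### Weak derivatives and primitives are the same up to null sets. -/

theorem HasPrim.hasWeakDeriv {F f g : Torus → ℝ} (h : HasPrim F g) (hf : f =ᵐ[volume] F) :
    HasWeakDeriv f g := by
  refine ⟨h.1, fun η hη => ?_⟩
  rw [← h.integral_mul_eq (Smooth.hasPrim hη)]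
  refine integral_congr_ae ?_
  filter_upwards [hf] with x hx
  rw [hx]

theorem HasWeakDeriv.ae_unique {f f' g g' : Torus → ℝ} (h : HasWeakDeriv f g)
    (h' : HasWeakDeriv f' g') (hf : f =ᵐ[volume] f') : g =ᵐ[volume] g' := by
  have h0 : (fun x => g x - g' x) =ᵐ[volume] 0 := by
    refine ae_eq_zero_of_integral_smooth (h.1.sub h'.1) fun η hη => ?_
    simp only [sub_mul]
    rw [integral_sub (integrable_mul_of_continuous hη.continuous h.1)
      (integrable_mul_of_continuous hη.continuous h'.1)]
    have e1 := h.2 η hη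
    have e2 := h'.2 η hη
    have e3 : ∫ x, f x * circDeriv η x = ∫ x, f' x * circDeriv η x := by
      refine integral_congr_ae ?_
      filter_upwards [hf] with x hx
      rw [hx]
    linarith
  filter_upwards [h0] with x hx
  simpa [sub_eq_zero] using hx

theorem smooth_const (c : ℝ) : Smooth fun _ => c := contDiff_const

theorem circDeriv_const (c : ℝ) (x : Torus) : circDeriv (fun _ => c) x = 0 := by
  simp [circDeriv]

/-- Testing against the constant 1 shows that `g` has mean zero, so it has a periodic primitive; `f`
minus that primitive has zero weak derivative and is a.e. constant. This supplies the continuous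
representative on which all later computations are done. -/
theorem HasWeakDeriv.exists_hasPrim {f g : Torus → ℝ} (hf : MemLp f 2 volume)
    (h : HasWeakDeriv f g) : ∃ F, f =ᵐ[volume] F ∧ HasPrim F g := by
  have h0 : ∫ x, g x = 0 := by
    have := h.2 (fun _ => 1) (smooth_const 1)
    simpa [circDeriv_const] using this
  obtain ⟨F, hF⟩ := HighTemp.exists_hasPrim h.1 h0
  obtain ⟨c, hc⟩ := ae_const_of_integral_circDeriv (hf.sub (hF.memLp 2)) fun η hη => by
    simp only [Pi.sub_apply, sub_mul]
    rw [integral_sub (integrable_mul_of_continuous hη.continuous_circDeriv hf)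
      (integrable_mul_of_continuous hη.continuous_circDeriv (hF.memLp 2)), h.2 η hη,
      (hF.hasWeakDeriv ae_eq_rfl).2 η hη, sub_self]
  refine ⟨fun x => F x + c, ?_, hF.add_const c⟩
  filter_upwards [hc] with x hx
  simp only [Pi.sub_apply] at hx
  linarith

theorem weakDeriv_spec {f g : Torus → ℝ} (h : HasWeakDeriv f g) :
    HasWeakDeriv f (weakDeriv f) := Classical.epsilon_spec (p := HasWeakDeriv f) ⟨g, h⟩

theorem HasWeakDeriv.weakDeriv_ae_eq {f g : Torus → ℝ} (h : HasWeakDeriv f g) :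
    weakDeriv f =ᵐ[volume] g := (weakDeriv_spec h).ae_unique h ae_eq_rfl

theorem MemH1.hasWeakDeriv {f : Torus → ℝ} (h : MemH1 f) : HasWeakDeriv f (weakDeriv f) :=
  weakDeriv_spec h.2.choose_spec

theorem MemH1.exists_hasPrim {f : Torus → ℝ} (h : MemH1 f) :
    ∃ F, f =ᵐ[volume] F ∧ HasPrim F (weakDeriv f) := h.hasWeakDeriv.exists_hasPrim h.1

theorem HasPrim.memH1 {F f g : Torus → ℝ} (h : HasPrim F g) (hf : f =ᵐ[volume] F) : MemH1 f :=
  ⟨(memLp_congr_ae hf).2 (h.memLp 2), g, h.hasWeakDeriv hf⟩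

theorem HasPrim.weakDeriv_ae_eq {F f g : Torus → ℝ} (h : HasPrim F g) (hf : f =ᵐ[volume] F) :
    weakDeriv f =ᵐ[volume] g := (h.hasWeakDeriv hf).weakDeriv_ae_eq

/-! ### Difference quotients -/

/-- The bound makes `T` factor through a bounded functional on the range of `j`; Hahn–Banach extends
it to all of `H` and Riesz represents it. No density of the range is needed. -/
theorem exists_riesz_of_bound {E H : Type*} [AddCommGroup E] [Module ℝ E]
    [NormedAddCommGroup H] [InnerProductSpace ℝ H] [CompleteSpace H]
    (j : E →ₗ[ℝ] H) (T : E →ₗ[ℝ] ℝ) (C : ℝ) (hT : ∀ e, |T e| ≤ C * ‖j e‖) :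
    ∃ g : H, ∀ e, T e = inner ℝ g (j e) := by
  have hker : LinearMap.ker j ≤ LinearMap.ker T := by
    intro e he
    rw [LinearMap.mem_ker] at he ⊢
    have := hT e
    rw [he, norm_zero, mul_zero] at this
    exact abs_nonpos_iff.1 this
  let S : LinearMap.range j →ₗ[ℝ] ℝ :=
    ((LinearMap.ker j).liftQ T hker).comp (j.quotKerEquivRange.symm : LinearMap.range j →ₗ[ℝ] _)
  have hS : ∀ e, S ⟨j e, e, rfl⟩ = T e := by
    intro e
    have e1 : j.quotKerEquivRange.symm ⟨j e, e, rfl⟩ = (LinearMap.ker j).mkQ e :=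
      j.quotKerEquivRange_symm_apply_image e _
    simp only [S, LinearMap.comp_apply, LinearEquiv.coe_coe, e1]
    rfl
  have hb : ∀ y, ‖S y‖ ≤ C * ‖y‖ := by
    rintro ⟨_, e, rfl⟩
    rw [hS]
    exact hT e
  obtain ⟨g, hg, -⟩ := exists_extension_norm_eq (LinearMap.range j) (S.mkContinuous C hb)
  refine ⟨(InnerProductSpace.toDual ℝ H).symm g, fun e => ?_⟩
  rw [InnerProductSpace.toDual_symm_apply, ← hS e]
  exact (hg ⟨j e, e, rfl⟩).symm

theorem Smooth.add {η θ : Torus → ℝ} (h1 : Smooth η) (h2 : Smooth θ) : Smooth (η + θ) :=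
  ContDiff.add h1 h2

theorem Smooth.const_smul {η : Torus → ℝ} (c : ℝ) (h : Smooth η) : Smooth (c • η) :=
  ContDiff.const_smul c h

/-- The vector space of smooth functions on the torus. -/
def smoothSubmodule : Submodule ℝ (Torus → ℝ) where
  carrier := {η | Smooth η}
  add_mem' h1 h2 := Smooth.add h1 h2
  zero_mem' := smooth_const 0
  smul_mem' c _ h := Smooth.const_smul c h

theorem circDeriv_add {η θ : Torus → ℝ} (h1 : Smooth η) (h2 : Smooth θ) (x : Torus) :
    circDeriv (η + θ) x = circDeriv η x + circDeriv θ x := by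
  induction x using QuotientAddGroup.induction_on with
  | H t => exact (circDeriv_coe _ t).trans ((h1.hasDerivAt t).add (h2.hasDerivAt t)).deriv

theorem circDeriv_smul {η : Torus → ℝ} (c : ℝ) (h1 : Smooth η) (x : Torus) :
    circDeriv (c • η) x = c * circDeriv η x := by
  induction x using QuotientAddGroup.induction_on with
  | H t => exact (circDeriv_coe _ t).trans ((h1.hasDerivAt t).const_mul c).deriv

/-- By duality: the functional η ↦ ∫ f η' is bounded for the L² norm of η, and minus its Riesz
representative is the weak derivative. -/
theorem exists_hasWeakDeriv_of_bound {f : Torus → ℝ} (hf : MemLp f 2 volume) (C : ℝ)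
    (h : ∀ η, Smooth η → |∫ x, f x * circDeriv η x| ≤ C * Real.sqrt (∫ x, η x ^ 2)) :
    ∃ g, HasWeakDeriv f g := by
  let j : smoothSubmodule →ₗ[ℝ] Lp ℝ 2 (volume : Measure Torus) :=
    { toFun := fun η => (memLp_of_continuous (Smooth.continuous η.2) 2).toLp _
      map_add' := fun _ _ => rfl
      map_smul' := fun _ _ => rfl }
  let T : smoothSubmodule →ₗ[ℝ] ℝ :=
    { toFun := fun η => ∫ x, f x * circDeriv η x
      map_add' := fun η θ => by
        rw [← integral_add (integrable_mul_of_continuous (Smooth.continuous_circDeriv η.2) hf)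
          (integrable_mul_of_continuous (Smooth.continuous_circDeriv θ.2) hf)]
        refine integral_congr_ae (ae_of_all _ fun x => ?_)
        simp only [Submodule.coe_add, circDeriv_add η.2 θ.2, mul_add]
      map_smul' := fun c η => by
        simp only [RingHom.id_apply, smul_eq_mul]
        rw [← integral_const_mul]
        refine integral_congr_ae (ae_of_all _ fun x => ?_)
        simp only [Submodule.coe_smul, circDeriv_smul c η.2]
        ring }
  have hj : ∀ η : smoothSubmodule, (j η : Torus → ℝ) =ᵐ[volume] η := fun η =>
    (memLp_of_continuous (Smooth.continuous η.2) 2).coeFn_toLp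
  have hnorm : ∀ η : smoothSubmodule, ‖j η‖ = Real.sqrt (∫ x, (η : Torus → ℝ) x ^ 2) := by
    intro η
    rw [norm_eq_sqrt_real_inner, L2.inner_def]
    congr 1
    refine integral_congr_ae ?_
    filter_upwards [hj η] with x hx
    simp [hx, sq]
  obtain ⟨g, hg⟩ := exists_riesz_of_bound j T C fun η => by rw [hnorm]; exact h η η.2
  refine ⟨fun x => -g x, (Lp.memLp g).neg, fun η hη => ?_⟩
  have := hg ⟨η, hη⟩
  rw [L2.inner_def] at this
  simp only [T, LinearMap.coe_mk, AddHom.coe_mk] at this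
  rw [this]
  simp only [neg_mul, integral_neg, neg_neg]
  refine integral_congr_ae ?_
  filter_upwards [hj ⟨η, hη⟩] with x hx
  simp [hx, mul_comm]

theorem MemLp.comp_add_torus {f : Torus → ℝ} (hf : MemLp f 2 volume) (h : Torus) :
    MemLp (fun x => f (x + h)) 2 volume :=
  hf.comp_measurePreserving (measurePreserving_add_right volume h)

/-- Translation invariance moves the difference quotient from the test function to `f`, where
Cauchy–Schwarz applies; the limit of small shifts then bounds ∫ f η' by C‖η‖. -/
theorem exists_hasWeakDeriv_of_difference_le {f : Torus → ℝ} (hf : MemLp f 2 volume) {C : ℝ}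
    (hC : 0 ≤ C)
    (h : ∀ s : ℝ, 0 < s → ∫ x, (f (x + (s : Torus)) - f x) ^ 2 ≤ (C * s) ^ 2) :
    ∃ g, HasWeakDeriv f g := by
  refine exists_hasWeakDeriv_of_bound hf C fun η hη => ?_
  obtain ⟨K, -, hK⟩ := exists_bound_of_continuous hη.continuous_circDeriv
  let s : ℕ → ℝ := fun n => 1 / ((n : ℝ) + 1)
  have hs : ∀ n, 0 < s n := fun n => Nat.one_div_pos_of_nat
  have hs0 : Tendsto s atTop (𝓝 0) := tendsto_one_div_add_atTop_nhds_zero_nat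
  have hlip : ∀ (x : Torus) (r : ℝ), |η (x + ((-r : ℝ) : Torus)) - η x| ≤ K * |r| := by
    intro x r
    induction x using QuotientAddGroup.induction_on with
    | H t =>
      have h1 := (convex_univ (𝕜 := ℝ) (E := ℝ)).norm_image_sub_le_of_norm_hasDerivWithin_le
        (f := fun t : ℝ => η t) (f' := fun t : ℝ => circDeriv η t) (C := K)
        (fun t _ => (hη.hasDerivAt t).hasDerivWithinAt) (fun t _ => hK t)
        (Set.mem_univ t) (Set.mem_univ (t + -r))
      have h2 : ‖t + -r - t‖ = |r| := by rw [Real.norm_eq_abs]; simp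
      rw [h2] at h1
      exact h1
  -- The test function is shifted by -s, so that after translation `f` is shifted by +s, the only
  -- sign covered by the hypothesis.
  have hlim : Tendsto (fun n => ∫ x, f x * ((η (x + ((-s n : ℝ) : Torus)) - η x) / (-s n))) atTop
      (𝓝 (∫ x, f x * circDeriv η x)) := by
    have hsh : ∀ n, Continuous fun x => (η (x + ((-s n : ℝ) : Torus)) - η x) / (-s n) := by
      intro n
      have := hη.continuous
      fun_prop
    refine tendsto_integral_of_dominated_convergence (fun x => |f x| * K)
      (fun n => hf.1.mul (hsh n).aestronglyMeasurable)
      ((integrable_of_memLp_two hf).abs.mul_const K) (fun n => ae_of_all _ fun x => ?_)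
      (ae_of_all _ fun x => ?_)
    · rw [norm_mul, Real.norm_eq_abs, Real.norm_eq_abs, abs_div, abs_neg]
      refine mul_le_mul_of_nonneg_left ?_ (abs_nonneg _)
      rw [div_le_iff₀ (abs_pos.2 (hs n).ne')]
      exact hlip x (s n)
    · refine Tendsto.const_mul _ ?_
      induction x using QuotientAddGroup.induction_on with
      | H t =>
        have h1 := (hη.hasDerivAt t).tendsto_slope_zero
        have h2 : Tendsto (fun n => -s n) atTop (𝓝[≠] 0) := by
          refine tendsto_nhdsWithin_iff.2 ⟨by simpa using hs0.neg, ?_⟩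
          filter_upwards with n
          simpa using (hs n).ne'
        have h3 := h1.comp h2
        refine h3.congr fun n => ?_
        simp only [Function.comp_apply, smul_eq_mul, div_eq_inv_mul]
        rfl
  refine le_of_tendsto hlim.abs (Eventually.of_forall fun n => ?_)
  have hηL : MemLp η 2 volume := memLp_of_continuous hη.continuous 2
  have e1 : ∫ x, f x * η (x + ((-s n : ℝ) : Torus)) = ∫ x, f (x + (s n : Torus)) * η x := by
    rw [← integral_add_right_eq_self (fun x => f x * η (x + ((-s n : ℝ) : Torus))) (s n : Torus)]
    simp
  have hi1 : Integrable fun x => f x * η (x + ((-s n : ℝ) : Torus)) :=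
    hf.integrable_mul (MemLp.comp_add_torus hηL _)
  have hi2 : Integrable fun x => f x * η x := hf.integrable_mul hηL
  have hi3 : Integrable fun x => f (x + (s n : Torus)) * η x :=
    (MemLp.comp_add_torus hf _).integrable_mul hηL
  have e2 : ∫ x, f x * ((η (x + ((-s n : ℝ) : Torus)) - η x) / (-s n)) =
      (-s n)⁻¹ * ∫ x, (f (x + (s n : Torus)) - f x) * η x := by
    have : ∀ x, f x * ((η (x + ((-s n : ℝ) : Torus)) - η x) / (-s n)) =
        (-s n)⁻¹ * (f x * η (x + ((-s n : ℝ) : Torus)) - f x * η x) := fun x => by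
      rw [div_eq_inv_mul]; ring
    simp_rw [this, sub_mul]
    rw [integral_const_mul, integral_sub hi1 hi2, integral_sub hi3 hi2, e1]
  rw [e2, abs_mul, abs_inv, abs_neg, abs_of_pos (hs n), inv_mul_le_iff₀ (hs n)]
  refine (abs_integral_mul_le ((MemLp.comp_add_torus hf _).sub hf) hηL).trans ?_
  rw [← mul_assoc]
  refine mul_le_mul_of_nonneg_right ?_ (Real.sqrt_nonneg _)
  rw [mul_comm (s n)]
  exact (Real.sqrt_le_sqrt (h (s n) (hs n))).trans_eq
    (Real.sqrt_sq (mul_nonneg hC (hs n).le))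

/-! ### The logarithmic kernel -/

theorem torus_forall {P : Torus → Prop} (h : ∀ t : ℝ, P t) (x : Torus) : P x := by
  induction x using QuotientAddGroup.induction_on with
  | H t => exact h t

theorem absSinHalf_coe (t : ℝ) : absSinHalf (t : Torus) = |Real.sin (t / 2)| :=
  abs_sin_half_periodic.lift_coe t

theorem cotHalf_coe (t : ℝ) : cotHalf (t : Torus) = 1 / Real.tan (t / 2) :=
  cot_half_periodic.lift_coe t

theorem continuous_absSinHalf : Continuous absSinHalf := by
  refine continuous_of_continuous_coe ?_
  simp only [absSinHalf_coe]
  fun_prop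

theorem absSinHalf_nonneg (x : Torus) : 0 ≤ absSinHalf x :=
  torus_forall (P := fun x => 0 ≤ absSinHalf x) (fun t => by rw [absSinHalf_coe]; positivity) x

theorem absSinHalf_le_one (x : Torus) : absSinHalf x ≤ 1 :=
  torus_forall (P := fun x => absSinHalf x ≤ 1)
    (fun t => by rw [absSinHalf_coe]; exact Real.abs_sin_le_one _) x

theorem absSinHalf_neg (x : Torus) : absSinHalf (-x) = absSinHalf x :=
  torus_forall (P := fun x => absSinHalf (-x) = absSinHalf x)
    (fun t => by
      rw [← AddCircle.coe_neg, absSinHalf_coe, absSinHalf_coe, neg_div, Real.sin_neg, abs_neg]) x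

theorem absSinHalf_eq_zero {x : Torus} (h : absSinHalf x = 0) : x = 0 := by
  induction x using QuotientAddGroup.induction_on with
  | H t =>
    have h1 : |Real.sin (t / 2)| = 0 := by rw [← absSinHalf_coe]; exact h
    obtain ⟨n, hn⟩ := Real.sin_eq_zero_iff.1 (abs_eq_zero.1 h1)
    rw [QuotientAddGroup.eq_zero_iff, AddSubgroup.mem_zmultiples_iff]
    refine ⟨n, ?_⟩
    rw [zsmul_eq_mul]; linarith

theorem absSinHalf_pos {x : Torus} (h : x ≠ 0) : 0 < absSinHalf x :=
  (absSinHalf_nonneg x).lt_of_ne fun h0 => h (absSinHalf_eq_zero h0.symm)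

theorem absSinHalf_zero : absSinHalf 0 = 0 := by
  have := absSinHalf_coe 0
  simpa using this

/-- The real-valued logarithmic kernel. -/
def kernelR (x : Torus) : ℝ := -Real.log (absSinHalf x)

theorem kernelR_nonneg (x : Torus) : 0 ≤ kernelR x :=
  neg_nonneg.2 (Real.log_nonpos (absSinHalf_nonneg x) (absSinHalf_le_one x))

theorem kernelR_neg (x : Torus) : kernelR (-x) = kernelR x := by
  rw [kernelR, absSinHalf_neg, kernelR]

theorem kernelR_sub_comm (x y : Torus) : kernelR (x - y) = kernelR (y - x) := by
  rw [← neg_sub, kernelR_neg]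

theorem measurable_kernelR : Measurable kernelR :=
  (Real.measurable_log.comp continuous_absSinHalf.measurable).neg

theorem logKernel_of_ne {x : Torus} (h : x ≠ 0) : logKernel x = ENNReal.ofReal (kernelR x) := by
  rw [logKernel, if_neg h, kernelR]

theorem logKernel_zero : logKernel 0 = ⊤ := by rw [logKernel, if_pos rfl]

theorem measurable_logKernel : Measurable logKernel := by
  unfold logKernel
  exact Measurable.ite (measurableSet_singleton 0) measurable_const
    measurable_kernelR.ennreal_ofReal

theorem logKernel_neg (x : Torus) : logKernel (-x) = logKernel x := by
  by_cases h : x = 0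
  · simp [h]
  · rw [logKernel_of_ne h, logKernel_of_ne (neg_ne_zero.2 h), kernelR_neg]

theorem logKernel_sub_comm (x y : Torus) : logKernel (x - y) = logKernel (y - x) := by
  rw [← neg_sub, logKernel_neg]

/-- Jordan's inequality gives |sin(t/2)| ≥ |t|/π, and a logarithm is below any power. The exponent
1/4 is chosen so that the square of the bound is of order |t|^(-1/2), still integrable at 0. -/
theorem kernelR_le {t : ℝ} (ht : |t| ≤ Real.pi) (h0 : t ≠ 0) :
    kernelR (t : Torus) ≤ 4 * (Real.pi / |t|) ^ (1 / 4 : ℝ) := by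
  have ht0 : 0 < |t| := abs_pos.2 h0
  have h1 : |t| / Real.pi ≤ |Real.sin (t / 2)| := by
    have := Real.mul_abs_le_abs_sin (x := t / 2) (by rw [abs_div, abs_two]; linarith)
    rw [abs_div, abs_two] at this
    refine le_trans (le_of_eq ?_) this
    field_simp
  rw [kernelR, absSinHalf_coe]
  calc -Real.log |Real.sin (t / 2)| ≤ -Real.log (|t| / Real.pi) :=
        neg_le_neg (Real.log_le_log (div_pos ht0 Real.pi_pos) h1)
    _ = Real.log (Real.pi / |t|) := by rw [← Real.log_inv, inv_div]
    _ ≤ (Real.pi / |t|) ^ (1 / 4 : ℝ) / (1 / 4) :=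
        Real.log_le_rpow_div (by positivity) (by norm_num)
    _ = _ := by ring

theorem memLp_kernelR : MemLp kernelR 2 volume := by
  rw [memLp_two_iff_integrable_sq measurable_kernelR.aestronglyMeasurable]
  have hmp := AddCircle.measurePreserving_mk (2 * Real.pi) (-Real.pi)
  rw [← hmp.integrable_comp (measurable_kernelR.pow_const 2).aestronglyMeasurable]
  have hpos : IntervalIntegrable (fun t : ℝ => |t| ^ (-(1 / 2) : ℝ)) volume 0 Real.pi := by
    refine (intervalIntegral.intervalIntegrable_rpow' (r := -(1 / 2)) (by norm_num)).congr ?_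
    intro t ht
    rw [Set.uIoc_of_le Real.pi_pos.le] at ht
    simp only [abs_of_pos ht.1]
  have hneg : IntervalIntegrable (fun t : ℝ => |t| ^ (-(1 / 2) : ℝ)) volume (-Real.pi) 0 := by
    have := hpos.symm
    rw [IntervalIntegrable.iff_comp_neg] at this
    simpa using this
  have hint := (hneg.trans hpos).const_mul (16 * Real.pi ^ (1 / 2 : ℝ))
  rw [intervalIntegrable_iff_integrableOn_Ioc_of_le (by linarith [Real.pi_pos])] at hint
  have e : -Real.pi + 2 * Real.pi = Real.pi := by ring
  rw [e]
  refine Integrable.mono' hint ?_ ?_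
  · exact ((measurable_kernelR.pow_const 2).comp
      continuous_coe_torus.measurable).aestronglyMeasurable
  · have hne : ∀ᵐ t : ℝ ∂(volume.restrict (Set.Ioc (-Real.pi) Real.pi)), t ≠ 0 :=
      ae_restrict_of_ae (by simp [ae_iff])
    filter_upwards [hne, ae_restrict_mem measurableSet_Ioc] with t ht htm
    have habs : |t| ≤ Real.pi := abs_le.2 ⟨htm.1.le, htm.2⟩
    have ht0 : 0 < |t| := abs_pos.2 ht
    simp only [Function.comp_apply]
    rw [Real.norm_eq_abs, abs_of_nonneg (sq_nonneg _)]
    have hb := kernelR_le habs ht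
    calc kernelR (t : Torus) ^ 2 ≤ (4 * (Real.pi / |t|) ^ (1 / 4 : ℝ)) ^ 2 :=
          pow_le_pow_left₀ (kernelR_nonneg _) hb 2
      _ = 16 * (Real.pi / |t|) ^ (1 / 2 : ℝ) := by
          rw [mul_pow, ← Real.rpow_natCast ((Real.pi / |t|) ^ (1 / 4 : ℝ)), ← Real.rpow_mul
            (by positivity)]
          norm_num
      _ = _ := by
          rw [Real.div_rpow Real.pi_pos.le ht0.le, Real.rpow_neg ht0.le, div_eq_mul_inv]; ring

theorem memLp_kernelR_sub (x : Torus) : MemLp (fun y => kernelR (x - y)) 2 volume := by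
  have e : (fun y => kernelR (x - y)) = fun y => kernelR (y + -x) :=
    funext fun y => by rw [kernelR_sub_comm, sub_eq_add_neg]
  rw [e]
  exact MemLp.comp_add_torus memLp_kernelR (-x)

/-- The logarithmic potential of a function. -/
def pot (w : Torus → ℝ) (x : Torus) : ℝ := ∫ y, kernelR (x - y) * w y

/-- The `L²` norm of the logarithmic kernel. -/
def kernelNorm : ℝ := Real.sqrt (∫ x, kernelR x ^ 2)

theorem kernelNorm_nonneg : 0 ≤ kernelNorm := Real.sqrt_nonneg _

/-- Cauchy–Schwarz, uniform in `x` because the norm of the kernel is translation invariant: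
potentials of L² functions are bounded. -/
theorem abs_pot_le {w : Torus → ℝ} (hw : MemLp w 2 volume) (x : Torus) :
    |pot w x| ≤ kernelNorm * Real.sqrt (∫ y, w y ^ 2) := by
  refine (abs_integral_mul_le (memLp_kernelR_sub x) hw).trans_eq ?_
  rw [integral_sub_left_eq_self (fun y => kernelR y ^ 2) volume x, kernelNorm]

theorem integrable_kernelR_mul {w : Torus → ℝ} (hw : MemLp w 2 volume) (x : Torus) :
    Integrable fun y => kernelR (x - y) * w y := (memLp_kernelR_sub x).integrable_mul hw

theorem pot_add {v w : Torus → ℝ} (hv : MemLp v 2 volume) (hw : MemLp w 2 volume) (x : Torus) :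
    pot (fun y => v y + w y) x = pot v x + pot w x := by
  unfold pot
  rw [← integral_add (integrable_kernelR_mul hv x) (integrable_kernelR_mul hw x)]
  simp only [mul_add]

theorem pot_sub {v w : Torus → ℝ} (hv : MemLp v 2 volume) (hw : MemLp w 2 volume) (x : Torus) :
    pot (fun y => v y - w y) x = pot v x - pot w x := by
  unfold pot
  rw [← integral_sub (integrable_kernelR_mul hv x) (integrable_kernelR_mul hw x)]
  simp only [mul_sub]

theorem pot_const_mul (c : ℝ) (w : Torus → ℝ) (x : Torus) :
    pot (fun y => c * w y) x = c * pot w x := by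
  unfold pot
  rw [← integral_const_mul]
  simp only [mul_left_comm]

theorem pot_congr {v w : Torus → ℝ} (h : v =ᵐ[volume] w) (x : Torus) : pot v x = pot w x := by
  refine integral_congr_ae ?_
  filter_upwards [h] with y hy
  rw [hy]

theorem pot_comp_add (w : Torus → ℝ) (h x : Torus) :
    pot (fun y => w (y + h)) x = pot w (x + h) := by
  unfold pot
  rw [← integral_add_right_eq_self (fun y => kernelR (x + h - y) * w y) h]
  simp only [add_sub_add_right_eq_sub]

theorem measurable_kernelR_prod : Measurable fun z : Torus × Torus => kernelR (z.1 - z.2) :=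
  measurable_kernelR.comp (measurable_fst.sub measurable_snd)

theorem memLp_kernelR_prod :
    MemLp (fun z : Torus × Torus => kernelR (z.1 - z.2)) 2 (volume.prod volume) := by
  rw [memLp_two_iff_integrable_sq measurable_kernelR_prod.aestronglyMeasurable]
  -- The squared kernel on the product is the integrand of the convolution of 1 with an integrable
  -- function.
  have := Integrable.convolution_integrand (𝕜 := ℝ) (G := Torus) (μ := volume) (ν := volume)
    (f := fun _ => (1 : ℝ)) (g := fun x => kernelR x ^ 2) (ContinuousLinearMap.mul ℝ ℝ)
    (integrable_const _) memLp_kernelR.integrable_sq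
  simpa using this

theorem memLp_mul_prod {v w : Torus → ℝ} (hv : MemLp v 2 volume) (hw : MemLp w 2 volume) :
    MemLp (fun z : Torus × Torus => v z.1 * w z.2) 2 (volume.prod volume) := by
  have hm : AEStronglyMeasurable (fun z : Torus × Torus => v z.1 * w z.2)
      (volume.prod volume) := hv.1.comp_fst.mul hw.1.comp_snd
  rw [memLp_two_iff_integrable_sq hm]
  simp only [mul_pow]
  exact hv.integrable_sq.mul_prod hw.integrable_sq

theorem integrable_kernelR_prod {v w : Torus → ℝ} (hv : MemLp v 2 volume)
    (hw : MemLp w 2 volume) :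
    Integrable (fun z : Torus × Torus => kernelR (z.1 - z.2) * (v z.1 * w z.2))
      (volume.prod volume) :=
  memLp_kernelR_prod.integrable_mul (memLp_mul_prod hv hw)

theorem memLp_pot {w : Torus → ℝ} (hw : MemLp w 2 volume) (p : ℝ≥0∞) :
    MemLp (pot w) p volume := by
  refine MemLp.of_bound ?_ (kernelNorm * Real.sqrt (∫ y, w y ^ 2))
    (ae_of_all _ fun x => abs_pot_le hw x)
  exact AEStronglyMeasurable.integral_prod_right' (f := fun z : Torus × Torus =>
    kernelR (z.1 - z.2) * w z.2)
    (measurable_kernelR_prod.aestronglyMeasurable.mul hw.1.comp_snd)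

theorem integral_mul_pot {v w : Torus → ℝ} (hv : MemLp v 2 volume) (hw : MemLp w 2 volume) :
    ∫ x, v x * pot w x =
      ∫ z : Torus × Torus, kernelR (z.1 - z.2) * (v z.1 * w z.2) ∂(volume.prod volume) := by
  rw [integral_prod _ (integrable_kernelR_prod hv hw)]
  refine integral_congr_ae (ae_of_all _ fun x => ?_)
  simp only [pot, ← integral_const_mul]
  refine integral_congr_ae (ae_of_all _ fun y => ?_)
  ring

/-! ### Positive definiteness -/

/-- Kernels that are finite sums of products `a x * a y` of continuous functions. -/
def FinitePD (K : Torus → Torus → ℝ) : Prop :=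
  ∃ (ι : Type) (_ : Fintype ι) (a : ι → Torus → ℝ), (∀ i, Continuous (a i)) ∧
    ∀ x y, K x y = ∑ i, a i x * a i y

/-- The Schur product theorem, trivial in this form: the new factors are the products of the old
ones. -/
theorem FinitePD.mul {K L : Torus → Torus → ℝ} (hK : FinitePD K) (hL : FinitePD L) :
    FinitePD fun x y => K x y * L x y := by
  obtain ⟨ι, _, a, ha, hK⟩ := hK
  obtain ⟨κ, _, b, hb, hL⟩ := hL
  refine ⟨ι × κ, inferInstance, fun p x => a p.1 x * b p.2 x,
    fun p => (ha p.1).mul (hb p.2), fun x y => ?_⟩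
  change K x y * L x y = _
  rw [hK, hL, Finset.sum_mul_sum, Fintype.sum_prod_type]
  refine Finset.sum_congr rfl fun i _ => Finset.sum_congr rfl fun j _ => ?_
  ring

theorem finitePD_const {c : ℝ} (hc : 0 ≤ c) : FinitePD fun _ _ => c :=
  ⟨Unit, inferInstance, fun _ _ => Real.sqrt c, fun _ => continuous_const, fun x y => by
    simp [Real.mul_self_sqrt hc]⟩

theorem FinitePD.pow {K : Torus → Torus → ℝ} (hK : FinitePD K) (n : ℕ) :
    FinitePD fun x y => K x y ^ n := by
  induction n with
  | zero => simpa using finitePD_const zero_le_one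
  | succ n ih => simpa only [pow_succ] using ih.mul hK

/-- The function `cos² (θ / 2)`. -/
def cosSqHalf (x : Torus) : ℝ := (1 + cosT 1 x) / 2

theorem cosSqHalf_eq (x : Torus) : cosSqHalf x = 1 - absSinHalf x ^ 2 := by
  refine torus_forall (P := fun x => cosSqHalf x = 1 - absSinHalf x ^ 2) (fun t => ?_) x
  rw [cosSqHalf, cosT_coe, absSinHalf_coe, sq_abs]
  have h : Real.cos (2 * (t / 2)) = 1 - 2 * Real.sin (t / 2) ^ 2 := by
    rw [Real.cos_two_mul, Real.cos_sq']; ring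
  rw [show (2 : ℝ) * (t / 2) = t by ring] at h
  push_cast
  rw [one_mul, h]; ring

theorem continuous_cosSqHalf : Continuous cosSqHalf := by
  have := (smooth_cosT 1).continuous
  unfold cosSqHalf
  fun_prop

theorem cosSqHalf_nonneg (x : Torus) : 0 ≤ cosSqHalf x := by
  rw [cosSqHalf_eq]
  nlinarith [absSinHalf_nonneg x, absSinHalf_le_one x]

theorem cosSqHalf_lt_one {x : Torus} (h : x ≠ 0) : cosSqHalf x < 1 := by
  rw [cosSqHalf_eq]
  have := absSinHalf_pos h
  nlinarith

theorem cosT_sub (x y : Torus) :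
    cosT 1 (x - y) = cosT 1 x * cosT 1 y + sinT 1 x * sinT 1 y := by
  revert y
  refine torus_forall (P := fun x => ∀ y, cosT 1 (x - y) = cosT 1 x * cosT 1 y +
    sinT 1 x * sinT 1 y) (fun s => torus_forall fun t => ?_) x
  rw [← AddCircle.coe_sub]
  simp only [cosT_coe, sinT_coe]
  push_cast
  simp only [one_mul, Real.cos_sub]

/-- The addition formula: cos²((x-y)/2) = (1 + cos x cos y + sin x sin y)/2. -/
theorem finitePD_cosSqHalf : FinitePD fun x y => cosSqHalf (x - y) := by
  have h2 : Real.sqrt (1 / 2) * Real.sqrt (1 / 2) = 1 / 2 := Real.mul_self_sqrt (by norm_num)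
  refine ⟨Fin 3, inferInstance, ![fun _ => Real.sqrt (1 / 2), fun x => Real.sqrt (1 / 2) * cosT 1 x,
    fun x => Real.sqrt (1 / 2) * sinT 1 x], fun i => ?_, fun x y => ?_⟩
  · have hc := (smooth_cosT 1).continuous
    have hs := (smooth_sinT 1).continuous
    fin_cases i
    · exact continuous_const
    · exact continuous_const.mul hc
    · exact continuous_const.mul hs
  · change cosSqHalf (x - y) = _
    rw [cosSqHalf, cosT_sub, Fin.sum_univ_three]
    simp only [Matrix.cons_val_zero, Matrix.cons_val_one, Matrix.cons_val_two, Matrix.tail_cons,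
      Matrix.head_cons]
    linear_combination -(1 + cosT 1 x * cosT 1 y + sinT 1 x * sinT 1 y) * h2

/-- The terms of the positive definite expansion of the logarithmic kernel. -/
def kernelTerm (n : ℕ) (x : Torus) : ℝ := cosSqHalf x ^ (n + 1) / (2 * ((n : ℝ) + 1))

theorem continuous_kernelTerm (n : ℕ) : Continuous (kernelTerm n) :=
  (continuous_cosSqHalf.pow _).div_const _

theorem kernelTerm_nonneg (n : ℕ) (x : Torus) : 0 ≤ kernelTerm n x :=
  div_nonneg (pow_nonneg (cosSqHalf_nonneg x) _) (by positivity)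

theorem finitePD_kernelTerm (n : ℕ) : FinitePD fun x y => kernelTerm n (x - y) := by
  have := (finitePD_cosSqHalf.pow (n + 1)).mul
    (finitePD_const (c := (2 * ((n : ℝ) + 1))⁻¹) (by positivity))
  simpa only [kernelTerm, div_eq_mul_inv] using this

/-- The Taylor series of -log(1 - r)/2 at r = cos²(x/2), where 1 - r = sin²(x/2). -/
theorem hasSum_kernelTerm {x : Torus} (h : x ≠ 0) :
    HasSum (fun n => kernelTerm n x) (kernelR x) := by
  have h1 := (Real.hasSum_pow_div_log_of_abs_lt_one (x := cosSqHalf x) (by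
    rw [abs_of_nonneg (cosSqHalf_nonneg x)]; exact cosSqHalf_lt_one h)).mul_left (1 / 2)
  have e1 : (fun n => kernelTerm n x) =
      fun n : ℕ => 1 / 2 * (cosSqHalf x ^ (n + 1) / ((n : ℝ) + 1)) := by
    funext n
    rw [kernelTerm]
    field_simp
  have e2 : kernelR x = 1 / 2 * -Real.log (1 - cosSqHalf x) := by
    rw [kernelR, cosSqHalf_eq, sub_sub_cancel, Real.log_pow]
    push_cast; ring
  rw [e1, e2]
  exact h1

/-- The expansion persists at the pole: for x = 0 the terms are half of the harmonic series, whose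
divergence matches the value `⊤`. This allows measures that charge the diagonal. -/
theorem tsum_kernelTerm (x : Torus) :
    ∑' n, ENNReal.ofReal (kernelTerm n x) = logKernel x := by
  by_cases h : x = 0
  · subst h
    rw [logKernel_zero]
    by_contra hne
    have hs := ENNReal.summable_toReal hne
    have h1 : cosSqHalf 0 = 1 := by rw [cosSqHalf_eq, absSinHalf_zero]; norm_num
    have h2 : ∀ n : ℕ, (ENNReal.ofReal (kernelTerm n 0)).toReal
        = 1 / 2 * (1 / ((n + 1 : ℕ) : ℝ)) := by
      intro n
      rw [ENNReal.toReal_ofReal (kernelTerm_nonneg n 0), kernelTerm, h1]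
      push_cast
      field_simp
      simp
    simp only [h2] at hs
    rw [summable_mul_left_iff (by norm_num)] at hs
    exact Real.not_summable_one_div_natCast ((summable_nat_add_iff 1).1 hs)
  · rw [logKernel_of_ne h, ← (hasSum_kernelTerm h).tsum_eq,
      ENNReal.ofReal_tsum_of_nonneg (fun n => kernelTerm_nonneg n x) (hasSum_kernelTerm h).summable]

instance nullSingletonClass_torus : NullSingletonClass (volume : Measure Torus) where
  measure_singleton x := by
    have h := AddCircle.volume_closedBall (2 * Real.pi) (x := x) 0
    rw [Metric.closedBall_zero] at h
    rw [h]
    simp [Real.two_pi_pos.le]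

theorem ae_sub_ne_zero : ∀ᵐ z : Torus × Torus ∂(volume.prod volume), z.1 - z.2 ≠ 0 := by
  have hm : MeasurableSet {z : Torus × Torus | z.1 - z.2 = 0} :=
    (measurable_fst.sub measurable_snd) (measurableSet_singleton 0)
  rw [ae_iff]
  simp only [not_not]
  rw [Measure.prod_apply hm, lintegral_eq_zero_iff (measurable_measure_prodMk_left hm)]
  refine ae_of_all _ fun x => ?_
  have : Prod.mk x ⁻¹' {z : Torus × Torus | z.1 - z.2 = 0} = {x} := by
    ext y
    simp [sub_eq_zero, eq_comm]
  change volume (Prod.mk x ⁻¹' {z : Torus × Torus | z.1 - z.2 = 0}) = 0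
  rw [this]
  simp

/-- Each term of the expansion contributes a sum of squares (∫ a w)². The partial sums increase to
the kernel off the diagonal, a null set, so they are dominated by the kernel itself. -/
theorem integral_mul_pot_nonneg {w : Torus → ℝ} (hw : MemLp w 2 volume) :
    0 ≤ ∫ x, w x * pot w x := by
  rw [integral_mul_pot hw hw]
  have hlim : Tendsto (fun N => ∫ z : Torus × Torus,
      (∑ n ∈ Finset.range N, kernelTerm n (z.1 - z.2)) * (w z.1 * w z.2) ∂(volume.prod volume))
      atTop (𝓝 (∫ z : Torus × Torus, kernelR (z.1 - z.2) * (w z.1 * w z.2)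
        ∂(volume.prod volume))) := by
    refine tendsto_integral_of_dominated_convergence
      (fun z => ‖kernelR (z.1 - z.2) * (w z.1 * w z.2)‖) (fun N => ?_)
      (integrable_kernelR_prod hw hw).norm (fun N => ?_) ?_
    · refine AEStronglyMeasurable.mul ?_ (memLp_mul_prod hw hw).1
      refine Continuous.aestronglyMeasurable ?_
      have hsub : Continuous fun z : Torus × Torus => z.1 - z.2 := by fun_prop
      exact continuous_finsetSum _ fun n _ => (continuous_kernelTerm n).comp hsub
    · filter_upwards [ae_sub_ne_zero] with z hz
      rw [norm_mul, norm_mul (kernelR _)]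
      refine mul_le_mul_of_nonneg_right ?_ (norm_nonneg (w z.1 * w z.2))
      rw [Real.norm_eq_abs, Real.norm_eq_abs, abs_of_nonneg (kernelR_nonneg _),
        abs_of_nonneg (Finset.sum_nonneg fun n _ => kernelTerm_nonneg n _)]
      exact sum_le_hasSum _ (fun n _ => kernelTerm_nonneg n _) (hasSum_kernelTerm hz)
    · filter_upwards [ae_sub_ne_zero] with z hz
      exact (hasSum_kernelTerm hz).tendsto_sum_nat.mul_const _
  refine ge_of_tendsto hlim (Eventually.of_forall fun N => ?_)
  have hterm : ∀ n, ∃ S : ℝ, 0 ≤ S ∧ Integrable (fun z : Torus × Torus =>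
      kernelTerm n (z.1 - z.2) * (w z.1 * w z.2)) (volume.prod volume) ∧
      ∫ z : Torus × Torus, kernelTerm n (z.1 - z.2) * (w z.1 * w z.2) ∂(volume.prod volume) = S := by
    intro n
    obtain ⟨ι, _, a, ha, hK⟩ := finitePD_kernelTerm n
    have hi : ∀ i, Integrable (fun z : Torus × Torus => (a i z.1 * w z.1) * (a i z.2 * w z.2))
        (volume.prod volume) := fun i =>
      (integrable_of_memLp_two (MemLp.mul_continuous (ha i) hw)).mul_prod
        (integrable_of_memLp_two (MemLp.mul_continuous (ha i) hw))
    have e : (fun z : Torus × Torus => kernelTerm n (z.1 - z.2) * (w z.1 * w z.2)) =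
        fun z => ∑ i, (a i z.1 * w z.1) * (a i z.2 * w z.2) := by
      funext z
      rw [show kernelTerm n (z.1 - z.2) = _ from hK z.1 z.2, Finset.sum_mul]
      exact Finset.sum_congr rfl fun i _ => by ring
    refine ⟨∑ i, (∫ x, a i x * w x) * ∫ x, a i x * w x,
      Finset.sum_nonneg fun i _ => mul_self_nonneg _, ?_, ?_⟩
    · rw [e]
      exact integrable_finsetSum _ fun i _ => hi i
    · rw [e, integral_finsetSum _ fun i _ => hi i]
      exact Finset.sum_congr rfl fun i _ =>
        integral_prod_mul (fun x => a i x * w x) (fun x => a i x * w x)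
  choose S hS0 hSi hS using hterm
  simp only [Finset.sum_mul]
  rw [integral_finsetSum _ fun n _ => hSi n]
  exact Finset.sum_nonneg fun n _ => (hS n).symm ▸ hS0 n

/-- The mutual logarithmic energy of two measures. -/
def mutualEnergy (μ ν : Measure Torus) : ℝ≥0∞ := ∫⁻ x, ∫⁻ y, logKernel (x - y) ∂ν ∂μ

/-! ### Mutual energies of measures. -/

theorem measurable_logKernel_prod : Measurable fun z : Torus × Torus => logKernel (z.1 - z.2) :=
  measurable_logKernel.comp (measurable_fst.sub measurable_snd)

theorem measurable_logKernel_sub (x : Torus) : Measurable fun y => logKernel (x - y) :=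
  measurable_logKernel.comp (measurable_const.sub measurable_id)

theorem mutualEnergy_comm (μ ν : Measure Torus) [SFinite μ] [SFinite ν] :
    mutualEnergy μ ν = mutualEnergy ν μ := by
  unfold mutualEnergy
  rw [lintegral_lintegral_swap measurable_logKernel_prod.aemeasurable]
  simp only [logKernel_sub_comm]

/-- With s and t the integrals of a factor against the two measures, the claim is the sum of the
inequalities 2st ≤ s² + t². Nonnegativity of `K` lets Lebesgue integrals be computed as real ones.
-/
theorem FinitePD.two_lintegral_le {K : Torus → Torus → ℝ} (hK : FinitePD K)
    (h0 : ∀ x y, 0 ≤ K x y) (μ ν : Measure Torus) [IsFiniteMeasure μ] [IsFiniteMeasure ν] :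
    2 * ∫⁻ x, ∫⁻ y, ENNReal.ofReal (K x y) ∂ν ∂μ ≤
      ∫⁻ x, ∫⁻ y, ENNReal.ofReal (K x y) ∂μ ∂μ + ∫⁻ x, ∫⁻ y, ENNReal.ofReal (K x y) ∂ν ∂ν := by
  obtain ⟨ι, _, a, ha, hK⟩ := hK
  have hint : ∀ (m : Measure Torus) [IsFiniteMeasure m] (F : Torus → ℝ), Continuous F →
      Integrable F m := by
    intro m _ F hF
    obtain ⟨C, -, hC⟩ := exists_bound_of_continuous hF
    exact Integrable.of_bound hF.aestronglyMeasurable C (ae_of_all _ hC)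
  have key : ∀ (m n : Measure Torus) [IsFiniteMeasure m] [IsFiniteMeasure n],
      0 ≤ ∑ i, (∫ x, a i x ∂m) * ∫ x, a i x ∂n ∧
      ∫⁻ x, ∫⁻ y, ENNReal.ofReal (K x y) ∂n ∂m =
        ENNReal.ofReal (∑ i, (∫ x, a i x ∂m) * ∫ x, a i x ∂n) := by
    intro m n _ _
    have hKi : ∀ x, Integrable (fun y => K x y) n := by
      intro x
      simp only [hK]
      exact integrable_finsetSum _ fun i _ => (hint n _ (ha i)).const_mul _
    have h1 : ∀ x, ∫ y, K x y ∂n = ∑ i, a i x * ∫ y, a i y ∂n := by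
      intro x
      simp only [hK]
      rw [integral_finsetSum _ fun i _ => (hint n _ (ha i)).const_mul _]
      simp only [integral_const_mul]
    have h1n : ∀ x, 0 ≤ ∑ i, a i x * ∫ y, a i y ∂n := fun x => by
      rw [← h1]; exact integral_nonneg fun y => h0 x y
    have h2 : ∫ x, ∑ i, a i x * ∫ y, a i y ∂n ∂m = ∑ i, (∫ x, a i x ∂m) * ∫ x, a i x ∂n := by
      rw [integral_finsetSum _ fun i _ => (hint m _ (ha i)).mul_const _]
      simp only [integral_mul_const]
    refine ⟨by rw [← h2]; exact integral_nonneg h1n, ?_⟩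
    have h3 : ∀ x, ∫⁻ y, ENNReal.ofReal (K x y) ∂n =
        ENNReal.ofReal (∑ i, a i x * ∫ y, a i y ∂n) := by
      intro x
      rw [← h1, ofReal_integral_eq_lintegral_ofReal (hKi x) (ae_of_all _ fun y => h0 x y)]
    simp only [h3]
    rw [← h2, ofReal_integral_eq_lintegral_ofReal _ (ae_of_all _ h1n)]
    exact integrable_finsetSum _ fun i _ => (hint m _ (ha i)).mul_const _
  obtain ⟨n1, e1⟩ := key μ ν
  obtain ⟨n2, e2⟩ := key μ μ
  obtain ⟨n3, e3⟩ := key ν ν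
  rw [e1, e2, e3, ← ENNReal.ofReal_add n2 n3,
    show (2 : ℝ≥0∞) = ENNReal.ofReal 2 by simp, ← ENNReal.ofReal_mul zero_le_two]
  refine ENNReal.ofReal_le_ofReal ?_
  rw [Finset.mul_sum, ← Finset.sum_add_distrib]
  refine Finset.sum_le_sum fun i _ => ?_
  nlinarith [sq_nonneg (∫ x, a i x ∂μ - ∫ x, a i x ∂ν)]

theorem measurable_kernelTerm_prod (k : ℕ) :
    Measurable fun z : Torus × Torus => ENNReal.ofReal (kernelTerm k (z.1 - z.2)) :=
  ((continuous_kernelTerm k).measurable.comp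
    (measurable_fst.sub measurable_snd)).ennreal_ofReal

theorem lintegral_logKernel (n : Measure Torus) (x : Torus) : ∫⁻ y, logKernel (x - y) ∂n =
    ∑' k, ∫⁻ y, ENNReal.ofReal (kernelTerm k (x - y)) ∂n := by
  have hk : ∀ k, Measurable fun y => ENNReal.ofReal (kernelTerm k (x - y)) := fun k =>
    ((continuous_kernelTerm k).measurable.comp
      (measurable_const.sub measurable_id)).ennreal_ofReal
  rw [← lintegral_tsum fun k => (hk k).aemeasurable]
  exact lintegral_congr fun y => (tsum_kernelTerm _).symm

theorem lintegral_lintegral_logKernel (m n : Measure Torus) [IsFiniteMeasure m]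
    [IsFiniteMeasure n] : mutualEnergy m n =
      ∑' k, ∫⁻ x, ∫⁻ y, ENNReal.ofReal (kernelTerm k (x - y)) ∂n ∂m := by
  have h2 : ∀ k, Measurable fun x => ∫⁻ y, ENNReal.ofReal (kernelTerm k (x - y)) ∂n :=
    fun k => Measurable.lintegral_prod_right' (measurable_kernelTerm_prod k)
  rw [mutualEnergy, ← lintegral_tsum fun k => (h2 k).aemeasurable]
  exact lintegral_congr fun x => lintegral_logKernel n x

/-- Positive definiteness tested on μ - ν, stated without subtraction since the energies may be
infinite; it is summed term by term over the expansion of the kernel. -/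
theorem two_mutualEnergy_le (μ ν : Measure Torus) [IsFiniteMeasure μ] [IsFiniteMeasure ν] :
    2 * mutualEnergy μ ν ≤ mutualEnergy μ μ + mutualEnergy ν ν := by
  have e : ∀ (m n : Measure Torus) [IsFiniteMeasure m] [IsFiniteMeasure n],
      mutualEnergy m n = ∑' k, ∫⁻ x, ∫⁻ y, ENNReal.ofReal (kernelTerm k (x - y)) ∂n ∂m :=
    fun m n _ _ => lintegral_lintegral_logKernel m n
  rw [e, e, e, ← ENNReal.tsum_add, ← ENNReal.tsum_mul_left]
  exact ENNReal.tsum_le_tsum fun k =>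
    (finitePD_kernelTerm k).two_lintegral_le (fun x y => kernelTerm_nonneg k _) μ ν

open InformationTheory in
/-- The midpoint strong convexity of `x log x` in terms of square roots. -/
theorem klFun_midpoint {a b : ℝ} (ha : 0 ≤ a) (hb : 0 ≤ b) :
    klFun ((1 - 1 / 2) * a + 1 / 2 * b) + (Real.sqrt a - Real.sqrt b) ^ 2 / 4 ≤
      (klFun a + klFun b) / 2 := by
  set m := (1 - 1 / 2) * a + 1 / 2 * b with hm
  have hm0 : 0 ≤ m := by positivity
  set q := Real.sqrt m with hq
  set s := Real.sqrt a with hs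
  set t := Real.sqrt b with ht
  have hqq : q ^ 2 = m := Real.sq_sqrt hm0
  have hss : s ^ 2 = a := Real.sq_sqrt ha
  have htt : t ^ 2 = b := Real.sq_sqrt hb
  have hq0 : 0 ≤ q := Real.sqrt_nonneg _
  have hs0 : 0 ≤ s := Real.sqrt_nonneg _
  have ht0 : 0 ≤ t := Real.sqrt_nonneg _
  rcases hm0.eq_or_lt with h0 | hmp
  · have ha' : a = 0 := by linarith
    have hb' : b = 0 := by linarith
    have hs' : s = 0 := by rw [hs, ha', Real.sqrt_zero]
    have ht' : t = 0 := by rw [ht, hb', Real.sqrt_zero]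
    rw [← h0, hs', ht', ha', hb']
    norm_num
  have hqp : 0 < q := Real.sqrt_pos.2 hmp
  -- The inequality log y ≤ y - 1 at y = q/r; the factor 2 comes from log c = 2 log r. Working with
  -- square roots is what leaves room for the quadratic gap.
  have key : ∀ c r : ℝ, 0 ≤ r → r ^ 2 = c → 2 * (r ^ 2 - r * q) ≤ c * Real.log c - c * Real.log m := by
    intro c r hr hrc
    rcases hr.eq_or_lt with h | h
    · rw [← hrc, ← h]; simp
    · have h1 := Real.log_le_sub_one_of_pos (div_pos hqp h)
      rw [Real.log_div hqp.ne' h.ne'] at h1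
      have h2 : Real.log c = 2 * Real.log r := by rw [← hrc, Real.log_pow]; norm_num
      have h3 : Real.log m = 2 * Real.log q := by rw [← hqq, Real.log_pow]; norm_num
      rw [h2, h3, ← hrc]
      have h4 : r ^ 2 * (q / r - 1) = r * q - r ^ 2 := by field_simp
      nlinarith [mul_le_mul_of_nonneg_left h1 (sq_nonneg r)]
  have k1 := key a s hs0 hss
  have k2 := key b t ht0 htt
  have h2m : 2 * q ^ 2 = s ^ 2 + t ^ 2 := by rw [hqq, hss, htt, hm]; ring
  have hst : s + t ≤ 2 * q := by nlinarith [sq_nonneg (s - t)]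
  -- By 2q² = s² + t², the right side minus the left side is the square of 2q - s - t.
  have h5 : (s - t) ^ 2 ≤ 4 * (2 * q ^ 2 - q * (s + t)) := by nlinarith
  simp only [klFun_apply]
  have h6 : m * Real.log m = (a * Real.log m + b * Real.log m) / 2 := by rw [hm]; ring
  rw [h6]
  linarith

/-! ### Densities with respect to the reference measure -/

theorem continuous_of_isC11 {V : Torus → ℝ} (hV : IsC11 V) : Continuous V :=
  continuous_of_continuous_coe hV.1.continuous

/-- The density of the reference measure. -/
def refDensity (V : Torus → ℝ) (x : Torus) : ℝ := Real.exp (-V x) / (2 * Real.pi)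

theorem refDensity_pos (V : Torus → ℝ) (x : Torus) : 0 < refDensity V x :=
  div_pos (Real.exp_pos _) Real.two_pi_pos

theorem continuous_refDensity {V : Torus → ℝ} (hV : Continuous V) : Continuous (refDensity V) := by
  unfold refDensity
  fun_prop

theorem refMeasure_eq (V : Torus → ℝ) :
    refMeasure V = volume.withDensity fun x => ENNReal.ofReal (refDensity V x) := rfl

theorem refMeasure_ac (V : Torus → ℝ) : refMeasure V ≪ volume := withDensity_absolutelyContinuous _ _

theorem ac_refMeasure {V : Torus → ℝ} (hV : Continuous V) : volume ≪ refMeasure V :=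
  withDensity_absolutelyContinuous' (continuous_refDensity hV).measurable.ennreal_ofReal.aemeasurable
    (ae_of_all _ fun x => (ENNReal.ofReal_pos.2 (refDensity_pos V x)).ne')

/-- `a` is a density of `ν` with respect to the reference measure. -/
def IsDensity (V : Torus → ℝ) (ν : Measure Torus) (a : Torus → ℝ) : Prop :=
  Measurable a ∧ (∀ x, 0 ≤ a x) ∧ ν = (refMeasure V).withDensity fun x => ENNReal.ofReal (a x)

section Density

variable {V : Torus → ℝ} [IsProbabilityMeasure (refMeasure V)]

theorem IsDensity.ac {ν : Measure Torus} {a : Torus → ℝ} (h : IsDensity V ν a) :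
    ν ≪ refMeasure V := by
  rw [h.2.2]; exact withDensity_absolutelyContinuous _ _

theorem exists_isDensity {ν : Measure Torus} [IsFiniteMeasure ν] (h : ν ≪ refMeasure V) :
    ∃ a, IsDensity V ν a := by
  refine ⟨fun x => (ν.rnDeriv (refMeasure V) x).toReal,
    (Measure.measurable_rnDeriv _ _).ennreal_toReal, fun x => ENNReal.toReal_nonneg, ?_⟩
  have hL : ν.HaveLebesgueDecomposition (refMeasure V) :=
    Measure.haveLebesgueDecomposition_of_sigmaFinite ν (refMeasure V)
  refine (Measure.withDensity_rnDeriv_eq ν _ h).symm.trans (withDensity_congr_ae ?_)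
  filter_upwards [Measure.rnDeriv_ne_top ν (refMeasure V)] with x hx
  rw [ENNReal.ofReal_toReal hx]

theorem IsDensity.klDiv_eq {ν : Measure Torus} [IsFiniteMeasure ν] {a : Torus → ℝ}
    (h : IsDensity V ν a) : InformationTheory.klDiv ν (refMeasure V) =
      ∫⁻ x, ENNReal.ofReal (InformationTheory.klFun (a x)) ∂(refMeasure V) := by
  rw [InformationTheory.klDiv_eq_lintegral_klFun_of_ac h.ac]
  refine lintegral_congr_ae ?_
  have h1 := Measure.rnDeriv_withDensity (refMeasure V) h.1.ennreal_ofReal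
  rw [← h.2.2] at h1
  filter_upwards [h1] with x hx
  rw [hx, ENNReal.toReal_ofReal (h.2.1 x)]

theorem mutualEnergy_eq_prod (μ ν : Measure Torus) [SFinite ν] :
    mutualEnergy μ ν = ∫⁻ z, logKernel (z.1 - z.2) ∂(μ.prod ν) :=
  (lintegral_prod _ measurable_logKernel_prod.aemeasurable).symm

theorem IsDensity.mutualEnergy_eq {μ ν : Measure Torus} [SFinite μ] [SFinite ν] {a b : Torus → ℝ}
    (hμ : IsDensity V μ a) (hν : IsDensity V ν b) :
    mutualEnergy μ ν = ∫⁻ z, ENNReal.ofReal (a z.1) * ENNReal.ofReal (b z.2) *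
      logKernel (z.1 - z.2) ∂((refMeasure V).prod (refMeasure V)) := by
  rw [mutualEnergy_eq_prod, hμ.2.2, hν.2.2,
    prod_withDensity hμ.1.ennreal_ofReal hν.1.ennreal_ofReal,
    lintegral_withDensity_eq_lintegral_mul _ _ measurable_logKernel_prod]
  · rfl
  · exact (hμ.1.ennreal_ofReal.comp measurable_fst).mul (hν.1.ennreal_ofReal.comp measurable_snd)

/-- The entropy is spread over the second variable, harmless as the reference measure has mass one;
the functional becomes one integral of a nonnegative integrand, ready for Fatou's lemma. -/
theorem IsDensity.freeEnergy_eq {ν : ProbabilityMeasure Torus} {a : Torus → ℝ}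
    (h : IsDensity V (ν : Measure Torus) a) (β : ℝ) :
    freeEnergy β V ν = ∫⁻ z, (ENNReal.ofReal β * (ENNReal.ofReal (a z.1) * ENNReal.ofReal (a z.2) *
      logKernel (z.1 - z.2)) + ENNReal.ofReal (InformationTheory.klFun (a z.1)))
        ∂((refMeasure V).prod (refMeasure V)) := by
  have hm : Measurable fun z : Torus × Torus =>
      ENNReal.ofReal (a z.1) * ENNReal.ofReal (a z.2) * logKernel (z.1 - z.2) :=
    ((h.1.ennreal_ofReal.comp measurable_fst).mul (h.1.ennreal_ofReal.comp measurable_snd)).mul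
      measurable_logKernel_prod
  have hk : Measurable fun x => ENNReal.ofReal (InformationTheory.klFun (a x)) :=
    (InformationTheory.measurable_klFun.comp h.1).ennreal_ofReal
  have h1 : ∫⁻ z, ENNReal.ofReal (InformationTheory.klFun (a z.1))
      ∂((refMeasure V).prod (refMeasure V)) =
      ∫⁻ x, ENNReal.ofReal (InformationTheory.klFun (a x)) ∂(refMeasure V) :=
    (lintegral_prod _ (hk.comp measurable_fst).aemeasurable).trans (by simp)
  rw [lintegral_add_left (hm.const_mul _), lintegral_const_mul _ hm, freeEnergy, h.klDiv_eq,
    ← h.mutualEnergy_eq h, h1]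
  rfl

/-- The convex combination of two probability measures. -/
def mix (t : ℝ) (ht : t ∈ Set.Icc (0 : ℝ) 1) (μ ν : ProbabilityMeasure Torus) :
    ProbabilityMeasure Torus :=
  ⟨ENNReal.ofReal (1 - t) • (μ : Measure Torus) + ENNReal.ofReal t • (ν : Measure Torus), ⟨by
    rw [Measure.add_apply, Measure.smul_apply, Measure.smul_apply, measure_univ, measure_univ,
      smul_eq_mul, smul_eq_mul, mul_one, mul_one,
      ← ENNReal.ofReal_add (sub_nonneg.2 ht.2) ht.1]
    simp⟩⟩

theorem coe_mix (t : ℝ) (ht : t ∈ Set.Icc (0 : ℝ) 1) (μ ν : ProbabilityMeasure Torus) :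
    (mix t ht μ ν : Measure Torus) =
      ENNReal.ofReal (1 - t) • (μ : Measure Torus) + ENNReal.ofReal t • (ν : Measure Torus) := rfl

theorem IsDensity.mix {t : ℝ} (ht : t ∈ Set.Icc (0 : ℝ) 1) {μ ν : ProbabilityMeasure Torus}
    {a b : Torus → ℝ} (hμ : IsDensity V (μ : Measure Torus) a)
    (hν : IsDensity V (ν : Measure Torus) b) :
    IsDensity V (HighTemp.mix t ht μ ν : Measure Torus) fun x => (1 - t) * a x + t * b x := by
  have h1 : 0 ≤ 1 - t := sub_nonneg.2 ht.2
  refine ⟨(hμ.1.const_mul _).add (hν.1.const_mul _), fun x =>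
    add_nonneg (mul_nonneg h1 (hμ.2.1 x)) (mul_nonneg ht.1 (hν.2.1 x)), ?_⟩
  rw [coe_mix, hμ.2.2, hν.2.2, ← withDensity_smul _ hμ.1.ennreal_ofReal,
    ← withDensity_smul _ hν.1.ennreal_ofReal,
    ← withDensity_add_left (hμ.1.ennreal_ofReal.const_smul _)]
  congr 1
  funext x
  simp only [Pi.add_apply, Pi.smul_apply, smul_eq_mul]
  rw [ENNReal.ofReal_add (mul_nonneg h1 (hμ.2.1 x)) (mul_nonneg ht.1 (hν.2.1 x)),
    ENNReal.ofReal_mul h1, ENNReal.ofReal_mul ht.1]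

/-! ### Convexity of the free energy. -/

theorem logEnergy_mix {t : ℝ} (ht : t ∈ Set.Icc (0 : ℝ) 1) (μ ν : ProbabilityMeasure Torus) :
    logEnergy (mix t ht μ ν : Measure Torus) =
      ENNReal.ofReal (1 - t) ^ 2 * logEnergy (μ : Measure Torus) +
      2 * (ENNReal.ofReal (1 - t) * ENNReal.ofReal t) * mutualEnergy (μ : Measure Torus) ν +
      ENNReal.ofReal t ^ 2 * logEnergy (ν : Measure Torus) := by
  change mutualEnergy _ _ = _ * mutualEnergy _ _ + _ + _ * mutualEnergy _ _
  have hm : ∀ m : Measure Torus, [SFinite m] → Measurable fun x => ∫⁻ y, logKernel (x - y) ∂m :=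
    fun m _ => measurable_logKernel_prod.lintegral_prod_right'
  have hr : ∀ m : Measure Torus, [SFinite m] → mutualEnergy m (mix t ht μ ν) =
      ENNReal.ofReal (1 - t) * mutualEnergy m μ + ENNReal.ofReal t * mutualEnergy m ν := by
    intro m _
    unfold mutualEnergy
    simp only [coe_mix, lintegral_add_measure, lintegral_smul_measure, smul_eq_mul]
    rw [lintegral_add_left ((hm _).const_mul _), lintegral_const_mul _ (hm _),
      lintegral_const_mul _ (hm _)]
  have hl : mutualEnergy (mix t ht μ ν) (mix t ht μ ν) =
      ENNReal.ofReal (1 - t) * mutualEnergy (μ : Measure Torus) (mix t ht μ ν) +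
      ENNReal.ofReal t * mutualEnergy (ν : Measure Torus) (mix t ht μ ν) := by
    rw [mutualEnergy_comm, hr, mutualEnergy_comm _ (μ : Measure Torus),
      mutualEnergy_comm _ (ν : Measure Torus)]
  rw [hl, hr, hr, mutualEnergy_comm (ν : Measure Torus) μ]
  ring

theorem half_mem_Icc : (1 / 2 : ℝ) ∈ Set.Icc (0 : ℝ) 1 := by constructor <;> norm_num

theorem ofReal_half : ENNReal.ofReal (1 / 2) = 2⁻¹ := by
  rw [one_div, ENNReal.ofReal_inv_of_pos two_pos, ENNReal.ofReal_ofNat]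

theorem logEnergy_midpoint_le (μ ν : ProbabilityMeasure Torus) :
    2 * logEnergy (mix (1 / 2) half_mem_Icc μ ν : Measure Torus) ≤
      logEnergy (μ : Measure Torus) + logEnergy (ν : Measure Torus) := by
  rw [logEnergy_mix, show (1 : ℝ) - 1 / 2 = 1 / 2 by norm_num, ofReal_half]
  have h := two_mutualEnergy_le (μ : Measure Torus) (ν : Measure Torus)
  have h2 : (2 : ℝ≥0∞) * 2⁻¹ = 1 := ENNReal.mul_inv_cancel two_ne_zero ENNReal.ofNat_ne_top
  have h4 : (2 : ℝ≥0∞)⁻¹ + 2⁻¹ = 1 := ENNReal.inv_two_add_inv_two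
  change 2 * (2⁻¹ ^ 2 * mutualEnergy (μ : Measure Torus) μ + _ +
    2⁻¹ ^ 2 * mutualEnergy (ν : Measure Torus) ν) ≤ mutualEnergy (μ : Measure Torus) μ +
      mutualEnergy (ν : Measure Torus) ν
  generalize mutualEnergy (μ : Measure Torus) μ = A at *
  generalize mutualEnergy (ν : Measure Torus) ν = B at *
  generalize mutualEnergy (μ : Measure Torus) ν = C at *
  calc 2 * (2⁻¹ ^ 2 * A + 2 * (2⁻¹ * 2⁻¹) * C + 2⁻¹ ^ 2 * B)
      = (2 * 2⁻¹) * 2⁻¹ * A + (2 * 2⁻¹) * 2⁻¹ * B + (2 * 2⁻¹) * 2⁻¹ * (2 * C) := by ring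
    _ = 2⁻¹ * A + 2⁻¹ * B + 2⁻¹ * (2 * C) := by rw [h2]; ring
    _ ≤ 2⁻¹ * A + 2⁻¹ * B + 2⁻¹ * (A + B) := by gcongr
    _ = (2⁻¹ + 2⁻¹) * (A + B) := by ring
    _ = A + B := by rw [h4, one_mul]

/-- Midpoint convexity with a gap: the energy is convex by positive definiteness, and the entropy
contributes the squared Hellinger-type distance of the densities. Both uniqueness and existence of
the minimizer follow from this gap. -/
theorem freeEnergy_midpoint {μ ν : ProbabilityMeasure Torus}
    {a b : Torus → ℝ} (hμ : IsDensity V (μ : Measure Torus) a)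
    (hν : IsDensity V (ν : Measure Torus) b) (β : ℝ) :
    2 * freeEnergy β V (mix (1 / 2) half_mem_Icc μ ν) +
      ∫⁻ x, ENNReal.ofReal ((Real.sqrt (a x) - Real.sqrt (b x)) ^ 2 / 2) ∂(refMeasure V) ≤
      freeEnergy β V μ + freeEnergy β V ν := by
  have hkl : 2 * InformationTheory.klDiv (mix (1 / 2) half_mem_Icc μ ν : Measure Torus)
      (refMeasure V) +
      ∫⁻ x, ENNReal.ofReal ((Real.sqrt (a x) - Real.sqrt (b x)) ^ 2 / 2) ∂(refMeasure V) ≤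
      InformationTheory.klDiv (μ : Measure Torus) (refMeasure V) +
        InformationTheory.klDiv (ν : Measure Torus) (refMeasure V) := by
    have hmix := IsDensity.mix half_mem_Icc hμ hν
    have hk : ∀ {c : Torus → ℝ}, Measurable c →
        Measurable fun x => ENNReal.ofReal (InformationTheory.klFun (c x)) := fun hc =>
      (InformationTheory.measurable_klFun.comp hc).ennreal_ofReal
    rw [hmix.klDiv_eq, hμ.klDiv_eq, hν.klDiv_eq, ← lintegral_add_left (hk hμ.1),
      ← lintegral_const_mul _ (hk hmix.1), ← lintegral_add_left ((hk hmix.1).const_mul _)]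
    refine lintegral_mono fun x => ?_
    rw [show (2 : ℝ≥0∞) = ENNReal.ofReal 2 by simp, ← ENNReal.ofReal_mul zero_le_two,
      ← ENNReal.ofReal_add (mul_nonneg zero_le_two
        (InformationTheory.klFun_nonneg (hmix.2.1 x))) (by positivity),
      ← ENNReal.ofReal_add (InformationTheory.klFun_nonneg (hμ.2.1 x))
        (InformationTheory.klFun_nonneg (hν.2.1 x))]
    refine ENNReal.ofReal_le_ofReal ?_
    linarith [klFun_midpoint (hμ.2.1 x) (hν.2.1 x)]
  unfold freeEnergy
  have hE := logEnergy_midpoint_le μ ν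
  calc _ = ENNReal.ofReal β * (2 * logEnergy (mix (1 / 2) half_mem_Icc μ ν : Measure Torus)) +
        (2 * InformationTheory.klDiv (mix (1 / 2) half_mem_Icc μ ν : Measure Torus)
          (refMeasure V) +
        ∫⁻ x, ENNReal.ofReal ((Real.sqrt (a x) - Real.sqrt (b x)) ^ 2 / 2) ∂(refMeasure V)) := by
        ring
    _ ≤ ENNReal.ofReal β * (logEnergy (μ : Measure Torus) + logEnergy (ν : Measure Torus)) +
        (InformationTheory.klDiv (μ : Measure Torus) (refMeasure V) +
        InformationTheory.klDiv (ν : Measure Torus) (refMeasure V)) := by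
        gcongr
    _ = _ := by ring

/-! ### Finiteness of the free energy -/

theorem lintegral_logKernel_withDensity {p : Torus → ℝ} (hm : Measurable p) (h0 : ∀ x, 0 ≤ p x)
    (hp : MemLp p 2 volume) (x : Torus) :
    ∫⁻ y, logKernel (x - y) ∂(volume.withDensity fun y => ENNReal.ofReal (p y)) =
      ENNReal.ofReal (pot p x) := by
  rw [lintegral_withDensity_eq_lintegral_mul _ hm.ennreal_ofReal (measurable_logKernel_sub x), pot,
    ofReal_integral_eq_lintegral_ofReal (integrable_kernelR_mul hp x)
      (ae_of_all _ fun y => mul_nonneg (kernelR_nonneg _) (h0 y))]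
  refine lintegral_congr_ae ?_
  have hne : ∀ᵐ y : Torus, y ≠ x := by
    rw [ae_iff]; simp
  filter_upwards [hne] with y hy
  rw [Pi.mul_apply, logKernel_of_ne (sub_ne_zero.2 hy.symm), mul_comm,
    ENNReal.ofReal_mul (kernelR_nonneg _)]

theorem pot_nonneg {p : Torus → ℝ} (h0 : ∀ x, 0 ≤ p x) (x : Torus) : 0 ≤ pot p x :=
  integral_nonneg fun y => mul_nonneg (kernelR_nonneg _) (h0 y)

theorem mutualEnergy_withDensity {p : Torus → ℝ} (hm : Measurable p) (h0 : ∀ x, 0 ≤ p x)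
    (hp : MemLp p 2 volume) (μ : Measure Torus) :
    mutualEnergy μ (volume.withDensity fun y => ENNReal.ofReal (p y)) =
      ∫⁻ x, ENNReal.ofReal (pot p x) ∂μ := by
  unfold mutualEnergy
  simp only [lintegral_logKernel_withDensity hm h0 hp]

theorem mutualEnergy_withDensity_le {p : Torus → ℝ} (hm : Measurable p) (h0 : ∀ x, 0 ≤ p x)
    (hp : MemLp p 2 volume) (μ : Measure Torus) [IsProbabilityMeasure μ] :
    mutualEnergy μ (volume.withDensity fun y => ENNReal.ofReal (p y)) ≤
      ENNReal.ofReal (kernelNorm * Real.sqrt (∫ y, p y ^ 2)) := by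
  rw [mutualEnergy_withDensity hm h0 hp]
  calc _ ≤ ∫⁻ x, ENNReal.ofReal (kernelNorm * Real.sqrt (∫ y, p y ^ 2)) ∂μ :=
        lintegral_mono fun x => ENNReal.ofReal_le_ofReal ((le_abs_self _).trans (abs_pot_le hp x))
    _ = _ := by rw [lintegral_const, measure_univ, mul_one]

variable (V) in
/-- The reference measure as a probability measure. -/
def refProb : ProbabilityMeasure Torus := ⟨refMeasure V, inferInstance⟩

variable (V) in
/-- A bound for the logarithmic energy of the reference measure. -/
def refEnergyBound : ℝ := kernelNorm * Real.sqrt (∫ y, refDensity V y ^ 2)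

theorem refEnergyBound_nonneg : 0 ≤ refEnergyBound V :=
  mul_nonneg kernelNorm_nonneg (Real.sqrt_nonneg _)

theorem freeEnergy_refProb_le (hV : Continuous V) (β : ℝ) :
    freeEnergy β V (refProb V) ≤ ENNReal.ofReal β * ENNReal.ofReal (refEnergyBound V) := by
  have h1 : logEnergy (refMeasure V) ≤ ENNReal.ofReal (refEnergyBound V) :=
    mutualEnergy_withDensity_le (continuous_refDensity hV).measurable
      (fun x => (refDensity_pos V x).le) (memLp_of_continuous (continuous_refDensity hV) 2)
      (refMeasure V)
  unfold freeEnergy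
  change _ * logEnergy (refMeasure V) + InformationTheory.klDiv (refMeasure V) (refMeasure V) ≤ _
  rw [InformationTheory.klDiv_self, add_zero]
  gcongr

theorem ac_of_freeEnergy_ne_top {β : ℝ} {ν : ProbabilityMeasure Torus}
    (h : freeEnergy β V ν ≠ ⊤) : (ν : Measure Torus) ≪ refMeasure V := by
  by_contra hne
  apply h
  rw [freeEnergy, InformationTheory.klDiv_of_not_ac hne, add_top]

theorem IsEquilibrium.freeEnergy_le (hV : Continuous V) {β : ℝ} {μ : ProbabilityMeasure Torus}
    (h : IsEquilibrium β V μ) :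
    freeEnergy β V μ ≤ ENNReal.ofReal β * ENNReal.ofReal (refEnergyBound V) :=
  (h _).trans (freeEnergy_refProb_le hV β)

theorem IsEquilibrium.freeEnergy_ne_top (hV : Continuous V) {β : ℝ} {μ : ProbabilityMeasure Torus}
    (h : IsEquilibrium β V μ) : freeEnergy β V μ ≠ ⊤ :=
  ne_top_of_le_ne_top (ENNReal.mul_ne_top ENNReal.ofReal_ne_top ENNReal.ofReal_ne_top)
    (h.freeEnergy_le hV)

/-! ### Uniqueness and existence of the minimizer -/

theorem IsEquilibrium.unique (hV : Continuous V) {β : ℝ} {μ ν : ProbabilityMeasure Torus}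
    (hμ : IsEquilibrium β V μ) (hν : IsEquilibrium β V ν) : μ = ν := by
  obtain ⟨a, ha⟩ := exists_isDensity (ac_of_freeEnergy_ne_top (hμ.freeEnergy_ne_top hV))
  obtain ⟨b, hb⟩ := exists_isDensity (ac_of_freeEnergy_ne_top (hν.freeEnergy_ne_top hV))
  have hmid := freeEnergy_midpoint ha hb β
  have h1 : freeEnergy β V μ + freeEnergy β V ν ≤
      2 * freeEnergy β V (mix (1 / 2) half_mem_Icc μ ν) := by
    rw [two_mul]
    exact add_le_add (hμ _) (hν _)
  have hfin : freeEnergy β V μ + freeEnergy β V ν ≠ ⊤ :=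
    ENNReal.add_ne_top.2 ⟨hμ.freeEnergy_ne_top hV, hν.freeEnergy_ne_top hV⟩
  have h0 : ∫⁻ x, ENNReal.ofReal ((Real.sqrt (a x) - Real.sqrt (b x)) ^ 2 / 2)
      ∂(refMeasure V) = 0 := by
    -- Minimality of both measures leaves no room for the gap, and the free energies can be
    -- cancelled because they are finite.
    have h2 := (add_le_add_left h1 _).trans hmid
    have h3 : freeEnergy β V μ + freeEnergy β V ν + ∫⁻ x, ENNReal.ofReal
        ((Real.sqrt (a x) - Real.sqrt (b x)) ^ 2 / 2) ∂(refMeasure V) ≤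
        freeEnergy β V μ + freeEnergy β V ν + 0 := by simpa using h2
    exact nonpos_iff_eq_zero.1 ((ENNReal.add_le_add_iff_left hfin).1 h3)
  have hmeas : Measurable fun x => ENNReal.ofReal ((Real.sqrt (a x) - Real.sqrt (b x)) ^ 2 / 2) :=
    (((ha.1.sqrt.sub hb.1.sqrt).pow_const 2).div_const 2).ennreal_ofReal
  rw [lintegral_eq_zero_iff hmeas] at h0
  apply Subtype.ext
  change (μ : Measure Torus) = ν
  rw [ha.2.2, hb.2.2]
  refine withDensity_congr_ae ?_
  filter_upwards [h0] with x hx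
  have h4 : (Real.sqrt (a x) - Real.sqrt (b x)) ^ 2 / 2 ≤ 0 := ENNReal.ofReal_eq_zero.1 hx
  have h5 : Real.sqrt (a x) - Real.sqrt (b x) = 0 := by nlinarith [sq_nonneg (√(a x) - √(b x))]
  rw [(Real.sqrt_inj (ha.2.1 x) (hb.2.1 x)).1 (sub_eq_zero.1 h5)]

end Density

section Existence

variable {V : Torus → ℝ} [IsProbabilityMeasure (refMeasure V)]

theorem IsDensity.lintegral_eq_one {ν : ProbabilityMeasure Torus} {a : Torus → ℝ}
    (h : IsDensity V (ν : Measure Torus) a) :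
    ∫⁻ x, ENNReal.ofReal (a x) ∂(refMeasure V) = 1 := by
  have h1 : (ν : Measure Torus) Set.univ = 1 := measure_univ
  rwa [h.2.2, withDensity_apply _ MeasurableSet.univ, Measure.restrict_univ] at h1

theorem IsDensity.memLp_sqrt {ν : ProbabilityMeasure Torus} {a : Torus → ℝ}
    (h : IsDensity V (ν : Measure Torus) a) :
    MemLp (fun x => Real.sqrt (a x)) 2 (refMeasure V) := by
  rw [memLp_two_iff_integrable_sq h.1.sqrt.aestronglyMeasurable]
  simp only [Real.sq_sqrt (h.2.1 _)]
  rw [← lintegral_ofReal_ne_top_iff_integrable h.1.aestronglyMeasurable (ae_of_all _ h.2.1),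
    h.lintegral_eq_one]
  exact ENNReal.one_ne_top

theorem norm_toLp_sq {f : Torus → ℝ} (hf : MemLp f 2 (refMeasure V)) :
    ENNReal.ofReal (‖hf.toLp f‖ ^ 2) = ∫⁻ x, ENNReal.ofReal (f x ^ 2) ∂(refMeasure V) := by
  rw [← ofReal_integral_eq_lintegral_ofReal hf.integrable_sq (ae_of_all _ fun x => sq_nonneg _)]
  congr 1
  rw [← real_inner_self_eq_norm_sq, L2.inner_def]
  refine integral_congr_ae ?_
  filter_upwards [hf.coeFn_toLp] with x hx
  simp [hx, sq]

/-- The convexity gap makes the square roots of the densities Cauchy in L²(μ₀). Their limit has norm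
one, so its square is a probability density; along an a.e. convergent subsequence Fatou's lemma
shows that it is a minimizer. No weak compactness is used. -/
theorem exists_isEquilibrium_of_seq {β : ℝ} {ν : ℕ → ProbabilityMeasure Torus}
    {a : ℕ → Torus → ℝ} (ha : ∀ n, IsDensity V (ν n : Measure Torus) (a n)) {e : ℕ → ℝ}
    (he : Tendsto e atTop (𝓝 0)) (hea : Antitone e)
    (hν : ∀ n, ∀ m : ProbabilityMeasure Torus,
      freeEnergy β V (ν n) ≤ freeEnergy β V m + ENNReal.ofReal (e n))
    (hfin : ∀ n, freeEnergy β V (ν n) ≠ ⊤) :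
    ∃ μ, IsEquilibrium β V μ := by
  have he0 : ∀ n, 0 ≤ e n := fun n => hea.le_of_tendsto he n
  let F : ℕ → Lp ℝ 2 (refMeasure V) := fun n => (ha n).memLp_sqrt.toLp _
  have hdist : ∀ n m, dist (F n) (F m) ^ 2 ≤ 2 * (e n + e m) := by
    intro n m
    have hmid := freeEnergy_midpoint (ha n) (ha m) β
    set M := mix (1 / 2) half_mem_Icc (ν n) (ν m)
    have hsum : freeEnergy β V (ν n) + freeEnergy β V (ν m) ≤
        2 * freeEnergy β V M + ENNReal.ofReal (e n + e m) := by
      rw [ENNReal.ofReal_add (he0 n) (he0 m)]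
      calc _ ≤ (freeEnergy β V M + ENNReal.ofReal (e n)) +
            (freeEnergy β V M + ENNReal.ofReal (e m)) := add_le_add (hν n M) (hν m M)
        _ = _ := by ring
    have hMfin : 2 * freeEnergy β V M ≠ ⊤ := by
      refine ne_top_of_le_ne_top (ENNReal.add_ne_top.2 ⟨hfin n, hfin m⟩)
        (le_trans ?_ hmid)
      exact le_self_add
    have hD := (ENNReal.add_le_add_iff_left hMfin).1 (hmid.trans hsum)
    have hsub : MemLp (fun x => Real.sqrt (a n x) - Real.sqrt (a m x)) 2 (refMeasure V) :=
      (ha n).memLp_sqrt.sub (ha m).memLp_sqrt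
    have hn : ENNReal.ofReal (dist (F n) (F m) ^ 2) = ENNReal.ofReal 2 *
        ∫⁻ x, ENNReal.ofReal ((Real.sqrt (a n x) - Real.sqrt (a m x)) ^ 2 / 2) ∂(refMeasure V) := by
      rw [dist_eq_norm, show F n - F m = hsub.toLp _ from
        (MemLp.toLp_sub (ha n).memLp_sqrt (ha m).memLp_sqrt).symm, norm_toLp_sq hsub,
        ← lintegral_const_mul' _ _ ENNReal.ofReal_ne_top]
      refine lintegral_congr fun x => ?_
      rw [← ENNReal.ofReal_mul zero_le_two]
      congr 1
      ring
    have h2 : ENNReal.ofReal (dist (F n) (F m) ^ 2) ≤ ENNReal.ofReal (2 * (e n + e m)) := by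
      rw [hn, ENNReal.ofReal_mul zero_le_two]
      gcongr
    exact (ENNReal.ofReal_le_ofReal_iff (by linarith [he0 n, he0 m])).1 h2
  have hcauchy : CauchySeq F := by
    refine cauchySeq_of_le_tendsto_0 (fun N => Real.sqrt (4 * e N)) (fun n m N hn hm => ?_) ?_
    · refine Real.le_sqrt_of_sq_le ((hdist n m).trans ?_)
      linarith [hea hn, hea hm]
    · have : Tendsto (fun N => Real.sqrt (4 * e N)) atTop (𝓝 (Real.sqrt (4 * 0))) :=
        (he.const_mul 4).sqrt
      simpa using this
  obtain ⟨g, hg⟩ := cauchySeq_tendsto_of_complete hcauchy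
  obtain ⟨ns, hns, hae⟩ := (tendstoInMeasure_of_tendsto_Lp hg).exists_seq_tendsto_ae
  have hgm : Measurable g := (Lp.stronglyMeasurable g).measurable
  -- Squaring avoids having to know that the L² limit is nonnegative.
  let b : Torus → ℝ := fun x => g x ^ 2
  have hb0 : ∀ x, 0 ≤ b x := fun x => sq_nonneg _
  have hbm : Measurable b := hgm.pow_const 2
  have hconv : ∀ᵐ x ∂(refMeasure V), Tendsto (fun k => a (ns k) x) atTop (𝓝 (b x)) := by
    have hF : ∀ᵐ x ∂(refMeasure V), ∀ k, F (ns k) x = Real.sqrt (a (ns k) x) :=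
      ae_all_iff.2 fun k => (ha (ns k)).memLp_sqrt.coeFn_toLp
    filter_upwards [hae, hF] with x hx hFx
    refine (hx.pow 2).congr fun k => ?_
    rw [hFx, Real.sq_sqrt ((ha _).2.1 x)]
  have hone : ∫⁻ x, ENNReal.ofReal (b x) ∂(refMeasure V) = 1 := by
    have h1 : ∀ n, ‖F n‖ = 1 := by
      intro n
      have := norm_toLp_sq (ha n).memLp_sqrt
      simp only [Real.sq_sqrt ((ha n).2.1 _), (ha n).lintegral_eq_one] at this
      rw [ENNReal.ofReal_eq_one] at this
      exact (pow_eq_one_iff_of_nonneg (norm_nonneg (F n)) two_ne_zero).1 this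
    have h2 : ‖g‖ = 1 := tendsto_nhds_unique hg.norm (by simp [h1])
    have := norm_toLp_sq (Lp.memLp g)
    rw [Lp.toLp_coeFn, h2] at this
    rw [← this]
    simp
  let μ : ProbabilityMeasure Torus :=
    ⟨(refMeasure V).withDensity fun x => ENNReal.ofReal (b x), ⟨by
      rw [withDensity_apply _ MeasurableSet.univ, Measure.restrict_univ, hone]⟩⟩
  have hμ : IsDensity V (μ : Measure Torus) b := ⟨hbm, hb0, rfl⟩
  have hle : ∀ m : ProbabilityMeasure Torus, freeEnergy β V μ ≤ freeEnergy β V m := by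
    intro m
    let Φ : ℝ → ℝ → Torus × Torus → ℝ≥0∞ := fun s t z =>
      ENNReal.ofReal β * (ENNReal.ofReal s * ENNReal.ofReal t * logKernel (z.1 - z.2)) +
        ENNReal.ofReal (InformationTheory.klFun s)
    have hΦ : ∀ k, freeEnergy β V (ν (ns k)) = ∫⁻ z, Φ (a (ns k) z.1) (a (ns k) z.2) z
        ∂((refMeasure V).prod (refMeasure V)) := fun k => (ha (ns k)).freeEnergy_eq β
    have hmeas : ∀ k, Measurable fun z : Torus × Torus => Φ (a (ns k) z.1) (a (ns k) z.2) z := by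
      intro k
      have h1 := (ha (ns k)).1
      exact ((((h1.ennreal_ofReal.comp measurable_fst).mul
        (h1.ennreal_ofReal.comp measurable_snd)).mul measurable_logKernel_prod).const_mul _).add
        ((InformationTheory.measurable_klFun.comp h1).ennreal_ofReal.comp measurable_fst)
    have hlim : ∀ᵐ z ∂((refMeasure V).prod (refMeasure V)),
        Tendsto (fun k => Φ (a (ns k) z.1) (a (ns k) z.2) z) atTop (𝓝 (Φ (b z.1) (b z.2) z)) := by
      have hne : ∀ᵐ z ∂((refMeasure V).prod (refMeasure V)), z.1 - z.2 ≠ 0 :=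
        ((refMeasure_ac V).prod (refMeasure_ac V)).ae_le ae_sub_ne_zero
      have h1 : ∀ᵐ z ∂((refMeasure V).prod (refMeasure V)),
          Tendsto (fun k => a (ns k) z.1) atTop (𝓝 (b z.1)) :=
        Measure.quasiMeasurePreserving_fst.ae hconv
      have h2 : ∀ᵐ z ∂((refMeasure V).prod (refMeasure V)),
          Tendsto (fun k => a (ns k) z.2) atTop (𝓝 (b z.2)) :=
        Measure.quasiMeasurePreserving_snd.ae hconv
      filter_upwards [hne, h1, h2] with z hz h1 h2
      -- Multiplication in [0, ∞] is continuous here only because the kernel is finite off the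
      -- diagonal.
      have hk : logKernel (z.1 - z.2) ≠ ⊤ := by
        rw [logKernel_of_ne hz]; exact ENNReal.ofReal_ne_top
      refine Tendsto.add ?_ ?_
      · refine ENNReal.Tendsto.const_mul ?_ (Or.inr ENNReal.ofReal_ne_top)
        refine ENNReal.Tendsto.mul_const ?_ (Or.inr hk)
        exact ENNReal.Tendsto.mul (ENNReal.tendsto_ofReal h1) (Or.inr ENNReal.ofReal_ne_top)
          (ENNReal.tendsto_ofReal h2) (Or.inr ENNReal.ofReal_ne_top)
      · exact ENNReal.tendsto_ofReal
          ((InformationTheory.continuous_klFun.tendsto (b z.1)).comp h1)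
    calc freeEnergy β V μ = ∫⁻ z, Φ (b z.1) (b z.2) z ∂((refMeasure V).prod (refMeasure V)) :=
          hμ.freeEnergy_eq β
      _ = ∫⁻ z, liminf (fun k => Φ (a (ns k) z.1) (a (ns k) z.2) z) atTop
            ∂((refMeasure V).prod (refMeasure V)) := by
          refine lintegral_congr_ae ?_
          filter_upwards [hlim] with z hz
          exact hz.liminf_eq.symm
      _ ≤ liminf (fun k => ∫⁻ z, Φ (a (ns k) z.1) (a (ns k) z.2) z
            ∂((refMeasure V).prod (refMeasure V))) atTop := lintegral_liminf_le hmeas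
      _ = liminf (fun k => freeEnergy β V (ν (ns k))) atTop := by simp only [hΦ]
      _ ≤ liminf (fun k => freeEnergy β V m + ENNReal.ofReal (e (ns k))) atTop :=
          liminf_le_liminf (Eventually.of_forall fun k => hν (ns k) m)
      _ = freeEnergy β V m := by
          have h1 : Tendsto (fun k => freeEnergy β V m + ENNReal.ofReal (e (ns k))) atTop
              (𝓝 (freeEnergy β V m + ENNReal.ofReal 0)) :=
            tendsto_const_nhds.add (ENNReal.tendsto_ofReal (he.comp hns.tendsto_atTop))
          rw [h1.liminf_eq, ENNReal.ofReal_zero, add_zero]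
  exact ⟨μ, hle⟩

theorem exists_isEquilibrium (hV : Continuous V) (β : ℝ) : ∃ μ, IsEquilibrium β V μ := by
  set I := ⨅ m : ProbabilityMeasure Torus, freeEnergy β V m with hI
  have hItop : I ≠ ⊤ := ne_top_of_le_ne_top
    (ne_top_of_le_ne_top (ENNReal.mul_ne_top ENNReal.ofReal_ne_top ENNReal.ofReal_ne_top)
      (freeEnergy_refProb_le hV β)) (iInf_le _ (refProb V))
  have hex : ∀ n : ℕ, ∃ ν : ProbabilityMeasure Torus,
      freeEnergy β V ν < I + ENNReal.ofReal (1 / ((n : ℝ) + 1)) := fun n =>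
    iInf_lt_iff.1 (ENNReal.lt_add_right hItop (ENNReal.ofReal_pos.2 Nat.one_div_pos_of_nat).ne')
  choose ν hν using hex
  have hfin : ∀ n, freeEnergy β V (ν n) ≠ ⊤ := fun n => (hν n).ne_top
  choose a ha using fun n => exists_isDensity (ac_of_freeEnergy_ne_top (hfin n))
  refine exists_isEquilibrium_of_seq ha tendsto_one_div_add_atTop_nhds_zero_nat ?_ ?_ hfin
  · intro n m hnm
    exact one_div_le_one_div_of_le (by positivity) (by
      have : (n : ℝ) ≤ m := by exact_mod_cast hnm
      linarith)
  · intro n m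
    refine (hν n).le.trans ?_
    gcongr
    exact iInf_le _ m

theorem existsUnique_isEquilibrium (hV : Continuous V) (β : ℝ) : ∃! μ, IsEquilibrium β V μ := by
  obtain ⟨μ, hμ⟩ := exists_isEquilibrium hV β
  exact ⟨μ, hμ, fun ν hν => hν.unique hV hμ⟩

theorem isEquilibrium_eqMeasure (hV : Continuous V) (β : ℝ) : IsEquilibrium β V (eqMeasure β V) :=
  Classical.epsilon_spec (exists_isEquilibrium hV β)

end Existence

/-! ### The Euler–Lagrange equation -/

open InformationTheory in
-- A first-order upper bound for the entropy along a segment, which replaces differentiation under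
-- the integral. With y the mixture, x log y ≤ x log x + y - x costs an error t²(s - x); its
-- negative part is absorbed by -t x log(1 - t) ≥ t² x.
theorem klFun_mix_le {t x s : ℝ} (ht0 : 0 < t) (ht1 : t < 1) (hx : 0 ≤ x) (hs : 0 ≤ s) :
    klFun ((1 - t) * x + t * s) ≤
      klFun x + t * (s * Real.log ((1 - t) * x + t * s) - x * Real.log x - x * Real.log (1 - t)) := by
  set y := (1 - t) * x + t * s with hy
  have h1t : 0 < 1 - t := by linarith
  have hy0 : 0 ≤ y := by positivity
  have hlog : x * t ≤ -(x * Real.log (1 - t)) := by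
    have := Real.log_le_sub_one_of_pos h1t
    nlinarith
  rcases hy0.eq_or_lt with h0 | hyp
  · have h1 : (1 - t) * x = 0 := by nlinarith [mul_nonneg h1t.le hx, mul_nonneg ht0.le hs]
    have h2 : x = 0 := (mul_eq_zero.1 h1).resolve_left h1t.ne'
    rw [← h0, h2]; simp
  have hxy : x - y ≤ x * (Real.log x - Real.log y) := by
    rcases hx.eq_or_lt with h | h
    · rw [← h]; simp only [zero_mul]; linarith
    · have h1 := Real.log_le_sub_one_of_pos (div_pos hyp h)
      rw [Real.log_div hyp.ne' h.ne'] at h1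
      have h2 := mul_le_mul_of_nonneg_left h1 hx
      have h3 : x * (y / x - 1) = y - x := by field_simp
      linarith
  simp only [klFun_apply]
  have hylog : y * Real.log y = (1 - t) * (x * Real.log y) + t * (s * Real.log y) := by
    rw [hy]; ring
  have h4 := mul_le_mul_of_nonneg_left hxy h1t.le
  have h5 : (1 - t) * (x - y) + (y - x) = t ^ 2 * (s - x) := by rw [hy]; ring
  have h6 := mul_le_mul_of_nonneg_left hlog ht0.le
  have h7 : 0 ≤ t ^ 2 * s := by positivity
  nlinarith

section EulerLagrange

variable {V : Torus → ℝ} [IsProbabilityMeasure (refMeasure V)]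

/-- At β = 0 the free energy does not see the logarithmic energy, but then the minimizer is the
reference measure, whose energy is finite. -/
theorem IsEquilibrium.logEnergy_ne_top (hV : Continuous V) {β : ℝ} (hβ : 0 ≤ β)
    {μ : ProbabilityMeasure Torus} (h : IsEquilibrium β V μ) :
    logEnergy (μ : Measure Torus) ≠ ⊤ := by
  rcases hβ.eq_or_lt with h0 | hpos
  · subst h0
    have h1 := h.freeEnergy_le hV
    rw [ENNReal.ofReal_zero, zero_mul, freeEnergy, ENNReal.ofReal_zero, zero_mul, zero_add] at h1
    have h2 := InformationTheory.klDiv_eq_zero_iff.1 (nonpos_iff_eq_zero.1 h1)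
    rw [h2]
    exact ne_top_of_le_ne_top ENNReal.ofReal_ne_top
      (mutualEnergy_withDensity_le (continuous_refDensity hV).measurable
      (fun x => (refDensity_pos V x).le) (memLp_of_continuous (continuous_refDensity hV) 2)
      (refMeasure V))
  · intro htop
    apply h.freeEnergy_ne_top hV
    rw [freeEnergy, htop, ENNReal.mul_top (ENNReal.ofReal_pos.2 hpos).ne', top_add]

theorem mutualEnergy_refMeasure_ne_top (hV : Continuous V) (μ : Measure Torus)
    [IsProbabilityMeasure μ] : mutualEnergy μ (refMeasure V) ≠ ⊤ :=
  ne_top_of_le_ne_top ENNReal.ofReal_ne_top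
    (mutualEnergy_withDensity_le (continuous_refDensity hV).measurable
      (fun x => (refDensity_pos V x).le) (memLp_of_continuous (continuous_refDensity hV) 2) μ)

/-- The logarithmic potential of a measure. -/
def measPot (μ : Measure Torus) (x : Torus) : ℝ≥0∞ := ∫⁻ y, logKernel (x - y) ∂μ

theorem measurable_measPot (μ : Measure Torus) [SFinite μ] : Measurable (measPot μ) :=
  measurable_logKernel_prod.lintegral_prod_right'

theorem ae_measPot_lt_top (hV : Continuous V) (μ : Measure Torus) [IsProbabilityMeasure μ] :
    ∀ᵐ x ∂(refMeasure V), measPot μ x < ⊤ := by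
  refine ae_lt_top (measurable_measPot μ) ?_
  change mutualEnergy (refMeasure V) μ ≠ ⊤
  rw [mutualEnergy_comm]
  exact mutualEnergy_refMeasure_ne_top hV μ

theorem IsDensity.integrable {ν : ProbabilityMeasure Torus} {a : Torus → ℝ}
    (h : IsDensity V (ν : Measure Torus) a) : Integrable a (refMeasure V) := by
  rw [← lintegral_ofReal_ne_top_iff_integrable h.1.aestronglyMeasurable (ae_of_all _ h.2.1),
    h.lintegral_eq_one]
  exact ENNReal.one_ne_top

theorem IsDensity.integral_eq_one {ν : ProbabilityMeasure Torus} {a : Torus → ℝ}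
    (h : IsDensity V (ν : Measure Torus) a) : ∫ x, a x ∂(refMeasure V) = 1 := by
  rw [integral_eq_lintegral_of_nonneg_ae (ae_of_all _ h.2.1) h.1.aestronglyMeasurable,
    h.lintegral_eq_one, ENNReal.toReal_one]

theorem IsDensity.integrable_klFun {ν : ProbabilityMeasure Torus} {a : Torus → ℝ}
    (h : IsDensity V (ν : Measure Torus) a)
    (hfin : InformationTheory.klDiv (ν : Measure Torus) (refMeasure V) ≠ ⊤) :
    Integrable (fun x => InformationTheory.klFun (a x)) (refMeasure V) := by
  have hm : Measurable fun x => InformationTheory.klFun (a x) :=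
    InformationTheory.measurable_klFun.comp h.1
  rw [← lintegral_ofReal_ne_top_iff_integrable hm.aestronglyMeasurable
    (ae_of_all _ fun x => InformationTheory.klFun_nonneg (h.2.1 x)), ← h.klDiv_eq]
  exact hfin

theorem IsDensity.toReal_klDiv {ν : ProbabilityMeasure Torus} {a : Torus → ℝ}
    (h : IsDensity V (ν : Measure Torus) a) :
    (InformationTheory.klDiv (ν : Measure Torus) (refMeasure V)).toReal =
      ∫ x, InformationTheory.klFun (a x) ∂(refMeasure V) := by
  rw [integral_eq_lintegral_of_nonneg_ae
    (ae_of_all _ fun x => InformationTheory.klFun_nonneg (h.2.1 x))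
    (InformationTheory.measurable_klFun.comp h.1).aestronglyMeasurable, h.klDiv_eq]

theorem IsDensity.integrable_mul_log {ν : ProbabilityMeasure Torus} {a : Torus → ℝ}
    (h : IsDensity V (ν : Measure Torus) a)
    (hfin : InformationTheory.klDiv (ν : Measure Torus) (refMeasure V) ≠ ⊤) :
    Integrable (fun x => a x * Real.log (a x)) (refMeasure V) := by
  have := ((h.integrable_klFun hfin).add h.integrable).sub (integrable_const (1 : ℝ))
  refine this.congr (ae_of_all _ fun x => ?_)
  simp only [Pi.add_apply, Pi.sub_apply, InformationTheory.klFun_apply]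
  ring

theorem IsDensity.integral_mul_log {ν : ProbabilityMeasure Torus} {a : Torus → ℝ}
    (h : IsDensity V (ν : Measure Torus) a)
    (hfin : InformationTheory.klDiv (ν : Measure Torus) (refMeasure V) ≠ ⊤) :
    ∫ x, a x * Real.log (a x) ∂(refMeasure V) =
      (InformationTheory.klDiv (ν : Measure Torus) (refMeasure V)).toReal := by
  have e : ∀ x, InformationTheory.klFun (a x) = a x * Real.log (a x) + (1 - a x) := fun x => by
    rw [InformationTheory.klFun_apply]; ring
  rw [h.toReal_klDiv]
  simp only [e]
  have h1 : Integrable (fun x => 1 - a x) (refMeasure V) := (integrable_const 1).sub h.integrable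
  rw [integral_add (h.integrable_mul_log hfin) h1, integral_sub (integrable_const 1) h.integrable, h.integral_eq_one]
  simp

/-- First variation of the free energy at a minimizer, towards the uniform distribution on a
sublevel set. -/
theorem IsEquilibrium.le_log_add (hV : Continuous V) {β : ℝ} (hβ : 0 ≤ β)
    {μ : ProbabilityMeasure Torus} (h : IsEquilibrium β V μ) {a : Torus → ℝ}
    (ha : IsDensity V (μ : Measure Torus) a) {A b : ℝ} (hA : 0 < A) (hb : 0 ≤ b)
    (hB : refMeasure V {x | a x ≤ A ∧ measPot μ x ≤ ENNReal.ofReal b} ≠ 0) :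
    (InformationTheory.klDiv (μ : Measure Torus) (refMeasure V)).toReal +
      2 * β * (logEnergy (μ : Measure Torus)).toReal ≤ Real.log A + 2 * β * b := by
  set B : Set Torus := {x | a x ≤ A ∧ measPot μ x ≤ ENNReal.ofReal b} with hBdef
  have hBm : MeasurableSet B := (measurableSet_le ha.1 measurable_const).inter
    (measurableSet_le (measurable_measPot _) measurable_const)
  have hEfin := h.logEnergy_ne_top hV hβ
  have hFfin := h.freeEnergy_ne_top hV
  have hKfin : InformationTheory.klDiv (μ : Measure Torus) (refMeasure V) ≠ ⊤ := by
    rw [freeEnergy] at hFfin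
    exact (ENNReal.add_ne_top.1 hFfin).2
  set K := (InformationTheory.klDiv (μ : Measure Torus) (refMeasure V)).toReal with hK
  set E := (logEnergy (μ : Measure Torus)).toReal with hE
  have hK0 : 0 ≤ K := ENNReal.toReal_nonneg
  have hE0 : 0 ≤ E := ENNReal.toReal_nonneg
  set z := (refMeasure V).real B with hz
  have hz0 : 0 < z := ENNReal.toReal_pos hB (measure_ne_top _ _)
  -- The competitor is the reference measure conditioned on `B`: its density is bounded, so its
  -- energy is finite, and its mutual energy with `μ` is at most `b`.
  let s : Torus → ℝ := B.indicator fun _ => 1 / z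
  have hsm : Measurable s := measurable_const.indicator hBm
  have hs0 : ∀ x, 0 ≤ s x := fun x => Set.indicator_nonneg (fun _ _ => by positivity) x
  have hsi : Integrable s (refMeasure V) := (integrable_const _).indicator hBm
  have hsint : ∫ x, s x ∂(refMeasure V) = 1 := by
    rw [integral_indicator hBm, setIntegral_const, smul_eq_mul]
    exact mul_one_div_cancel hz0.ne'
  have hslint : ∫⁻ x, ENNReal.ofReal (s x) ∂(refMeasure V) = 1 := by
    rw [← ofReal_integral_eq_lintegral_ofReal hsi (ae_of_all _ hs0), hsint, ENNReal.ofReal_one]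
  let ν : ProbabilityMeasure Torus :=
    ⟨(refMeasure V).withDensity fun x => ENNReal.ofReal (s x), ⟨by
      rw [withDensity_apply _ MeasurableSet.univ, Measure.restrict_univ, hslint]⟩⟩
  have hν : IsDensity V (ν : Measure Torus) s := ⟨hsm, hs0, rfl⟩
  have hM : mutualEnergy (μ : Measure Torus) ν ≤ ENNReal.ofReal b := by
    rw [mutualEnergy_comm]
    change ∫⁻ x, measPot μ x ∂((refMeasure V).withDensity fun x => ENNReal.ofReal (s x)) ≤ _
    rw [lintegral_withDensity_eq_lintegral_mul _ hsm.ennreal_ofReal (measurable_measPot _)]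
    calc _ ≤ ∫⁻ x, ENNReal.ofReal (s x) * ENNReal.ofReal b ∂(refMeasure V) := by
          refine lintegral_mono fun x => ?_
          rw [Pi.mul_apply]
          by_cases hx : x ∈ B
          · gcongr
            exact hx.2
          · simp [s, hx]
      _ = ENNReal.ofReal b := by
          rw [lintegral_mul_const _ hsm.ennreal_ofReal, hslint, one_mul]
  have hN : logEnergy (ν : Measure Torus) ≠ ⊤ := by
    have hle : (ν : Measure Torus) ≤ ENNReal.ofReal (1 / z) • refMeasure V := by
      change (refMeasure V).withDensity (fun x => ENNReal.ofReal (s x)) ≤ _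
      rw [← withDensity_const]
      refine withDensity_mono (ae_of_all _ fun x => ENNReal.ofReal_le_ofReal ?_)
      exact Set.indicator_le_self' (fun _ _ => by positivity) x
    have h1 : logEnergy (ν : Measure Torus) ≤
        ENNReal.ofReal (1 / z) * mutualEnergy (ν : Measure Torus) (refMeasure V) := by
      unfold logEnergy mutualEnergy
      rw [← lintegral_const_mul' _ _ ENNReal.ofReal_ne_top]
      refine lintegral_mono fun x => ?_
      refine (lintegral_mono' hle le_rfl).trans_eq ?_
      rw [lintegral_smul_measure, smul_eq_mul]
    exact ne_top_of_le_ne_top (ENNReal.mul_ne_top ENNReal.ofReal_ne_top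
      (mutualEnergy_refMeasure_ne_top hV _)) h1
  set N := (logEnergy (ν : Measure Torus)).toReal with hNdef
  have hN0 : 0 ≤ N := ENNReal.toReal_nonneg
  -- Minimality against the mixture, divided by t. On `B` the mixed density is at most A + t/z,
  -- which bounds the logarithm by a constant.
  have key : ∀ t : ℝ, 0 < t → t < 1 →
      0 ≤ β * ((t - 2) * E + 2 * (1 - t) * b + t * N) +
        (Real.log (A + t / z) - K - Real.log (1 - t)) := by
    intro t ht0 ht1
    have htI : t ∈ Set.Icc (0 : ℝ) 1 := ⟨ht0.le, ht1.le⟩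
    have h1t : 0 < 1 - t := by linarith
    have hF := h (mix t htI μ ν)
    have hmix := IsDensity.mix htI ha hν
    let R : Torus → ℝ := fun x => InformationTheory.klFun (a x) + t * (s x * Real.log (A + t / z)
      - a x * Real.log (a x) - a x * Real.log (1 - t))
    have hRge : ∀ x, InformationTheory.klFun ((1 - t) * a x + t * s x) ≤ R x := by
      intro x
      refine (klFun_mix_le ht0 ht1 (ha.2.1 x) (hs0 x)).trans ?_
      have : s x * Real.log ((1 - t) * a x + t * s x) ≤ s x * Real.log (A + t / z) := by
        by_cases hx : x ∈ B
        · have hsx : s x = 1 / z := Set.indicator_of_mem hx _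
          refine mul_le_mul_of_nonneg_left ?_ (hs0 x)
          have hax := ha.2.1 x
          have haA : a x ≤ A := hx.1
          rw [hsx]
          refine Real.log_le_log (by positivity) ?_
          have : t * (1 / z) = t / z := by ring
          nlinarith
        · have hsx : s x = 0 := Set.indicator_of_notMem hx _
          simp [hsx]
      simp only [R]
      nlinarith
    have hR0 : ∀ x, 0 ≤ R x := fun x =>
      (InformationTheory.klFun_nonneg (hmix.2.1 x)).trans (hRge x)
    have hi1 := ha.integrable_klFun hKfin
    have hi2 := ha.integrable_mul_log hKfin
    have hi3 : Integrable (fun x => s x * Real.log (A + t / z)) (refMeasure V) := hsi.mul_const _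
    have hi4 : Integrable (fun x => a x * Real.log (1 - t)) (refMeasure V) :=
      ha.integrable.mul_const _
    have hRi : Integrable R (refMeasure V) := hi1.add (((hi3.sub hi2).sub hi4).const_mul t)
    have hRint : ∫ x, R x ∂(refMeasure V) =
        K + t * (Real.log (A + t / z) - K - Real.log (1 - t)) := by
      have hi5 : Integrable (fun x => s x * Real.log (A + t / z) - a x * Real.log (a x))
        (refMeasure V) := hi3.sub hi2
      have hi6 : Integrable (fun x => s x * Real.log (A + t / z) - a x * Real.log (a x)
        - a x * Real.log (1 - t)) (refMeasure V) := hi5.sub hi4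
      simp only [R]
      rw [integral_add hi1 (hi6.const_mul t), integral_const_mul, integral_sub hi5 hi4,
        integral_sub hi3 hi2, integral_mul_const, integral_mul_const, hsint, ha.integral_eq_one,
        ha.integral_mul_log hKfin, ← ha.toReal_klDiv]
      simp only [one_mul, ← hK]
    have hKmix : InformationTheory.klDiv (mix t htI μ ν : Measure Torus) (refMeasure V) ≤
        ENNReal.ofReal (K + t * (Real.log (A + t / z) - K - Real.log (1 - t))) := by
      rw [hmix.klDiv_eq, ← hRint, ofReal_integral_eq_lintegral_ofReal hRi (ae_of_all _ hR0)]
      exact lintegral_mono fun x => ENNReal.ofReal_le_ofReal (hRge x)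
    have hEmix : logEnergy (mix t htI μ ν : Measure Torus) ≤
        ENNReal.ofReal ((1 - t) ^ 2 * E + 2 * ((1 - t) * t) * b + t ^ 2 * N) := by
      rw [logEnergy_mix, ENNReal.ofReal_add (by positivity) (by positivity),
        ENNReal.ofReal_add (by positivity) (by positivity), ENNReal.ofReal_mul (by positivity),
        ENNReal.ofReal_mul (by positivity), ENNReal.ofReal_mul (by positivity),
        ENNReal.ofReal_mul (by positivity), ENNReal.ofReal_mul (by positivity),
        ENNReal.ofReal_pow h1t.le, ENNReal.ofReal_pow ht0.le, hE, ENNReal.ofReal_toReal hEfin,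
        hNdef, ENNReal.ofReal_toReal hN, ENNReal.ofReal_ofNat]
      gcongr
    have hK' : 0 ≤ K + t * (Real.log (A + t / z) - K - Real.log (1 - t)) := by
      rw [← hRint]; exact integral_nonneg hR0
    have hF2 : ENNReal.ofReal (β * E + K) ≤ ENNReal.ofReal
        (β * ((1 - t) ^ 2 * E + 2 * ((1 - t) * t) * b + t ^ 2 * N) +
          (K + t * (Real.log (A + t / z) - K - Real.log (1 - t)))) := by
      rw [ENNReal.ofReal_add (by positivity) hK0, ENNReal.ofReal_mul hβ,
        ENNReal.ofReal_add (by positivity) hK', ENNReal.ofReal_mul hβ, hE,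
        ENNReal.ofReal_toReal hEfin, hK, ENNReal.ofReal_toReal hKfin]
      refine hF.trans ?_
      unfold freeEnergy
      gcongr
    have hF3 := (ENNReal.ofReal_le_ofReal_iff (add_nonneg (by positivity) hK')).1 hF2
    have hF4 : 0 ≤ t * (β * ((t - 2) * E + 2 * (1 - t) * b + t * N) +
        (Real.log (A + t / z) - K - Real.log (1 - t))) := by nlinarith
    exact nonneg_of_mul_nonneg_right hF4 ht0
  have hlim : Tendsto (fun t : ℝ => β * ((t - 2) * E + 2 * (1 - t) * b + t * N) +
      (Real.log (A + t / z) - K - Real.log (1 - t))) (𝓝[>] 0)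
      (𝓝 (β * ((0 - 2) * E + 2 * (1 - 0) * b + 0 * N) +
        (Real.log (A + 0 / z) - K - Real.log (1 - 0)))) := by
    refine tendsto_nhdsWithin_of_tendsto_nhds (ContinuousAt.tendsto
      (f := fun t : ℝ => β * ((t - 2) * E + 2 * (1 - t) * b + t * N) +
      (Real.log (A + t / z) - K - Real.log (1 - t))) (x := 0) ?_)
    have h1 : ContinuousAt (fun t : ℝ => Real.log (A + t / z)) 0 :=
      ContinuousAt.log (by fun_prop) (by simpa using hA.ne')
    have h2 : ContinuousAt (fun t : ℝ => Real.log (1 - t)) 0 :=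
      ContinuousAt.log (by fun_prop) (by simp)
    fun_prop
  have hev : ∀ᶠ t in 𝓝[>] (0 : ℝ), 0 ≤ β * ((t - 2) * E + 2 * (1 - t) * b + t * N) +
      (Real.log (A + t / z) - K - Real.log (1 - t)) := by
    filter_upwards [Ioo_mem_nhdsGT (zero_lt_one (α := ℝ))] with t ht using key t ht.1 ht.2
  have hfinal := ge_of_tendsto hlim hev
  simp only [zero_div, add_zero, sub_zero, Real.log_one, zero_mul] at hfinal
  linarith

/-- Where the inequality fails there are rationals A, b with a ≤ A, potential at most b and log A +
2βb < C. By the first variation each such set is null, and there are countably many pairs. -/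
theorem IsEquilibrium.exp_le (hV : Continuous V) {β : ℝ} (hβ : 0 ≤ β)
    {μ : ProbabilityMeasure Torus} (h : IsEquilibrium β V μ) {a : Torus → ℝ}
    (ha : IsDensity V (μ : Measure Torus) a) :
    ∀ᵐ x ∂(refMeasure V), Real.exp
      ((InformationTheory.klDiv (μ : Measure Torus) (refMeasure V)).toReal +
      2 * β * (logEnergy (μ : Measure Torus)).toReal - 2 * β * (measPot μ x).toReal) ≤ a x := by
  set C := (InformationTheory.klDiv (μ : Measure Torus) (refMeasure V)).toReal +
      2 * β * (logEnergy (μ : Measure Torus)).toReal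
  have hnull : ∀ᵐ x ∂(refMeasure V), ∀ q : ℚ × ℚ, 0 < (q.1 : ℝ) → 0 ≤ (q.2 : ℝ) →
      Real.log q.1 + 2 * β * q.2 < C →
      ¬ (a x ≤ q.1 ∧ measPot μ x ≤ ENNReal.ofReal q.2) := by
    rw [ae_all_iff]
    intro q
    by_cases hq : 0 < (q.1 : ℝ) ∧ 0 ≤ (q.2 : ℝ) ∧ Real.log q.1 + 2 * β * q.2 < C
    · have h0 : refMeasure V {x | a x ≤ q.1 ∧ measPot μ x ≤ ENNReal.ofReal q.2} = 0 := by
        by_contra hne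
        exact absurd (h.le_log_add hV hβ ha hq.1 hq.2.1 hne) (not_le.2 hq.2.2)
      filter_upwards [measure_eq_zero_iff_ae_notMem.1 h0] with x hx _ _ _ using hx
    · exact ae_of_all _ fun x h1 h2 h3 => absurd ⟨h1, h2, h3⟩ hq
  filter_upwards [hnull, ae_measPot_lt_top hV (μ : Measure Torus)] with x hx hfin
  by_contra! hlt
  set u := (measPot μ x).toReal with hu
  have hu0 : 0 ≤ u := ENNReal.toReal_nonneg
  obtain ⟨A, hA1, hA2⟩ := exists_rat_btwn hlt
  have hA0 : 0 < (A : ℝ) := (ha.2.1 x).trans_lt hA1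
  have hlogA : Real.log A < C - 2 * β * u := by
    rw [← Real.log_exp (C - 2 * β * u)]
    exact Real.log_lt_log hA0 hA2
  set δ := C - 2 * β * u - Real.log A with hδ
  have hδ0 : 0 < δ := by linarith
  -- The slack δ/(2β + 1) ensures 2β(b - u) < δ, including when β = 0.
  obtain ⟨b, hb1, hb2⟩ := exists_rat_btwn (show u < u + δ / (2 * β + 1) from
    lt_add_of_pos_right _ (by positivity))
  refine hx (A, b) hA0 (hu0.trans hb1.le) ?_ ⟨hA1.le, ?_⟩
  · have h1 : 2 * β * (b - u) ≤ 2 * β * (δ / (2 * β + 1)) :=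
      mul_le_mul_of_nonneg_left (by linarith) (by positivity)
    have h2 : 2 * β * (δ / (2 * β + 1)) < δ := by
      rw [← mul_div_assoc, div_lt_iff₀ (by positivity)]
      nlinarith
    simp only
    nlinarith
  · rw [← ENNReal.ofReal_toReal hfin.ne]
    exact ENNReal.ofReal_le_ofReal hb1.le

/-- The one-sided bound suffices: integrating log a + 2βU - (K + 2βE) against the minimizer, with U
its potential, gives exactly K + 2βE - (K + 2βE) = 0. The integrand is nonnegative, hence zero, and
a > 0 a.e. -/
theorem IsEquilibrium.euler_lagrange (hV : Continuous V) {β : ℝ} (hβ : 0 ≤ β)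
    {μ : ProbabilityMeasure Torus} (h : IsEquilibrium β V μ) {a : Torus → ℝ}
    (ha : IsDensity V (μ : Measure Torus) a) :
    ∀ᵐ x ∂(refMeasure V), a x = Real.exp
      ((InformationTheory.klDiv (μ : Measure Torus) (refMeasure V)).toReal +
      2 * β * (logEnergy (μ : Measure Torus)).toReal - 2 * β * (measPot μ x).toReal) := by
  set K := (InformationTheory.klDiv (μ : Measure Torus) (refMeasure V)).toReal with hK
  set E := (logEnergy (μ : Measure Torus)).toReal with hE
  have hEfin := h.logEnergy_ne_top hV hβ
  have hKfin : InformationTheory.klDiv (μ : Measure Torus) (refMeasure V) ≠ ⊤ := by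
    have := h.freeEnergy_ne_top hV
    rw [freeEnergy] at this
    exact (ENNReal.add_ne_top.1 this).2
  have hle := h.exp_le hV hβ ha
  rw [← hK, ← hE] at hle
  have hUm := measurable_measPot (μ : Measure Torus)
  have hElint : ∫⁻ x, ENNReal.ofReal (a x * (measPot μ x).toReal) ∂(refMeasure V) =
      logEnergy (μ : Measure Torus) := by
    have e : logEnergy (μ : Measure Torus) = ∫⁻ x, measPot μ x
        ∂((refMeasure V).withDensity fun x => ENNReal.ofReal (a x)) :=
      congrArg (fun m : Measure Torus => ∫⁻ x, measPot μ x ∂m) ha.2.2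
    rw [e, lintegral_withDensity_eq_lintegral_mul _ ha.1.ennreal_ofReal hUm]
    refine lintegral_congr_ae ?_
    filter_upwards [ae_measPot_lt_top hV (μ : Measure Torus)] with x hx
    rw [ENNReal.ofReal_mul (ha.2.1 x), ENNReal.ofReal_toReal hx.ne, Pi.mul_apply]
  have hnn : ∀ x, 0 ≤ a x * (measPot μ x).toReal := fun x =>
    mul_nonneg (ha.2.1 x) ENNReal.toReal_nonneg
  have hmeas : Measurable fun x => a x * (measPot μ x).toReal := ha.1.mul hUm.ennreal_toReal
  have hUi : Integrable (fun x => a x * (measPot μ x).toReal) (refMeasure V) := by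
    rw [← lintegral_ofReal_ne_top_iff_integrable hmeas.aestronglyMeasurable (ae_of_all _ hnn),
      hElint]
    exact hEfin
  have hUint : ∫ x, a x * (measPot μ x).toReal ∂(refMeasure V) = E := by
    rw [integral_eq_lintegral_of_nonneg_ae (ae_of_all _ hnn) hmeas.aestronglyMeasurable, hElint]
  have hlogi := ha.integrable_mul_log hKfin
  let G : Torus → ℝ := fun x =>
    a x * Real.log (a x) + 2 * β * (a x * (measPot μ x).toReal) - (K + 2 * β * E) * a x
  have hi1 : Integrable (fun x => a x * Real.log (a x) + 2 * β * (a x * (measPot μ x).toReal))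
    (refMeasure V) := hlogi.add (hUi.const_mul _)
  have hGi : Integrable G (refMeasure V) := hi1.sub (ha.integrable.const_mul _)
  have hGint : ∫ x, G x ∂(refMeasure V) = 0 := by
    simp only [G]
    rw [integral_sub hi1 (ha.integrable.const_mul _), integral_add hlogi (hUi.const_mul _),
      integral_const_mul, integral_const_mul, hUint, ha.integral_eq_one, ha.integral_mul_log hKfin,
      ← hK]
    ring
  have hlog : ∀ᵐ x ∂(refMeasure V),
      0 < a x ∧ K + 2 * β * E - 2 * β * (measPot μ x).toReal ≤ Real.log (a x) := by
    filter_upwards [hle] with x hx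
    have hpos := (Real.exp_pos _).trans_le hx
    exact ⟨hpos, (Real.le_log_iff_exp_le hpos).2 hx⟩
  have hG0 : 0 ≤ᵐ[refMeasure V] G := by
    filter_upwards [hlog] with x hx
    have := mul_le_mul_of_nonneg_left hx.2 hx.1.le
    simp only [G, Pi.zero_apply]
    linarith
  have hGz := (integral_eq_zero_iff_of_nonneg_ae hG0 hGi).1 hGint
  filter_upwards [hGz, hlog] with x hx hlx
  have h1 : a x * (Real.log (a x) + 2 * β * (measPot μ x).toReal - (K + 2 * β * E)) = 0 := by
    have : G x = 0 := hx
    simp only [G] at this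
    linarith
  have h2 := (mul_eq_zero.1 h1).resolve_left hlx.1.ne'
  rw [show K + 2 * β * E - 2 * β * (measPot μ x).toReal = Real.log (a x) by linarith,
    Real.exp_log hlx.1]

/-- The Euler–Lagrange equation for the density of the equilibrium measure. -/
theorem exists_eqDensity_eq (hV : Continuous V) {β : ℝ} (hβ : 0 ≤ β) :
    MemLp (eqDensity β V) 2 volume ∧
    (eqMeasure β V : Measure Torus) =
      volume.withDensity (fun x => ENNReal.ofReal (eqDensity β V x)) ∧
    ∃ C, 0 ≤ C ∧ C ≤ 2 * β * refEnergyBound V ∧ ∀ᵐ x : Torus,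
      eqDensity β V x = refDensity V x * Real.exp (C - 2 * β * pot (eqDensity β V) x) := by
  have h := isEquilibrium_eqMeasure hV β
  set μ := eqMeasure β V with hμ
  have hFfin := h.freeEnergy_ne_top hV
  obtain ⟨a, ha⟩ := exists_isDensity (ac_of_freeEnergy_ne_top hFfin)
  have hEL := (ac_refMeasure hV).ae_le (h.euler_lagrange hV hβ ha)
  set K := (InformationTheory.klDiv (μ : Measure Torus) (refMeasure V)).toReal with hK
  set E := (logEnergy (μ : Measure Torus)).toReal with hE
  have hK0 : 0 ≤ K := ENNReal.toReal_nonneg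
  have hE0 : 0 ≤ E := ENNReal.toReal_nonneg
  have hEfin := h.logEnergy_ne_top hV hβ
  have hKfin : InformationTheory.klDiv (μ : Measure Torus) (refMeasure V) ≠ ⊤ := by
    rw [freeEnergy] at hFfin
    exact (ENNReal.add_ne_top.1 hFfin).2
  -- Comparison with the reference measure. It yields K + 2βE ≤ 2(βE + K) ≤ 2β `refEnergyBound`, so
  -- the constant is O(β), as the limit requires.
  have hCle : β * E + K ≤ β * refEnergyBound V := by
    have h1 := h.freeEnergy_le hV
    rw [freeEnergy, ← ENNReal.ofReal_toReal hEfin, ← ENNReal.ofReal_toReal hKfin,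
      ← ENNReal.ofReal_mul hβ, ← ENNReal.ofReal_mul hβ,
      ← ENNReal.ofReal_add (by positivity) hK0] at h1
    exact (ENNReal.ofReal_le_ofReal_iff (mul_nonneg hβ refEnergyBound_nonneg)).1 h1
  have hr := continuous_refDensity hV
  have hpm : Measurable fun x => refDensity V x * a x := hr.measurable.mul ha.1
  have hp0 : ∀ x, 0 ≤ refDensity V x * a x := fun x =>
    mul_nonneg (refDensity_pos V x).le (ha.2.1 x)
  have hμp : (μ : Measure Torus) = volume.withDensity
      fun x => ENNReal.ofReal (refDensity V x * a x) := by
    rw [ha.2.2, refMeasure_eq, ← withDensity_mul _ hr.measurable.ennreal_ofReal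
      ha.1.ennreal_ofReal]
    congr 1
    funext x
    rw [Pi.mul_apply, ENNReal.ofReal_mul (refDensity_pos V x).le]
  have hpe : eqDensity β V =ᵐ[volume] fun x => refDensity V x * a x := by
    have h1 := Measure.rnDeriv_withDensity (volume : Measure Torus) hpm.ennreal_ofReal
    rw [← hμp] at h1
    filter_upwards [h1] with x hx
    rw [eqDensity, hx, ENNReal.toReal_ofReal (hp0 x)]
  -- The potential is nonnegative, so the Euler–Lagrange equation bounds the density by a constant;
  -- only then can the potential be treated as a real integral.
  have hpL : MemLp (fun x => refDensity V x * a x) 2 volume := by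
    obtain ⟨M, hM0, hM⟩ := exists_bound_of_continuous hr
    refine MemLp.of_bound hpm.aestronglyMeasurable (M * Real.exp (K + 2 * β * E)) ?_
    filter_upwards [hEL] with x hx
    rw [Real.norm_eq_abs, abs_mul, hx, Real.abs_exp]
    refine mul_le_mul (hM x) (Real.exp_le_exp.2 ?_) (Real.exp_pos _).le hM0
    have : 0 ≤ 2 * β * (measPot μ x).toReal := by positivity
    linarith
  have hpot : ∀ x, (measPot μ x).toReal = pot (eqDensity β V) x := by
    intro x
    have h1 : measPot (volume.withDensity fun x => ENNReal.ofReal (refDensity V x * a x)) x =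
        ENNReal.ofReal (pot (fun x => refDensity V x * a x) x) :=
      lintegral_logKernel_withDensity hpm hp0 hpL x
    rw [hμp, h1, ENNReal.toReal_ofReal (pot_nonneg hp0 x), pot_congr hpe]
  refine ⟨(memLp_congr_ae hpe).2 hpL, ?_, K + 2 * β * E, by positivity, by nlinarith, ?_⟩
  · rw [hμp]
    refine withDensity_congr_ae ?_
    filter_upwards [hpe] with x hx
    rw [hx]
  · filter_upwards [hpe, hEL] with x hx1 hx2
    rw [hx1, hx2, hpot]

end EulerLagrange

/-! ### The Hilbert transform -/

theorem cotHalf_eq (x : Torus) : cotHalf x = sinT 1 x / (1 - cosT 1 x) := by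
  refine torus_forall (P := fun x => cotHalf x = sinT 1 x / (1 - cosT 1 x)) (fun t => ?_) x
  rw [cotHalf_coe, sinT_coe, cosT_coe]
  have h1 : Real.cos t = 1 - 2 * Real.sin (t / 2) ^ 2 := by
    rw [show t = 2 * (t / 2) by ring, Real.cos_two_mul, Real.cos_sq']; ring_nf
  have h2 : Real.sin t = 2 * Real.sin (t / 2) * Real.cos (t / 2) := by
    rw [← Real.sin_two_mul]; ring_nf
  push_cast
  rw [one_mul, h1, h2, Real.tan_eq_sin_div_cos, one_div_div]
  -- At the pole both sides are 0 by the convention for division by zero.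
  rcases eq_or_ne (Real.sin (t / 2)) 0 with h | h
  · simp [h]
  · field_simp
    ring

theorem measurable_cotHalf : Measurable cotHalf := by
  have : cotHalf = fun x => sinT 1 x / (1 - cosT 1 x) := funext cotHalf_eq
  rw [this]
  exact (smooth_sinT 1).continuous.measurable.div
    (measurable_const.sub (smooth_cosT 1).continuous.measurable)

theorem abs_cotHalf_mul_le (x : Torus) : |cotHalf x| * absSinHalf x ≤ 1 := by
  refine torus_forall (P := fun x => |cotHalf x| * absSinHalf x ≤ 1) (fun t => ?_) x
  rw [cotHalf_coe, absSinHalf_coe, ← abs_mul, Real.tan_eq_sin_div_cos, one_div_div]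
  rcases eq_or_ne (Real.sin (t / 2)) 0 with h | h
  · simp [h]
  · rw [div_mul_cancel₀ _ h]
    exact Real.abs_cos_le_one _

/-- The logarithmic kernel truncated at height `-log c`. -/
def kernelTrunc (c : ℝ) (x : Torus) : ℝ := -Real.log (max (absSinHalf x) c)

/-- The truncated cotangent kernel. -/
def cotTrunc (c : ℝ) (x : Torus) : ℝ :=
  {y : Torus | c < absSinHalf y}.indicator cotHalf x

theorem measurable_cotTrunc (c : ℝ) : Measurable (cotTrunc c) :=
  measurable_cotHalf.indicator (measurableSet_lt measurable_const continuous_absSinHalf.measurable)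

theorem abs_cotTrunc_le {c : ℝ} (hc : 0 < c) (x : Torus) : |cotTrunc c x| ≤ 1 / c := by
  unfold cotTrunc
  by_cases h : x ∈ {y : Torus | c < absSinHalf y}
  · rw [Set.indicator_of_mem h, le_div_iff₀ hc]
    exact (mul_le_mul_of_nonneg_left (le_of_lt h) (abs_nonneg _)).trans (abs_cotHalf_mul_le x)
  · rw [Set.indicator_of_notMem h, abs_zero]
    positivity

/-- The level set is countable, being given by cos(X - t) = 1 - 2c². These are the corners of the
truncated kernel. -/
theorem ae_abs_sin_ne {c : ℝ} (hc0 : 0 < c) (hc1 : c < 1) (X : ℝ) :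
    ∀ᵐ t : ℝ, |Real.sin ((X - t) / 2)| ≠ c := by
  have hcount : {t : ℝ | |Real.sin ((X - t) / 2)| = c}.Countable := by
    have hsub : {t : ℝ | |Real.sin ((X - t) / 2)| = c} ⊆
        (Set.range fun k : ℤ => X - (2 * k * Real.pi + Real.arccos (1 - 2 * c ^ 2))) ∪
        Set.range fun k : ℤ => X - (2 * k * Real.pi - Real.arccos (1 - 2 * c ^ 2)) := by
      intro t ht
      have h1 : Real.cos (X - t) = 1 - 2 * c ^ 2 := by
        rw [← show |Real.sin ((X - t) / 2)| = c from ht, sq_abs,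
          show X - t = 2 * ((X - t) / 2) by ring, Real.cos_two_mul, Real.cos_sq']; ring_nf
      have h2 : Real.cos (Real.arccos (1 - 2 * c ^ 2)) = Real.cos (X - t) := by
        rw [h1, Real.cos_arccos (by nlinarith) (by nlinarith)]
      obtain ⟨k, hk | hk⟩ := Real.cos_eq_cos_iff.1 h2
      · exact Or.inl ⟨k, by simp only; linarith⟩
      · exact Or.inr ⟨k, by simp only; linarith⟩
    exact ((Set.countable_range _).union (Set.countable_range _)).mono hsub
  have := hcount.measure_zero volume
  exact measure_eq_zero_iff_ae_notMem.1 this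

/-- Truncating the height of the logarithm corresponds exactly to cutting the cotangent off near its
pole: the truncated kernel is constant there, and Lipschitz everywhere because log is Lipschitz on
[c, ∞). -/
theorem hasPrim_kernelTrunc {c : ℝ} (hc0 : 0 < c) (hc1 : c < 1) (x : Torus) :
    HasPrim (fun t => kernelTrunc c (x - t)) (fun t => cotTrunc c (x - t) / 2) := by
  induction x using QuotientAddGroup.induction_on with
  | H X =>
  have hlift : ∀ t : ℝ, kernelTrunc c ((X : Torus) - (t : Torus)) =
      -Real.log (max |Real.sin ((X - t) / 2)| c) := fun t => by
    rw [← AddCircle.coe_sub, kernelTrunc, absSinHalf_coe]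
  refine HasPrim.of_ac (fun a b => ?_) ?_ ?_
  · refine LipschitzOnWith.absolutelyContinuousOnInterval (K := (1 / c).toNNReal) ?_
    refine LipschitzOnWith.of_dist_le_mul fun s _ t _ => ?_
    rw [Real.coe_toNNReal _ (by positivity)]
    change dist (kernelTrunc c ((X : Torus) - (s : Torus)))
      (kernelTrunc c ((X : Torus) - (t : Torus))) ≤ _
    rw [hlift, hlift, dist_neg_neg]
    set p := max |Real.sin ((X - s) / 2)| c
    set q := max |Real.sin ((X - t) / 2)| c
    have hp : p ∈ Set.Ici c := Set.mem_Ici.2 (le_max_right _ _)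
    have hq : q ∈ Set.Ici c := Set.mem_Ici.2 (le_max_right _ _)
    have h1 : |Real.log p - Real.log q| ≤ 1 / c * |p - q| := by
      have := (convex_Ici c).norm_image_sub_le_of_norm_deriv_le (f := Real.log) (C := 1 / c)
        (fun z hz => Real.differentiableAt_log (hc0.trans_le hz).ne') (fun z hz => by
          rw [Real.deriv_log, Real.norm_eq_abs, abs_inv, abs_of_pos (hc0.trans_le hz), one_div]
          exact inv_anti₀ hc0 hz) hq hp
      simpa [Real.norm_eq_abs] using this
    have h2 : |p - q| ≤ |s - t| := by
      refine (abs_max_sub_max_le_abs _ _ c).trans ?_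
      refine (abs_abs_sub_abs_le_abs_sub _ _).trans ?_
      have h3 : |Real.sin ((X - s) / 2) - Real.sin ((X - t) / 2)| ≤
          |(X - s) / 2 - (X - t) / 2| := by
        have := Real.lipschitzWith_sin.dist_le_mul ((X - s) / 2) ((X - t) / 2)
        simpa [Real.dist_eq] using this
      refine h3.trans ?_
      rw [show (X - s) / 2 - (X - t) / 2 = -((s - t) / 2) by ring, abs_neg, abs_div, abs_two]
      linarith [abs_nonneg (s - t)]
    rw [Real.dist_eq, Real.dist_eq]
    exact h1.trans (mul_le_mul_of_nonneg_left h2 (by positivity))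
  · filter_upwards [ae_abs_sin_ne hc0 hc1 X] with t ht
    have hfun : (fun t : ℝ => kernelTrunc c (((X : ℝ) : Torus) - (t : Torus))) =
        fun t => -Real.log (max |Real.sin ((X - t) / 2)| c) := funext hlift
    change HasDerivAt (fun t : ℝ => kernelTrunc c (((X : ℝ) : Torus) - (t : Torus)))
      (cotTrunc c (((X : ℝ) : Torus) - (t : Torus)) / 2) t
    have hcont : Continuous fun t : ℝ => |Real.sin ((X - t) / 2)| := by fun_prop
    rw [hfun, ← AddCircle.coe_sub, cotTrunc]
    rcases lt_or_gt_of_ne ht with hlt | hgt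
    · rw [Set.indicator_of_notMem (by
        simp only [Set.mem_ofPred_eq, absSinHalf_coe, not_lt]; exact hlt.le), zero_div]
      refine (hasDerivAt_const t (-Real.log c)).congr_of_eventuallyEq ?_
      filter_upwards [hcont.continuousAt.eventually_lt continuousAt_const hlt] with s hs
      rw [max_eq_right hs.le]
    · rw [Set.indicator_of_mem (by simpa only [Set.mem_ofPred_eq, absSinHalf_coe] using hgt),
        cotHalf_coe]
      have hne : Real.sin ((X - t) / 2) ≠ 0 := fun h => by
        rw [h, abs_zero] at hgt; linarith
      have h1 : HasDerivAt (fun s : ℝ => (X - s) / 2) (-1 / 2) t :=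
        ((hasDerivAt_id t).const_sub X).div_const 2
      have h2 := (h1.sin.log hne).neg
      have h3 : HasDerivAt (fun s : ℝ => -Real.log (Real.sin ((X - s) / 2)))
          (1 / Real.tan ((X - t) / 2) / 2) t := by
        refine h2.congr_deriv ?_
        rw [Real.tan_eq_sin_div_cos, one_div_div]
        field_simp
      refine h3.congr_of_eventuallyEq ?_
      filter_upwards [continuousAt_const.eventually_lt hcont.continuousAt hgt] with s hs
      rw [max_eq_left hs.le, Real.log_abs]
  · refine MemLp.of_bound (((measurable_cotTrunc c).comp
      (measurable_const.sub measurable_id)).div_const 2).aestronglyMeasurable (1 / c)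
      (ae_of_all _ fun t => ?_)
    rw [Real.norm_eq_abs, abs_div, abs_two]
    have := abs_cotTrunc_le hc0 ((X : Torus) - t)
    have h0 : 0 < 1 / c := by positivity
    linarith

/-- Integration by parts produces no boundary terms at the cut, since the truncated kernel is
continuous across it. The threshold is ε/2 because |e^{ix} - e^{it}| = 2|sin((x-t)/2)|. -/
theorem integral_truncated_cot {u w f : Torus → ℝ} (hu : HasPrim u w) (hf : f =ᵐ[volume] u)
    {ε : ℝ} (h0 : 0 < ε) (h2 : ε < 2) (x : Torus) :
    ∫ t in {t : Torus | ε < 2 * absSinHalf (x - t)}, f t * cotHalf (x - t) =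
      -2 * ∫ t, kernelTrunc (ε / 2) (x - t) * w t := by
  have hm : MeasurableSet {t : Torus | ε < 2 * absSinHalf (x - t)} :=
    measurableSet_lt measurable_const ((continuous_absSinHalf.measurable.comp
      (measurable_const.sub measurable_id)).const_mul 2)
  rw [← integral_indicator hm]
  have h := hu.integral_mul_eq (hasPrim_kernelTrunc (c := ε / 2) (by linarith) (by linarith) x)
  have e1 : ∫ t, {t : Torus | ε < 2 * absSinHalf (x - t)}.indicator
      (fun t => f t * cotHalf (x - t)) t = ∫ t, 2 * (u t * (cotTrunc (ε / 2) (x - t) / 2)) := by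
    refine integral_congr_ae ?_
    filter_upwards [hf] with t ht
    unfold cotTrunc
    by_cases hx : ε < 2 * absSinHalf (x - t)
    · rw [Set.indicator_of_mem (by exact hx), Set.indicator_of_mem (by
        change ε / 2 < absSinHalf (x - t); linarith), ht]
      ring
    · rw [Set.indicator_of_notMem (by exact hx), Set.indicator_of_notMem (by
        change ¬ ε / 2 < absSinHalf (x - t); intro h'; exact hx (by linarith))]
      ring
  rw [e1, integral_const_mul, h]
  simp only [mul_comm (w _)]
  ring

theorem abs_kernelTrunc_le {c : ℝ} (hc0 : 0 < c) (hc1 : c < 1) {x : Torus} (hx : x ≠ 0) :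
    |kernelTrunc c x| ≤ kernelR x := by
  have hs := absSinHalf_pos hx
  have h1 : max (absSinHalf x) c ≤ 1 := max_le (absSinHalf_le_one x) hc1.le
  have h2 : 0 < max (absSinHalf x) c := hc0.trans_le (le_max_right _ _)
  rw [kernelTrunc, abs_neg, abs_of_nonpos (Real.log_nonpos h2.le h1), kernelR]
  exact neg_le_neg (Real.log_le_log hs (le_max_left _ _))

/-- After the integration by parts the limit ε → 0 is dominated by the logarithmic kernel, so the
principal value exists at every point. This turns the singular integral of the flux into a potential
of its derivative, to which positive definiteness applies. -/
theorem hilbert_eq {u w f : Torus → ℝ} (hu : HasPrim u w) (hf : f =ᵐ[volume] u) (x : Torus) :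
    hilbert f x = pot w x / Real.pi := by
  have hne : ∀ᵐ t : Torus, x - t ≠ 0 := by
    have : ∀ᵐ t : Torus, t ≠ x := by rw [ae_iff]; simp
    filter_upwards [this] with t ht
    exact sub_ne_zero.2 ht.symm
  have hcont : ∀ c, Continuous (kernelTrunc c) ∨ c ≤ 0 := by
    intro c
    rcases le_or_gt c 0 with h | h
    · exact Or.inr h
    · refine Or.inl (Continuous.neg (Continuous.log (by
        have := continuous_absSinHalf
        fun_prop) fun y => ?_))
      exact (h.trans_le (le_max_right _ _)).ne'
  have hlim : Tendsto (fun ε : ℝ => ∫ t, kernelTrunc (ε / 2) (x - t) * w t) (𝓝[>] 0)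
      (𝓝 (pot w x)) := by
    refine tendsto_integral_filter_of_dominated_convergence
      (fun t => ‖kernelR (x - t) * w t‖) ?_ ?_ (integrable_kernelR_mul hu.1 x).norm ?_
    · filter_upwards [self_mem_nhdsWithin] with ε hε
      have hc := (hcont (ε / 2)).resolve_right (not_le.2 (half_pos hε))
      exact (hc.comp (continuous_const.sub continuous_id)).aestronglyMeasurable.mul hu.1.1
    · filter_upwards [Ioo_mem_nhdsGT (zero_lt_two (α := ℝ))] with ε hε
      filter_upwards [hne] with t ht
      rw [norm_mul, norm_mul]
      refine mul_le_mul_of_nonneg_right ?_ (norm_nonneg _)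
      rw [Real.norm_eq_abs, Real.norm_eq_abs, abs_of_nonneg (kernelR_nonneg _)]
      exact abs_kernelTrunc_le (by linarith [hε.1]) (by linarith [hε.2]) ht
    · filter_upwards [hne] with t ht
      refine Tendsto.mul_const _ ?_
      have hs := absSinHalf_pos ht
      refine tendsto_const_nhds.congr' ?_
      filter_upwards [Ioo_mem_nhdsGT hs] with ε hε
      rw [kernelTrunc, kernelR, max_eq_left (by linarith [hε.1, hε.2])]
  have hlim2 : Tendsto (fun ε : ℝ => (∫ t in {t : Torus | ε < 2 * absSinHalf (x - t)},
      f t * cotHalf (x - t)) / (2 * Real.pi)) (𝓝[>] 0) (𝓝 (-2 * pot w x / (2 * Real.pi))) := by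
    refine ((hlim.const_mul (-2)).div_const _).congr' ?_
    filter_upwards [Ioo_mem_nhdsGT (zero_lt_two (α := ℝ))] with ε hε
    rw [integral_truncated_cot hu hf hε.1 hε.2]
  rw [hilbert, hlim2.limUnder_eq]
  have := Real.pi_ne_zero
  field_simp

/-! ### Regularity of the equilibrium density -/

/-- The logarithm has slope at least 1/M on (0, M]. -/
theorem sq_sub_le_mul_log_sub {a b M : ℝ} (ha : 0 < a) (hb : 0 < b) (haM : a ≤ M) (hbM : b ≤ M) :
    (a - b) ^ 2 ≤ M * ((a - b) * (Real.log a - Real.log b)) := by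
  wlog hab : b ≤ a generalizing a b
  · have := this hb ha hbM haM (le_of_not_ge hab)
    nlinarith
  have h1 : 1 - (a / b)⁻¹ ≤ Real.log (a / b) := Real.one_sub_inv_le_log_of_pos (div_pos ha hb)
  rw [Real.log_div ha.ne' hb.ne', inv_div] at h1
  have h2 : a - b ≤ a * (Real.log a - Real.log b) := by
    have := mul_le_mul_of_nonneg_left h1 ha.le
    rwa [mul_sub, mul_one, mul_div_cancel₀ _ ha.ne'] at this
  have h3 : 0 ≤ Real.log a - Real.log b := sub_nonneg.2 (Real.log_le_log hb hab)
  have h4 : a * (Real.log a - Real.log b) ≤ M * (Real.log a - Real.log b) :=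
    mul_le_mul_of_nonneg_right haM h3
  nlinarith [mul_le_mul_of_nonneg_left (h2.trans h4) (sub_nonneg.2 hab)]

theorem mul_abs_log_sub_le {a b m : ℝ} (hm : 0 < m) (ha : m ≤ a) (hb : m ≤ b) :
    m * |Real.log a - Real.log b| ≤ |a - b| := by
  wlog hab : b ≤ a generalizing a b
  · rw [abs_sub_comm, abs_sub_comm a]
    exact this hb ha (le_of_not_ge hab)
  have hb0 := hm.trans_le hb
  have ha0 := hm.trans_le ha
  have h1 := Real.log_le_sub_one_of_pos (div_pos ha0 hb0)
  rw [Real.log_div ha0.ne' hb0.ne'] at h1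
  have h3 : 0 ≤ Real.log a - Real.log b := sub_nonneg.2 (Real.log_le_log hb0 hab)
  rw [abs_of_nonneg h3, abs_of_nonneg (sub_nonneg.2 hab)]
  have h2 := mul_le_mul_of_nonneg_left h1 hb0.le
  rw [mul_sub b (a / b), mul_one, mul_div_cancel₀ _ hb0.ne'] at h2
  exact (mul_le_mul_of_nonneg_right hb h3).trans h2

theorem IsC11.exists_lipschitz {V : Torus → ℝ} (hV : IsC11 V) :
    ∃ L, 0 ≤ L ∧ ∀ (x : Torus) (s : ℝ), |V (x + (s : Torus)) - V x| ≤ L * |s| := by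
  obtain ⟨hd, K, hK⟩ := hV
  obtain ⟨L, hL0, hL⟩ := exists_bound_of_continuous hK.continuous
  refine ⟨L, hL0, fun x s => ?_⟩
  induction x using QuotientAddGroup.induction_on with
  | H t =>
    have h1 := (convex_univ (𝕜 := ℝ) (E := ℝ)).norm_image_sub_le_of_norm_hasDerivWithin_le
      (f := fun t : ℝ => V t) (f' := fun t : ℝ => circDeriv V t) (C := L)
      (fun t _ => by rw [circDeriv_coe]; exact (hd t).hasDerivAt.hasDerivWithinAt)
      (fun t _ => hL t) (Set.mem_univ t) (Set.mem_univ (t + s))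
    have h2 : ‖t + s - t‖ = |s| := by rw [Real.norm_eq_abs]; simp
    rw [h2] at h1
    exact h1

section EqDensity

variable {β : ℝ} {V : Torus → ℝ}

variable (β V) in
theorem eqDensity_nonneg (x : Torus) : 0 ≤ eqDensity β V x := ENNReal.toReal_nonneg

variable (β V) in
theorem measurable_eqDensity : Measurable (eqDensity β V) :=
  (Measure.measurable_rnDeriv _ _).ennreal_toReal

variable [IsProbabilityMeasure (refMeasure V)]

theorem integral_eqMeasure (hV : Continuous V) (hβ : 0 ≤ β) (g : Torus → ℝ) :
    ∫ x, g x ∂(eqMeasure β V : Measure Torus) = ∫ x, eqDensity β V x * g x := by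
  rw [(exists_eqDensity_eq hV hβ).2.1,
    integral_withDensity_eq_integral_toReal_smul (measurable_eqDensity β V).ennreal_ofReal
      (ae_of_all _ fun x => ENNReal.ofReal_lt_top)]
  simp only [ENNReal.toReal_ofReal (eqDensity_nonneg β V _), smul_eq_mul]

/-! ### Two-sided bounds for the equilibrium density. -/

theorem eqDensity_le (hV : Continuous V) (hβ : 0 ≤ β) {R : ℝ} (hR : ∀ x, refDensity V x ≤ R) :
    ∀ᵐ x, eqDensity β V x ≤ R * Real.exp (2 * β * refEnergyBound V) := by
  obtain ⟨-, -, C, -, hC, h⟩ := exists_eqDensity_eq hV hβ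
  filter_upwards [h] with x hx
  rw [hx]
  have := mul_nonneg (mul_nonneg zero_le_two hβ) (pot_nonneg (eqDensity_nonneg β V) x)
  gcongr
  · exact (refDensity_pos V x).le.trans (hR x)
  · exact hR x
  · linarith

theorem exists_le_eqDensity (hV : Continuous V) (hβ : 0 ≤ β) :
    ∃ m, 0 < m ∧ ∀ᵐ x, m ≤ eqDensity β V x := by
  obtain ⟨hp, -, C, hC0, hC, h⟩ := exists_eqDensity_eq hV hβ
  obtain ⟨B, -, hB⟩ := exists_bound_of_continuous hV
  set N := kernelNorm * Real.sqrt (∫ y, eqDensity β V y ^ 2)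
  refine ⟨Real.exp (-B) / (2 * Real.pi) * Real.exp (-(2 * β * N)), by positivity, ?_⟩
  filter_upwards [h] with x hx
  rw [hx, refDensity]
  have h1 := (le_abs_self _).trans (abs_pot_le hp x)
  have h2 := mul_le_mul_of_nonneg_left h1 (mul_nonneg zero_le_two hβ)
  have h3 := (le_abs_self _).trans (hB x)
  gcongr
  linarith

theorem exists_eqDensity_le (hV : Continuous V) (hβ : 0 ≤ β) :
    ∃ M, 0 < M ∧ ∀ᵐ x, eqDensity β V x ≤ M := by
  obtain ⟨R, hR0, hR⟩ := exists_bound_of_continuous (continuous_refDensity hV)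
  have h0 : 0 < R := (refDensity_pos V 0).trans_le ((le_abs_self _).trans (hR 0))
  exact ⟨_, by positivity, eqDensity_le hV hβ fun x => (le_abs_self _).trans (hR x)⟩

/-- Let D = p(· + s) - p. The Euler–Lagrange equation gives Δ log p = -ΔV - 2β pot D; multiplying by
D and integrating, the interaction contributes -2β ∫ D (pot D) ≤ 0. So ∫ D² = O(s²) from the
Lipschitz bound on V alone, for every β and without regularity of the kernel, and the lower bound on
p transfers this to log p. -/
theorem exists_hasPrim_log_eqDensity (hV : IsC11 V) (hβ : 0 ≤ β) :
    ∃ Λ l, HasPrim Λ l ∧ eqDensity β V =ᵐ[volume] fun x => Real.exp (Λ x) := by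
  have hVc := continuous_of_isC11 hV
  obtain ⟨hp, -, C, -, -, hEL⟩ := exists_eqDensity_eq hVc hβ
  obtain ⟨m, hm, hmp⟩ := exists_le_eqDensity hVc hβ
  obtain ⟨M, hM, hMp⟩ := exists_eqDensity_le hVc hβ
  obtain ⟨L, hL0, hL⟩ := hV.exists_lipschitz
  set p := eqDensity β V with hpdef
  have hlog : MemLp (fun x => Real.log (p x)) 2 volume := by
    refine MemLp.of_bound (Real.measurable_log.comp (measurable_eqDensity β V)).aestronglyMeasurable
      (|Real.log m| + |Real.log M|) ?_
    filter_upwards [hmp, hMp] with x h1 h2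
    have h3 := Real.log_le_log hm h1
    have h4 := Real.log_le_log (hm.trans_le h1) h2
    rw [Real.norm_eq_abs, abs_le]
    constructor
    · linarith [neg_abs_le (Real.log m), abs_nonneg (Real.log M)]
    · linarith [le_abs_self (Real.log M), abs_nonneg (Real.log m)]
  have hlogEL : ∀ᵐ x, Real.log (p x) = -V x - Real.log (2 * Real.pi) + C - 2 * β * pot p x := by
    filter_upwards [hEL] with x hx
    rw [hx, Real.log_mul (refDensity_pos V x).ne' (Real.exp_pos _).ne', Real.log_exp, refDensity,
      Real.log_div (Real.exp_pos _).ne' Real.two_pi_pos.ne', Real.log_exp]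
    ring
  have hshift : ∀ (s : Torus) {P : Torus → Prop}, (∀ᵐ x, P x) → ∀ᵐ x, P (x + s) := fun s P h =>
    (measurePreserving_add_right volume s).quasiMeasurePreserving.ae h
  have key : ∀ s : ℝ, 0 < s → ∫ x, (Real.log (p (x + (s : Torus))) - Real.log (p x)) ^ 2 ≤
      (Real.sqrt (2 * Real.pi) * M * L / m * s) ^ 2 := by
    intro s hs
    set D : Torus → ℝ := fun x => p (x + (s : Torus)) - p x with hD
    have hps := MemLp.comp_add_torus hp (s : Torus)
    have hDL : MemLp D 2 volume := hps.sub hp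
    have hpotD : ∀ x, pot D x = pot p (x + (s : Torus)) - pot p x := fun x => by
      rw [hD, pot_sub hps hp, pot_comp_add]
    have h1 : ∀ᵐ x, D x ^ 2 + 4 * β * M * (D x * pot D x) ≤ (M * L * s) ^ 2 := by
      filter_upwards [hmp, hMp, hlogEL, hshift s hmp, hshift s hMp, hshift s hlogEL] with
        x a1 a2 a3 b1 b2 b3
      have h2 := sq_sub_le_mul_log_sub (hm.trans_le b1) (hm.trans_le a1) b2 a2
      have h3 : Real.log (p (x + (s : Torus))) - Real.log (p x) =
          -(V (x + (s : Torus)) - V x) - 2 * β * pot D x := by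
        rw [a3, b3, hpotD]; ring
      rw [h3] at h2
      change D x ^ 2 ≤ M * (D x * _) at h2
      have h4 := hL x s
      rw [abs_of_pos hs] at h4
      have h5 : (V (x + (s : Torus)) - V x) ^ 2 ≤ (L * s) ^ 2 := sq_le_sq' (abs_le.1 h4).1 (abs_le.1 h4).2
      have h6 : M ^ 2 * (V (x + (s : Torus)) - V x) ^ 2 ≤ M ^ 2 * (L * s) ^ 2 :=
        mul_le_mul_of_nonneg_left h5 (sq_nonneg M)
      -- Young's inequality for -M D ΔV; absorbing half of D² doubles the interaction term, hence
      -- the factor 4βM.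
      nlinarith [sq_nonneg (D x + M * (V (x + (s : Torus)) - V x))]
    have hi1 := hDL.integrable_sq
    have hi2 : Integrable fun x => D x * pot D x := hDL.integrable_mul (memLp_pot hDL 2)
    have h2 : ∫ x, D x ^ 2 ≤ 2 * Real.pi * (M * L * s) ^ 2 := by
      have h3 := integral_mono_ae (hi1.add (hi2.const_mul (4 * β * M)))
        (integrable_const ((M * L * s) ^ 2)) h1
      rw [integral_const, volume_real_univ_torus, smul_eq_mul] at h3
      simp only [Pi.add_apply] at h3
      rw [integral_add hi1 (hi2.const_mul _), integral_const_mul] at h3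
      have := mul_nonneg (mul_nonneg (mul_nonneg zero_le_four hβ) hM.le)
        (integral_mul_pot_nonneg hDL)
      linarith
    have h3 : ∀ᵐ x, (Real.log (p (x + (s : Torus))) - Real.log (p x)) ^ 2 ≤ (m ^ 2)⁻¹ * D x ^ 2 := by
      filter_upwards [hmp, hshift s hmp] with x a1 b1
      have h4 := mul_abs_log_sub_le hm b1 a1
      have h5 := pow_le_pow_left₀ (by positivity) h4 2
      rw [mul_pow, sq_abs, sq_abs] at h5
      rw [inv_mul_eq_div, le_div_iff₀ (by positivity), mul_comm]
      exact h5
    have h4 := integral_mono_ae ((MemLp.comp_add_torus hlog (s : Torus)).sub hlog).integrable_sq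
      (hi1.const_mul (m ^ 2)⁻¹) h3
    rw [integral_const_mul] at h4
    refine h4.trans ?_
    rw [show (Real.sqrt (2 * Real.pi) * M * L / m * s) ^ 2 =
      (m ^ 2)⁻¹ * (Real.sqrt (2 * Real.pi) ^ 2 * (M * L * s) ^ 2) by field_simp,
      Real.sq_sqrt Real.two_pi_pos.le]
    gcongr
  obtain ⟨g, hg⟩ := exists_hasWeakDeriv_of_difference_le hlog (by positivity) key
  obtain ⟨Λ, hΛ, hΛg⟩ := hg.exists_hasPrim hlog
  refine ⟨Λ, g, hΛg, ?_⟩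
  filter_upwards [hΛ, hmp] with x h1 h2
  rw [← h1, Real.exp_log (hm.trans_le h2)]

end EqDensity

/-! ### The flux equation -/

section Flux

variable {Λ l f u w φ : Torus → ℝ} {β : ℝ}

theorem continuous_exp_neg (hΛ : Continuous Λ) : Continuous fun x => Real.exp (-Λ x) := by fun_prop

theorem memLp_exp_neg_mul (hΛ : Continuous Λ) (hw : MemLp w 2 volume) :
    MemLp (fun x => Real.exp (-Λ x) * w x) 2 volume :=
  MemLp.mul_continuous (continuous_exp_neg hΛ) hw

theorem integrable_exp_neg_mul_sq (hΛ : Continuous Λ) (hw : MemLp w 2 volume) :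
    Integrable fun x => Real.exp (-Λ x) * w x ^ 2 := by
  have := (memLp_exp_neg_mul hΛ hw).integrable_mul hw
  refine this.congr (ae_of_all _ fun x => ?_)
  simp only [Pi.mul_apply]
  ring

theorem integrable_mul_pot (hw : MemLp w 2 volume) : Integrable fun x => w x * pot w x :=
  hw.integrable_mul (memLp_pot hw 2)

theorem ae_eq_zero_of_fluxForm_nonpos (hΛ : Continuous Λ) (hβ : 0 ≤ β) (hw : MemLp w 2 volume)
    (h : (∫ x, Real.exp (-Λ x) * w x ^ 2) + 2 * β * ∫ x, w x * pot w x ≤ 0) :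
    w =ᵐ[volume] 0 := by
  have h1 := mul_nonneg (mul_nonneg zero_le_two hβ) (integral_mul_pot_nonneg hw)
  have h0 : 0 ≤ fun x => Real.exp (-Λ x) * w x ^ 2 := fun x => by positivity
  have h2 : ∫ x, Real.exp (-Λ x) * w x ^ 2 = 0 :=
    le_antisymm (by linarith) (integral_nonneg h0)
  rw [integral_eq_zero_iff_of_nonneg h0 (integrable_exp_neg_mul_sq hΛ hw)] at h2
  filter_upwards [h2] with x hx
  simpa [Real.exp_ne_zero] using hx

theorem integrable_mul_of_memLp_two {f g : Torus → ℝ} (hf : MemLp f 2 volume)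
    (hg : MemLp g 2 volume) : Integrable fun x => f x * g x :=
  hf.integrable_mul hg

theorem memLp_flux (hΛ : Continuous Λ) (β : ℝ) (hw : MemLp w 2 volume) :
    MemLp (fun x => Real.exp (-Λ x) * w x + 2 * β * pot w x) 2 volume :=
  (memLp_exp_neg_mul hΛ hw).add ((memLp_pot hw 2).const_mul (2 * β))

/-- The bilinear form `∫ e^{-Λ} w v + 2β ∫ v (pot w)` on `L²`. -/
def fluxForm (hΛ : Continuous Λ) (β : ℝ) :
    Lp ℝ 2 (volume : Measure Torus) →ₗ[ℝ] Lp ℝ 2 (volume : Measure Torus) →ₗ[ℝ] ℝ :=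
  LinearMap.mk₂ ℝ (fun w v => ∫ x, (Real.exp (-Λ x) * w x + 2 * β * pot w x) * v x)
    (fun w w' v => by
      have hw := Lp.memLp w
      have hw' := Lp.memLp w'
      have hv := Lp.memLp v
      have hi := fun {w : Torus → ℝ} (hw : MemLp w 2 volume) =>
        integrable_mul_of_memLp_two (memLp_flux hΛ β hw) hv
      rw [← integral_add (hi hw) (hi hw')]
      have h := Lp.coeFn_add w w'
      refine integral_congr_ae ?_
      filter_upwards [h] with x hx
      rw [pot_congr h, hx]
      have := pot_add hw hw' x
      simp only [Pi.add_apply] at this ⊢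
      change _ * _ = _
      rw [show pot (⇑w + ⇑w') x = pot w x + pot w' x from this]
      ring)
    (fun c w v => by
      have h := Lp.coeFn_smul c w
      rw [smul_eq_mul, ← integral_const_mul]
      refine integral_congr_ae ?_
      filter_upwards [h] with x hx
      rw [pot_congr h, hx]
      have := pot_const_mul c w x
      rw [show pot (c • ⇑w) x = c * pot w x from this]
      simp only [Pi.smul_apply, smul_eq_mul]
      ring)
    (fun w v v' => by
      have hw := Lp.memLp w
      have hi := fun {v : Torus → ℝ} (hv : MemLp v 2 volume) =>
        integrable_mul_of_memLp_two (memLp_flux hΛ β hw) hv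
      rw [← integral_add (hi (Lp.memLp v)) (hi (Lp.memLp v'))]
      refine integral_congr_ae ?_
      filter_upwards [Lp.coeFn_add v v'] with x hx
      simp only [hx, Pi.add_apply]
      ring)
    (fun c w v => by
      rw [smul_eq_mul, ← integral_const_mul]
      refine integral_congr_ae ?_
      filter_upwards [Lp.coeFn_smul c v] with x hx
      simp only [hx, Pi.smul_apply, smul_eq_mul]
      ring)

theorem fluxForm_apply (hΛ : Continuous Λ) (β : ℝ) (w v : Lp ℝ 2 (volume : Measure Torus)) :
    fluxForm hΛ β w v = ∫ x, (Real.exp (-Λ x) * w x + 2 * β * pot w x) * v x := rfl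

theorem sqrt_integral_sq_eq_norm (v : Lp ℝ 2 (volume : Measure Torus)) :
    Real.sqrt (∫ x, v x ^ 2) = ‖v‖ := by
  rw [← Real.sqrt_sq (norm_nonneg v), ← real_inner_self_eq_norm_sq, L2.inner_def]
  congr 1
  refine integral_congr_ae (ae_of_all _ fun x => ?_)
  simp [sq]

theorem exists_abs_fluxForm_le (hΛ : Continuous Λ) (β : ℝ) :
    ∃ C, ∀ w v, ‖fluxForm hΛ β w v‖ ≤ C * ‖w‖ * ‖v‖ := by
  obtain ⟨B, hB0, hB⟩ := exists_bound_of_continuous (continuous_exp_neg hΛ)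
  refine ⟨B + |2 * β| * kernelNorm * Real.sqrt (2 * Real.pi), fun w v => ?_⟩
  have hw := Lp.memLp w
  have hv := Lp.memLp v
  have h1 := memLp_exp_neg_mul hΛ hw
  have h2 := (memLp_pot hw 2).const_mul (2 * β)
  have e : fluxForm hΛ β w v =
      (∫ x, (Real.exp (-Λ x) * w x) * v x) + ∫ x, (2 * β * pot w x) * v x := by
    rw [fluxForm_apply, ← integral_add (integrable_mul_of_memLp_two h1 hv)
      (integrable_mul_of_memLp_two h2 hv)]
    refine integral_congr_ae (ae_of_all _ fun x => ?_)
    simp only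
    ring
  have b1 : Real.sqrt (∫ x, (Real.exp (-Λ x) * w x) ^ 2) ≤ B * ‖w‖ := by
    rw [← sqrt_integral_sq_eq_norm]
    refine Real.sqrt_le_iff.2 ⟨by positivity, ?_⟩
    rw [mul_pow, Real.sq_sqrt (integral_nonneg fun x => sq_nonneg _), ← integral_const_mul]
    refine integral_mono h1.integrable_sq (hw.integrable_sq.const_mul _) fun x => ?_
    have h3 : Real.exp (-Λ x) ^ 2 ≤ B ^ 2 :=
      pow_le_pow_left₀ (Real.exp_pos _).le ((le_abs_self _).trans (hB x)) 2
    calc (Real.exp (-Λ x) * w x) ^ 2 = Real.exp (-Λ x) ^ 2 * w x ^ 2 := mul_pow _ _ _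
      _ ≤ B ^ 2 * w x ^ 2 := mul_le_mul_of_nonneg_right h3 (sq_nonneg _)
  have b2 : Real.sqrt (∫ x, (2 * β * pot w x) ^ 2) ≤
      |2 * β| * kernelNorm * Real.sqrt (2 * Real.pi) * ‖w‖ := by
    refine Real.sqrt_le_iff.2 ⟨by have := kernelNorm_nonneg; positivity, ?_⟩
    have h3 : ∀ x, (2 * β * pot w x) ^ 2 ≤ (|2 * β| * (kernelNorm * ‖w‖)) ^ 2 := fun x => by
      have := abs_pot_le hw x
      rw [sqrt_integral_sq_eq_norm] at this
      rw [← sq_abs, abs_mul]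
      gcongr
    refine (integral_mono h2.integrable_sq (integrable_const _) h3).trans_eq ?_
    rw [integral_const, volume_real_univ_torus, smul_eq_mul, mul_pow (_ * _ * _) ‖w‖,
      mul_pow _ (Real.sqrt _), Real.sq_sqrt Real.two_pi_pos.le]
    ring
  rw [e, Real.norm_eq_abs]
  refine (abs_add_le _ _).trans ?_
  rw [add_mul, add_mul]
  have c1 := abs_integral_mul_le h1 hv
  have c2 := abs_integral_mul_le h2 hv
  rw [sqrt_integral_sq_eq_norm] at c1 c2
  exact add_le_add (c1.trans (mul_le_mul_of_nonneg_right b1 (norm_nonneg _)))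
    (c2.trans (mul_le_mul_of_nonneg_right b2 (norm_nonneg _)))

/-- Lax–Milgram on L²: the interaction part of the form is nonnegative, so the weight exp(-Λ),
bounded below by exp(-N), makes it coercive for every β ≥ 0. -/
theorem exists_flux_solution (hΛ : Continuous Λ) (hβ : 0 ≤ β) (hf : MemLp f 2 volume) :
    ∃ w, MemLp w 2 volume ∧
      (fun x => Real.exp (-Λ x) * w x + 2 * β * pot w x) =ᵐ[volume] f := by
  obtain ⟨C, hC⟩ := exists_abs_fluxForm_le hΛ β
  set B := LinearMap.mkContinuous₂ (fluxForm hΛ β) C hC with hBdef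
  obtain ⟨N, hN0, hN⟩ := exists_bound_of_continuous hΛ
  have hcoer : IsCoercive B := by
    refine ⟨Real.exp (-N), Real.exp_pos _, fun w => ?_⟩
    have hw := Lp.memLp w
    rw [hBdef, LinearMap.mkContinuous₂_apply, fluxForm_apply, ← sqrt_integral_sq_eq_norm, mul_assoc,
      Real.mul_self_sqrt (integral_nonneg fun x => sq_nonneg _)]
    have e : ∫ x, (Real.exp (-Λ x) * w x + 2 * β * pot w x) * w x =
        (∫ x, Real.exp (-Λ x) * w x ^ 2) + 2 * β * ∫ x, w x * pot w x := by
      rw [← integral_const_mul, ← integral_add (integrable_exp_neg_mul_sq hΛ hw)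
        ((integrable_mul_pot hw).const_mul _)]
      refine integral_congr_ae (ae_of_all _ fun x => ?_)
      simp only
      ring
    rw [e, ← integral_const_mul]
    have h1 := mul_nonneg (mul_nonneg zero_le_two hβ) (integral_mul_pot_nonneg hw)
    have h2 : ∫ x, Real.exp (-N) * w x ^ 2 ≤ ∫ x, Real.exp (-Λ x) * w x ^ 2 := by
      refine integral_mono (hw.integrable_sq.const_mul _) (integrable_exp_neg_mul_sq hΛ hw)
        fun x => ?_
      refine mul_le_mul_of_nonneg_right (Real.exp_le_exp.2 ?_) (sq_nonneg _)
      linarith [(le_abs_self _).trans (hN x)]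
    linarith
  set A := hcoer.continuousLinearEquivOfBilin
  set w := A.symm (hf.toLp f)
  have hw := Lp.memLp w
  refine ⟨w, hw, ?_⟩
  have hg : MemLp (fun x => Real.exp (-Λ x) * w x + 2 * β * pot w x) 2 volume :=
    (memLp_exp_neg_mul hΛ hw).add ((memLp_pot hw 2).const_mul (2 * β))
  have hd := hg.sub hf
  set v := hd.toLp _
  have h1 : fluxForm hΛ β w v = inner ℝ (hf.toLp f) v := by
    have := hcoer.continuousLinearEquivOfBilin_apply w v
    rw [show hcoer.continuousLinearEquivOfBilin w = hf.toLp f from A.apply_symm_apply _] at this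
    exact this.symm
  rw [fluxForm_apply, L2.inner_def] at h1
  -- The weak equation is tested with the residual itself, which gives equality a.e.
  have h2 : ∫ x, v x ^ 2 = 0 := by
    have h3 : ∫ x, inner ℝ (hf.toLp f x) (v x) = ∫ x, f x * v x := by
      refine integral_congr_ae ?_
      filter_upwards [hf.coeFn_toLp] with x hx
      simp [hx, mul_comm]
    rw [h3] at h1
    rw [← sub_eq_zero.2 h1, ← integral_sub (integrable_mul_of_memLp_two hg (Lp.memLp v))
      (integrable_mul_of_memLp_two hf (Lp.memLp v))]
    refine integral_congr_ae ?_
    filter_upwards [hd.coeFn_toLp] with x hx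
    rw [sq]
    nth_rw 1 [hx]
    simp only [Pi.sub_apply]
    ring
  rw [integral_eq_zero_iff_of_nonneg (fun x => sq_nonneg _) (Lp.memLp v).integrable_sq] at h2
  filter_upwards [h2, hd.coeFn_toLp] with x h3 h4
  have h5 : v x = 0 := by simpa using h3
  rw [h5] at h4
  exact (sub_eq_zero.1 h4.symm)

/-- The free constant `c` is the multiplier of the constraint ∫ w = 0: a multiple of the solution w₂
with right side 1 corrects the mean. If ∫ w₂ were 0, the form at w₂, which equals ∫ w₂, would
vanish; then w₂ = 0, contradicting its equation. -/
theorem exists_flux_solution_integral_eq_zero (hΛ : Continuous Λ) (hβ : 0 ≤ β)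
    (hf : MemLp f 2 volume) :
    ∃ w c, MemLp w 2 volume ∧ ∫ x, w x = 0 ∧
      ∀ᵐ x, Real.exp (-Λ x) * w x + 2 * β * pot w x = -(f x + c) := by
  obtain ⟨w₁, hw₁, h₁⟩ := exists_flux_solution hΛ hβ hf.neg
  obtain ⟨w₂, hw₂, h₂⟩ := exists_flux_solution hΛ hβ (memLp_const (1 : ℝ))
  have hne : ∫ x, w₂ x ≠ 0 := by
    intro h0
    have e : (∫ x, Real.exp (-Λ x) * w₂ x ^ 2) + 2 * β * ∫ x, w₂ x * pot w₂ x = ∫ x, w₂ x := by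
      rw [← integral_const_mul, ← integral_add (integrable_exp_neg_mul_sq hΛ hw₂)
        ((integrable_mul_pot hw₂).const_mul _)]
      refine integral_congr_ae ?_
      filter_upwards [h₂] with x hx
      linear_combination w₂ x * hx
    have hz := ae_eq_zero_of_fluxForm_nonpos hΛ hβ hw₂ (e.trans h0).le
    obtain ⟨x, hx⟩ : ∃ _ : Torus, False := Filter.Eventually.exists (f := ae volume) (by
      filter_upwards [hz, h₂] with x a b
      have : pot w₂ x = 0 := by
        rw [pot_congr hz]; simp [pot]
      rw [a, this] at b
      simp at b)
    exact hx.elim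
  set t := -(∫ x, w₁ x) / ∫ x, w₂ x
  have ht : t * ∫ x, w₂ x = -∫ x, w₁ x := div_mul_cancel₀ _ hne
  have hw₂' : MemLp (fun x => t * w₂ x) 2 volume := hw₂.const_mul t
  refine ⟨fun x => w₁ x + t * w₂ x, -t, hw₁.add hw₂', ?_, ?_⟩
  · rw [integral_add (integrable_of_memLp_two hw₁) (integrable_of_memLp_two hw₂'),
      integral_const_mul, ht]
    ring
  · filter_upwards [h₁, h₂] with x a b
    rw [pot_add hw₁ hw₂', pot_const_mul]
    simp only [Pi.neg_apply] at a
    linear_combination a + t * b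

end Flux

/-! ### The inverse operator -/

section Inverse

variable {β : ℝ} {V : Torus → ℝ} [IsProbabilityMeasure (refMeasure V)] {Λ l f u w φ : Torus → ℝ}

theorem integral_eqDensity (hV : Continuous V) (hβ : 0 ≤ β) : ∫ x, eqDensity β V x = 1 := by
  have := integral_eqMeasure hV hβ fun _ => 1
  simpa using this.symm

/-- With p = e^Λ, the product rule gives φ'' + (log p)'φ' = (pφ')'/p, and the Hilbert term is 2πβ
(pot w)/π. The second-order nonlocal operator becomes a zeroth-order expression in w. -/
theorem opL_ae_eq {Q : Torus → ℝ} (hΛ : HasPrim Λ l)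
    (hp : eqDensity β V =ᵐ[volume] fun x => Real.exp (Λ x))
    (hφQ : weakDeriv φ =ᵐ[volume] Q) {q : Torus → ℝ} (hQ : HasPrim Q q)
    (hu : HasPrim (fun x => Real.exp (Λ x) * Q x) w) :
    opL β V φ =ᵐ[volume] fun x => -(Real.exp (-Λ x) * w x + 2 * β * pot w x) := by
  have hw : w =ᵐ[volume] fun x => Real.exp (Λ x) * q x + Q x * (Real.exp (Λ x) * l x) :=
    (hu.hasWeakDeriv ae_eq_rfl).ae_unique ((hΛ.exp.mul hQ).hasWeakDeriv ae_eq_rfl) ae_eq_rfl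
  have hlog : (fun x => Real.log (eqDensity β V x)) =ᵐ[volume] Λ := by
    filter_upwards [hp] with x hx
    rw [hx, Real.log_exp]
  have hflux : (fun x => eqDensity β V x * weakDeriv φ x) =ᵐ[volume]
      fun x => Real.exp (Λ x) * Q x := by
    filter_upwards [hp, hφQ] with x h1 h2
    rw [h1, h2]
  filter_upwards [hw, hQ.weakDeriv_ae_eq hφQ, hΛ.weakDeriv_ae_eq hlog, hφQ] with x h1 h2 h3 h4
  rw [opL, hilbert_eq hu hflux, h2, h3, h4, h1, Real.exp_neg]
  have := Real.pi_ne_zero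
  field_simp
  ring

theorem IsInvL.exists_flux (hΛ : HasPrim Λ l)
    (hp : eqDensity β V =ᵐ[volume] fun x => Real.exp (Λ x)) (h : IsInvL β V f φ) :
    ∃ u w c, HasPrim u w ∧ (weakDeriv φ =ᵐ[volume] fun x => Real.exp (-Λ x) * u x) ∧
      ∀ᵐ x, Real.exp (-Λ x) * w x + 2 * β * pot w x = -(f x + c) := by
  obtain ⟨-, h1, c, hc⟩ := h
  obtain ⟨Q, hQ, hQq⟩ := h1.exists_hasPrim
  refine ⟨_, _, c, hΛ.exp.mul hQq, ?_, ?_⟩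
  · filter_upwards [hQ] with x hx
    rw [hx, ← mul_assoc, ← Real.exp_add, neg_add_cancel, Real.exp_zero, one_mul]
  · filter_upwards [hc, opL_ae_eq hΛ hp hQ hQq (hΛ.exp.mul hQq)] with x h2 h3
    rw [← h2, h3]
    ring

theorem isInvL_of_flux (hΛ : HasPrim Λ l)
    (hp : eqDensity β V =ᵐ[volume] fun x => Real.exp (Λ x)) (hu : HasPrim u w)
    (hφ : HasPrim φ fun x => Real.exp (-Λ x) * u x)
    (hφ0 : ∫ x, φ x ∂(eqMeasure β V : Measure Torus) = 0) {c : ℝ}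
    (h : ∀ᵐ x, Real.exp (-Λ x) * w x + 2 * β * pot w x = -(f x + c)) : IsInvL β V f φ := by
  have hwd := hφ.weakDeriv_ae_eq ae_eq_rfl
  have hQ := hΛ.neg.exp.mul hu
  refine ⟨⟨hφ.memH1 ae_eq_rfl, hφ0⟩, hQ.memH1 hwd, c, ?_⟩
  have hu' : HasPrim (fun x => Real.exp (Λ x) * (Real.exp (-Λ x) * u x)) w := by
    convert hu using 2 with x
    rw [← mul_assoc, ← Real.exp_add, add_neg_cancel, Real.exp_zero, one_mul]
  filter_upwards [h, opL_ae_eq hΛ hp hwd hQ hu'] with x h1 h2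
  rw [h2, h1]
  ring

/-- The weight p turns φ' into the flux u, and integration by parts moves the derivative from f to
u. -/
theorem innerHilb_eq_of_flux (hV : Continuous V) (hβ : 0 ≤ β)
    (hp : eqDensity β V =ᵐ[volume] fun x => Real.exp (Λ x)) (hf : MemH1 f) (hu : HasPrim u w)
    (hφ : weakDeriv φ =ᵐ[volume] fun x => Real.exp (-Λ x) * u x) :
    innerHilb β V f φ = -∫ x, f x * w x := by
  obtain ⟨F, hfF, hF⟩ := hf.exists_hasPrim
  have h1 : ∫ x, f x * w x = ∫ x, F x * w x := by
    refine integral_congr_ae ?_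
    filter_upwards [hfF] with x hx
    rw [hx]
  rw [innerHilb, integral_eqMeasure hV hβ, h1, hF.integral_mul_eq hu, neg_neg]
  refine integral_congr_ae ?_
  filter_upwards [hp, hφ] with x h2 h3
  rw [h2, h3, mul_left_comm (weakDeriv f x), ← mul_assoc, ← Real.exp_add, add_neg_cancel,
    Real.exp_zero, one_mul]

/-- The flux equation tested with w; the constant disappears because w has mean zero. -/
theorem fluxForm_eq_of_flux (hΛ : Continuous Λ) (hw : MemLp w 2 volume)
    (hf : MemLp f 2 volume) (hw0 : ∫ x, w x = 0) {c : ℝ}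
    (h : ∀ᵐ x, Real.exp (-Λ x) * w x + 2 * β * pot w x = -(f x + c)) :
    (∫ x, Real.exp (-Λ x) * w x ^ 2) + 2 * β * ∫ x, w x * pot w x = -∫ x, f x * w x := by
  have e : (∫ x, f x * w x) = ∫ x, f x * w x + c * w x := by
    rw [integral_add (integrable_mul_of_memLp_two hf hw)
      ((integrable_of_memLp_two hw).const_mul c), integral_const_mul, hw0, mul_zero, add_zero]
  rw [e, ← integral_const_mul, ← integral_neg, ← integral_add (integrable_exp_neg_mul_sq hΛ hw)
    ((integrable_mul_pot hw).const_mul _)]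
  refine integral_congr_ae ?_
  filter_upwards [h] with x hx
  linear_combination w x * hx

theorem flux_ae_unique (hΛ : Continuous Λ) (hβ : 0 ≤ β) {w₁ w₂ : Torus → ℝ} {c₁ c₂ : ℝ}
    (hw₁ : MemLp w₁ 2 volume) (hw₂ : MemLp w₂ 2 volume) (h₁ : ∫ x, w₁ x = 0) (h₂ : ∫ x, w₂ x = 0)
    (e₁ : ∀ᵐ x, Real.exp (-Λ x) * w₁ x + 2 * β * pot w₁ x = -(f x + c₁))
    (e₂ : ∀ᵐ x, Real.exp (-Λ x) * w₂ x + 2 * β * pot w₂ x = -(f x + c₂)) :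
    w₁ =ᵐ[volume] w₂ := by
  have hd : MemLp (fun x => w₁ x - w₂ x) 2 volume := hw₁.sub hw₂
  have h0 : ∫ x, (w₁ x - w₂ x) = 0 := by
    rw [integral_sub (integrable_of_memLp_two hw₁) (integrable_of_memLp_two hw₂), h₁, h₂, sub_zero]
  have key := fluxForm_eq_of_flux (β := β) hΛ hd (memLp_const (0 : ℝ)) h0 (c := c₁ - c₂) (by
    filter_upwards [e₁, e₂] with x a b
    rw [pot_sub hw₁ hw₂]
    linear_combination a - b)
  have hz := ae_eq_zero_of_fluxForm_nonpos hΛ hβ hd (by rw [key]; simp)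
  filter_upwards [hz] with x hx
  exact sub_eq_zero.1 hx

theorem IsInvL.ae_unique (hV : IsC11 V) (hβ : 0 ≤ β) {φ₂ : Torus → ℝ} (h : IsInvL β V f φ)
    (h₂ : IsInvL β V f φ₂) : φ₂ =ᵐ[volume] φ := by
  have hVc := continuous_of_isC11 hV
  obtain ⟨Λ, l, hΛ, hp⟩ := exists_hasPrim_log_eqDensity hV hβ
  obtain ⟨u, w, c, hu, hφ, e⟩ := h.exists_flux hΛ hp
  obtain ⟨u', w', c', hu', hφ', e'⟩ := h₂.exists_flux hΛ hp
  have hww := flux_ae_unique hΛ.continuous hβ hu'.1 hu.1 hu'.integral_eq_zero hu.integral_eq_zero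
    e' e
  have huu := hu'.sub_eq_const hu hww
  obtain ⟨Φ, hΦ, hΦd⟩ := h.1.1.exists_hasPrim
  obtain ⟨Φ', hΦ', hΦd'⟩ := h₂.1.1.exists_hasPrim
  set κ := u' 0 - u 0
  have hdiff : (fun x => weakDeriv φ₂ x - weakDeriv φ x) =ᵐ[volume]
      fun x => κ * Real.exp (-Λ x) := by
    filter_upwards [hφ, hφ'] with x a b
    rw [a, b, ← huu x]
    ring
  have hpos : 0 < ∫ x, Real.exp (-Λ x) :=
    integral_exp_pos (integrable_of_memLp_two (memLp_of_continuous (continuous_exp_neg hΛ.continuous) 2))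
  -- Equal w determine the fluxes only up to a constant κ; it vanishes since φ' has mean zero on the
  -- circle while exp(-Λ) has positive integral. The remaining constant of φ is fixed by the mean
  -- under the equilibrium measure.
  have hκ : κ = 0 := by
    have h0 := (hΦd'.sub hΦd).integral_eq_zero
    rw [integral_congr_ae hdiff, integral_const_mul] at h0
    exact (mul_eq_zero.1 h0).resolve_right hpos.ne'
  have hk := hΦd'.sub_eq_const hΦd (by
    filter_upwards [hdiff] with x hx
    rw [hκ, zero_mul] at hx
    exact sub_eq_zero.1 hx)
  set k := Φ' 0 - Φ 0
  have hk0 : k = 0 := by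
    have hpL := (exists_eqDensity_eq hVc hβ).1
    have e1 := h.1.2
    have e2 := h₂.1.2
    rw [integral_eqMeasure hVc hβ] at e1 e2
    have e3 := integral_sub (integrable_mul_of_memLp_two hpL h₂.1.1.1)
      (integrable_mul_of_memLp_two hpL h.1.1.1)
    rw [e1, e2, sub_zero] at e3
    have e4 : ∫ x, (eqDensity β V x * φ₂ x - eqDensity β V x * φ x) =
        ∫ x, eqDensity β V x * k := by
      refine integral_congr_ae ?_
      filter_upwards [hΦ, hΦ'] with x a b
      rw [a, b, ← hk x]
      ring
    rwa [e4, integral_mul_const, integral_eqDensity hVc hβ, one_mul] at e3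
  filter_upwards [hΦ, hΦ'] with x a b
  rw [a, b]
  linarith [hk x]

theorem exists_isInvL (hV : IsC11 V) (hβ : 0 ≤ β) (hf : MemLp f 2 volume) :
    ∃ φ, IsInvL β V f φ := by
  have hVc := continuous_of_isC11 hV
  obtain ⟨Λ, l, hΛ, hp⟩ := exists_hasPrim_log_eqDensity hV hβ
  obtain ⟨w, c, hw, hw0, e⟩ := exists_flux_solution_integral_eq_zero hΛ.continuous hβ hf
  obtain ⟨u, hu⟩ := exists_hasPrim hw hw0
  have hE := memLp_of_continuous (continuous_exp_neg hΛ.continuous) 2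
  have hpos : 0 < ∫ x, Real.exp (-Λ x) := integral_exp_pos (integrable_of_memLp_two hE)
  -- The constant of integration of the flux is chosen so that φ' = exp(-Λ)(u + κ) has mean zero,
  -- hence a periodic primitive.
  set κ := -(∫ x, Real.exp (-Λ x) * u x) / ∫ x, Real.exp (-Λ x)
  have hκ : κ * ∫ x, Real.exp (-Λ x) = -∫ x, Real.exp (-Λ x) * u x := div_mul_cancel₀ _ hpos.ne'
  have huκ := hu.add_const κ
  obtain ⟨Φ, hΦ⟩ := exists_hasPrim (memLp_exp_neg_mul hΛ.continuous (huκ.memLp 2)) (by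
    simp only [mul_add]
    rw [integral_add (integrable_mul_of_memLp_two hE (hu.memLp 2))
      ((integrable_of_memLp_two hE).mul_const κ), integral_mul_const, mul_comm _ κ, hκ]
    ring)
  refine ⟨_, isInvL_of_flux hΛ hp huκ
    (hΦ.add_const (-∫ x, Φ x ∂(eqMeasure β V : Measure Torus))) ?_ e⟩
  have hi : Integrable Φ (eqMeasure β V : Measure Torus) := by
    obtain ⟨C, -, hC⟩ := exists_bound_of_continuous hΦ.continuous
    exact Integrable.of_bound hΦ.continuous.aestronglyMeasurable C (ae_of_all _ hC)
  rw [integral_add hi (integrable_const _)]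
  simp

theorem IsInvL.innerHilb_nonneg (hV : IsC11 V) (hβ : 0 ≤ β) (hf : MemH1 f) (h : IsInvL β V f φ) :
    0 ≤ innerHilb β V f φ := by
  obtain ⟨Λ, l, hΛ, hp⟩ := exists_hasPrim_log_eqDensity hV hβ
  obtain ⟨u, w, c, hu, hφ, e⟩ := h.exists_flux hΛ hp
  rw [innerHilb_eq_of_flux (continuous_of_isC11 hV) hβ hp hf hu hφ,
    ← fluxForm_eq_of_flux hΛ.continuous hu.1 hf.1 hu.integral_eq_zero e]
  exact add_nonneg (integral_nonneg fun x => by positivity)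
    (mul_nonneg (mul_nonneg zero_le_two hβ) (integral_mul_pot_nonneg hu.1))

theorem MemH1.add_const {ψ : Torus → ℝ} (hψ : MemH1 ψ) (c : ℝ) : MemH1 fun x => ψ x + c := by
  obtain ⟨F, hF, h⟩ := hψ.exists_hasPrim
  refine (h.add_const c).memH1 ?_
  filter_upwards [hF] with x hx
  rw [hx]

/-- The form of the flux equation suited to small β: multiplied by the density, with the mean of ψ
absorbed into `c`. The centering also drops out of the inner product, as ∫ w = 0. -/
theorem exists_flux_center {ψ : Torus → ℝ} (hV : IsC11 V) (hβ : 0 ≤ β) (hψ : MemH1 ψ) :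
    ∃ w c, MemLp w 2 volume ∧ ∫ x, w x = 0 ∧
      (∀ᵐ x, w x = -(eqDensity β V x * (ψ x + c + 2 * β * pot w x))) ∧
      innerHilb β V (center β V ψ) (invL β V (center β V ψ)) = -∫ x, ψ x * w x := by
  obtain ⟨Λ, l, hΛ, hp⟩ := exists_hasPrim_log_eqDensity hV hβ
  have hc : MemH1 (center β V ψ) := hψ.add_const (-∫ y, ψ y ∂(eqMeasure β V : Measure Torus))
  have h : IsInvL β V (center β V ψ) (invL β V (center β V ψ)) :=
    Classical.epsilon_spec (exists_isInvL hV hβ hc.1)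
  obtain ⟨u, w, c, hu, hφ, e⟩ := h.exists_flux hΛ hp
  refine ⟨w, -(∫ y, ψ y ∂(eqMeasure β V : Measure Torus)) + c, hu.1, hu.integral_eq_zero, ?_, ?_⟩
  · filter_upwards [e, hp] with x h1 h2
    have h3 : Real.exp (Λ x) * Real.exp (-Λ x) = 1 := by rw [← Real.exp_add]; simp
    rw [h2]
    simp only [center] at h1
    linear_combination Real.exp (Λ x) * h1 - w x * h3
  · rw [innerHilb_eq_of_flux (continuous_of_isC11 hV) hβ hp hc hu hφ]
    simp only [center, sub_mul]
    rw [integral_sub (integrable_mul_of_memLp_two hψ.1 hu.1)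
      ((integrable_of_memLp_two hu.1).const_mul _), integral_const_mul, hu.integral_eq_zero]
    ring

end Inverse

/-! ### The high temperature limit -/

theorem abs_exp_sub_one_le_exp_abs (t : ℝ) : |Real.exp t - 1| ≤ Real.exp |t| - 1 := by
  rcases le_total 0 t with h | h
  · rw [abs_of_nonneg h, abs_of_nonneg (sub_nonneg.2 (Real.one_le_exp h))]
  · rw [abs_of_nonpos h, abs_of_nonpos (sub_nonpos.2 (Real.exp_le_one_iff.2 h))]
    linarith [Real.add_one_le_exp t, Real.add_one_le_exp (-t)]

theorem integral_refMeasure {V : Torus → ℝ} (hV : Continuous V) (g : Torus → ℝ) :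
    ∫ x, g x ∂(refMeasure V) = ∫ x, refDensity V x * g x := by
  rw [refMeasure_eq,
    integral_withDensity_eq_integral_toReal_smul (continuous_refDensity hV).measurable.ennreal_ofReal
      (ae_of_all _ fun x => ENNReal.ofReal_lt_top)]
  simp only [ENNReal.toReal_ofReal (refDensity_pos V _).le, smul_eq_mul]

theorem integral_add_mul_add_mul {f g h : Torus → ℝ} (hf : Integrable f) (hg : Integrable g)
    (hh : Integrable h) (c d : ℝ) :
    ∫ x, (f x + c * g x + d * h x) = (∫ x, f x) + c * (∫ x, g x) + d * ∫ x, h x := by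
  have h1 : Integrable fun x => f x + c * g x := hf.add (hg.const_mul c)
  rw [integral_add h1 (hh.const_mul d), integral_add hf (hg.const_mul c), integral_const_mul,
    integral_const_mul]

section Limit

variable {β : ℝ} {V : Torus → ℝ} [IsProbabilityMeasure (refMeasure V)]

theorem exists_eqDensity_le_uniform (hV : Continuous V) :
    ∃ M, 0 < M ∧ ∀ β, 0 ≤ β → β ≤ 1 → ∀ᵐ x, eqDensity β V x ≤ M := by
  obtain ⟨R, hR0, hR⟩ := exists_bound_of_continuous (continuous_refDensity hV)
  have h0 : 0 < R := (refDensity_pos V 0).trans_le ((le_abs_self _).trans (hR 0))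
  refine ⟨R * Real.exp (2 * refEnergyBound V), by positivity, fun β hβ hβ1 => ?_⟩
  filter_upwards [eqDensity_le hV hβ fun x => (le_abs_self _).trans (hR x)] with x hx
  refine hx.trans ?_
  have := mul_le_mul_of_nonneg_right hβ1 (refEnergyBound_nonneg (V := V))
  refine mul_le_mul_of_nonneg_left (Real.exp_le_exp.2 ?_) hR0
  linarith

/-- In the Euler–Lagrange equation the exponent C - 2β pot p is O(β) uniformly in x, by the bound on
C and the uniform bound on p. The case β = 0 is included and identifies the density there. -/
theorem exists_abs_eqDensity_sub_le (hV : Continuous V) :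
    ∃ R B, ∀ β, 0 ≤ β → β ≤ 1 → ∀ᵐ x,
      |eqDensity β V x - refDensity V x| ≤ R * (Real.exp (B * β) - 1) := by
  obtain ⟨R, hR0, hR⟩ := exists_bound_of_continuous (continuous_refDensity hV)
  obtain ⟨M, hM0, hM⟩ := exists_eqDensity_le_uniform hV
  refine ⟨R, 2 * refEnergyBound V + 2 * (kernelNorm * (Real.sqrt (2 * Real.pi) * M)),
    fun β hβ hβ1 => ?_⟩
  obtain ⟨hp, -, C, hC0, hC, h⟩ := exists_eqDensity_eq hV hβ
  have hsq : Real.sqrt (∫ x, eqDensity β V x ^ 2) ≤ Real.sqrt (2 * Real.pi) * M := by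
    refine Real.sqrt_le_iff.2 ⟨by positivity, ?_⟩
    rw [mul_pow, Real.sq_sqrt Real.two_pi_pos.le]
    have h1 : ∀ᵐ x, eqDensity β V x ^ 2 ≤ M ^ 2 := by
      filter_upwards [hM β hβ hβ1] with x hx
      exact pow_le_pow_left₀ (eqDensity_nonneg β V x) hx 2
    refine (integral_mono_ae hp.integrable_sq (integrable_const _) h1).trans_eq ?_
    rw [integral_const, volume_real_univ_torus, smul_eq_mul]
  filter_upwards [h] with x hx
  have h1 : |C - 2 * β * pot (eqDensity β V) x| ≤
      (2 * refEnergyBound V + 2 * (kernelNorm * (Real.sqrt (2 * Real.pi) * M))) * β := by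
    have h2 := (abs_pot_le hp x).trans (mul_le_mul_of_nonneg_left hsq kernelNorm_nonneg)
    have h3 := mul_le_mul_of_nonneg_left h2 (mul_nonneg zero_le_two hβ)
    refine (abs_sub _ _).trans ?_
    rw [abs_of_nonneg hC0, abs_mul, abs_of_nonneg (mul_nonneg zero_le_two hβ)]
    linarith
  rw [hx, show refDensity V x * Real.exp (C - 2 * β * pot (eqDensity β V) x) - refDensity V x =
    refDensity V x * (Real.exp (C - 2 * β * pot (eqDensity β V) x) - 1) by ring, abs_mul]
  refine mul_le_mul (hR x) ((abs_exp_sub_one_le_exp_abs _).trans ?_) (abs_nonneg _) hR0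
  gcongr

theorem integrable_eqDensity_mul (hV : Continuous V) (hβ : 0 ≤ β) {g : Torus → ℝ}
    (hg : Integrable g) : Integrable fun x => eqDensity β V x * g x := by
  obtain ⟨M, hM, h⟩ := exists_eqDensity_le hV hβ
  refine hg.bdd_mul (measurable_eqDensity β V).aestronglyMeasurable (c := M) ?_
  filter_upwards [h] with x hx
  rwa [Real.norm_eq_abs, abs_of_nonneg (eqDensity_nonneg β V x)]

theorem integrable_refDensity_mul {V : Torus → ℝ} (hV : Continuous V) {g : Torus → ℝ}
    (hg : Integrable g) : Integrable fun x => refDensity V x * g x := by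
  obtain ⟨C, -, hC⟩ := exists_bound_of_continuous (continuous_refDensity hV)
  exact hg.bdd_mul (continuous_refDensity hV).aestronglyMeasurable (c := C) (ae_of_all _ hC)

theorem tendsto_integral_eqDensity_mul (hV : Continuous V) {g : Torus → ℝ} (hg : Integrable g) :
    Tendsto (fun β => ∫ x, eqDensity β V x * g x) (𝓝[>] 0) (𝓝 (∫ x, refDensity V x * g x)) := by
  obtain ⟨R, B, h⟩ := exists_abs_eqDensity_sub_le hV
  have h0 : Tendsto (fun β : ℝ => R * (Real.exp (B * β) - 1) * ∫ x, |g x|) (𝓝[>] 0) (𝓝 0) := by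
    have : Continuous fun β : ℝ => R * (Real.exp (B * β) - 1) * ∫ x, |g x| := by fun_prop
    have := this.tendsto 0
    simp only [mul_zero, Real.exp_zero, sub_self, zero_mul] at this
    exact this.mono_left nhdsWithin_le_nhds
  refine tendsto_iff_norm_sub_tendsto_zero.2 (squeeze_zero' (Eventually.of_forall fun _ =>
    norm_nonneg _) ?_ h0)
  filter_upwards [self_mem_nhdsWithin, Ioc_mem_nhdsGT (zero_lt_one (α := ℝ))] with β hβ hβ1
  have hβ0 : 0 ≤ β := le_of_lt hβ
  rw [← integral_sub (integrable_eqDensity_mul hV hβ0 hg) (integrable_refDensity_mul hV hg),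
    ← integral_const_mul]
  refine norm_integral_le_of_norm_le (hg.abs.const_mul _) ?_
  filter_upwards [h β hβ0 hβ1.2] with x hx
  rw [← sub_mul, Real.norm_eq_abs, abs_mul]
  exact mul_le_mul_of_nonneg_right hx (abs_nonneg _)

theorem eqDensity_zero_ae_eq (hV : Continuous V) : eqDensity 0 V =ᵐ[volume] refDensity V := by
  obtain ⟨R, B, h⟩ := exists_abs_eqDensity_sub_le hV
  filter_upwards [h 0 le_rfl zero_le_one] with x hx
  rw [mul_zero, Real.exp_zero, sub_self, mul_zero] at hx
  exact sub_eq_zero.1 (abs_nonpos_iff.1 hx)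

/-- The square of the standard deviation `σ_β^V(ψ)`. -/
def sigmaSq (β : ℝ) (V ψ : Torus → ℝ) : ℝ :=
  innerHilb β V (center β V ψ) (invL β V (center β V ψ))

/-- With w = -pX, one has w² ≤ M p X² = -M w X. On integration the constant drops out, the
interaction term is discarded by its sign, and Cauchy–Schwarz closes the estimate, uniformly in β.
-/
theorem sqrt_integral_sq_le_of_flux {ψ w p : Torus → ℝ} {c M : ℝ} (hβ : 0 ≤ β) (hM0 : 0 ≤ M)
    (hp0 : ∀ x, 0 ≤ p x) (hp : ∀ᵐ x, p x ≤ M) (hψ : MemLp ψ 2 volume) (hw : MemLp w 2 volume)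
    (hw0 : ∫ x, w x = 0) (h : ∀ᵐ x, w x = -(p x * (ψ x + c + 2 * β * pot w x))) :
    Real.sqrt (∫ x, w x ^ 2) ≤ M * Real.sqrt (∫ x, ψ x ^ 2) := by
  have h1 : ∀ᵐ x, w x ^ 2 ≤ -(M * (ψ x * w x + c * w x + 2 * β * (w x * pot w x))) := by
    filter_upwards [h, hp] with x hx hpx
    set X := ψ x + c + 2 * β * pot w x
    have h2 : p x * (p x * X ^ 2) ≤ M * (p x * X ^ 2) :=
      mul_le_mul_of_nonneg_right hpx (mul_nonneg (hp0 x) (sq_nonneg _))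
    have h3 : ψ x * w x + c * w x + 2 * β * (w x * pot w x) = w x * X := by ring
    rw [h3, hx]
    linarith
  have i1 := integrable_mul_of_memLp_two hψ hw
  have i2 := integrable_of_memLp_two hw
  have i3 := integrable_mul_pot hw
  have h2 := integral_mono_ae hw.integrable_sq
    (((i1.add (i2.const_mul c)).add (i3.const_mul (2 * β))).const_mul M).neg h1
  simp only [Pi.neg_apply, Pi.add_apply] at h2
  rw [integral_neg, integral_const_mul, integral_add_mul_add_mul i1 i2 i3, hw0] at h2
  have h3 := mul_nonneg (mul_nonneg zero_le_two hβ) (integral_mul_pot_nonneg hw)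
  have h4 := (neg_le_abs _).trans (abs_integral_mul_le hψ hw)
  set a := Real.sqrt (∫ x, w x ^ 2) with ha
  set b := Real.sqrt (∫ x, ψ x ^ 2)
  have h5 : a * a ≤ M * b * a := by
    rw [ha, Real.mul_self_sqrt (integral_nonneg fun x => sq_nonneg _), ← ha]
    nlinarith
  rcases (Real.sqrt_nonneg (∫ x, w x ^ 2)).eq_or_lt with h6 | h6
  · rw [ha, ← h6]
    exact mul_nonneg hM0 (Real.sqrt_nonneg _)
  · exact le_of_mul_le_mul_right h5 h6

/-- Integrating the flux equation determines `c`, and testing it with ψ gives σ². The error is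
exactly 2β times the covariance of ψ and pot w under the equilibrium measure, and pot w is bounded
uniformly for β in [0, 1]. -/
theorem exists_abs_sigmaSq_sub_le (hV : IsC11 V) {ψ : Torus → ℝ} (hψ : MemH1 ψ) :
    ∃ D, ∀ β, 0 ≤ β → β ≤ 1 →
      |sigmaSq β V ψ - ((∫ x, eqDensity β V x * ψ x ^ 2) - (∫ x, eqDensity β V x * ψ x) ^ 2)| ≤
        D * β := by
  have hVc := continuous_of_isC11 hV
  obtain ⟨M, hM0, hM⟩ := exists_eqDensity_le_uniform hVc
  set K := kernelNorm * (M * Real.sqrt (∫ x, ψ x ^ 2)) with hK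
  -- `K` bounds |pot w| and `I` bounds ∫ p|ψ|; the two parts of the covariance are each at most K I,
  -- whence the constant 4 K I.
  have hK0 : 0 ≤ K := by have := kernelNorm_nonneg; positivity
  set I := M * ∫ x, |ψ x| with hI
  refine ⟨4 * (K * I), fun β hβ hβ1 => ?_⟩
  obtain ⟨w, c, hw, hw0, hflux, hS⟩ := exists_flux_center hV hβ hψ
  have hpot : ∀ x, |pot w x| ≤ K := fun x => (abs_pot_le hw x).trans
    (mul_le_mul_of_nonneg_left (sqrt_integral_sq_le_of_flux hβ hM0.le (eqDensity_nonneg β V)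
      (hM β hβ hβ1) hψ.1 hw hw0 hflux) kernelNorm_nonneg)
  have hp1 := integral_eqDensity hVc hβ
  set p := eqDensity β V with hp
  have hpL := integrable_of_memLp_two (exists_eqDensity_eq hVc hβ).1
  have j1 := integrable_eqDensity_mul hVc hβ (integrable_of_memLp_two hψ.1)
  have j2 := integrable_eqDensity_mul hVc hβ hψ.1.integrable_sq
  have j3 := integrable_eqDensity_mul hVc hβ (integrable_of_memLp_two (memLp_pot hw 2))
  have j4 := integrable_eqDensity_mul hVc hβ (integrable_mul_of_memLp_two hψ.1 (memLp_pot hw 2))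
  have e1 : (∫ x, p x * ψ x) + c + 2 * β * (∫ x, p x * pot w x) = 0 := by
    have : ∫ x, w x = -((∫ x, p x * ψ x) + c * (∫ x, p x) + 2 * β * ∫ x, p x * pot w x) := by
      rw [← integral_add_mul_add_mul j1 hpL j3, ← integral_neg]
      refine integral_congr_ae ?_
      filter_upwards [hflux] with x hx
      rw [hx]
      ring
    rw [hw0, hp1] at this
    linarith
  have e2 : ∫ x, ψ x * w x = -((∫ x, p x * ψ x ^ 2) + c * (∫ x, p x * ψ x) +
      2 * β * ∫ x, p x * (ψ x * pot w x)) := by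
    rw [← integral_add_mul_add_mul j2 j1 j4, ← integral_neg]
    refine integral_congr_ae ?_
    filter_upwards [hflux] with x hx
    rw [hx]
    ring
  have b1 : |∫ x, p x * ψ x| ≤ I := by
    rw [hI, ← integral_const_mul, ← Real.norm_eq_abs]
    refine norm_integral_le_of_norm_le ((integrable_of_memLp_two hψ.1).abs.const_mul _) ?_
    filter_upwards [hM β hβ hβ1] with x hx
    rw [Real.norm_eq_abs, abs_mul, abs_of_nonneg (eqDensity_nonneg β V x)]
    exact mul_le_mul_of_nonneg_right hx (abs_nonneg _)
  have b2 : |∫ x, p x * (ψ x * pot w x)| ≤ K * I := by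
    rw [hI, ← mul_assoc, ← integral_const_mul, ← Real.norm_eq_abs]
    refine norm_integral_le_of_norm_le ((integrable_of_memLp_two hψ.1).abs.const_mul _) ?_
    filter_upwards [hM β hβ hβ1] with x hx
    rw [Real.norm_eq_abs, abs_mul, abs_of_nonneg (eqDensity_nonneg β V x), abs_mul]
    calc eqDensity β V x * (|ψ x| * |pot w x|) ≤ M * (|ψ x| * K) := by
          gcongr
          exact hpot x
      _ = K * M * |ψ x| := by ring
  have b3 : |∫ x, p x * pot w x| ≤ K := by
    rw [← mul_one K, ← hp1, ← integral_const_mul, ← Real.norm_eq_abs]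
    refine norm_integral_le_of_norm_le (hpL.const_mul _) (ae_of_all _ fun x => ?_)
    rw [Real.norm_eq_abs, abs_mul, abs_of_nonneg (eqDensity_nonneg β V x), mul_comm]
    exact mul_le_mul_of_nonneg_right (hpot x) (eqDensity_nonneg β V x)
  have e3 : sigmaSq β V ψ - ((∫ x, p x * ψ x ^ 2) - (∫ x, p x * ψ x) ^ 2) =
      2 * β * ((∫ x, p x * (ψ x * pot w x)) - (∫ x, p x * pot w x) * ∫ x, p x * ψ x) := by
    rw [sigmaSq, hS, e2]
    linear_combination (∫ x, p x * ψ x) * e1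
  rw [e3, abs_mul, abs_of_nonneg (mul_nonneg zero_le_two hβ)]
  have b4 : |(∫ x, p x * pot w x) * ∫ x, p x * ψ x| ≤ K * I := by
    rw [abs_mul]
    exact mul_le_mul b3 b1 (abs_nonneg _) hK0
  have b5 := mul_le_mul_of_nonneg_left ((abs_sub _ _).trans (add_le_add b2 b4))
    (mul_nonneg zero_le_two hβ)
  refine b5.trans_eq ?_
  ring

theorem integral_sq_sub_mean_refMeasure (hV : Continuous V) {ψ : Torus → ℝ}
    (hψ : MemLp ψ 2 volume) :
    ∫ x, (ψ x - ∫ y, ψ y ∂(refMeasure V)) ^ 2 ∂(refMeasure V) =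
      (∫ x, refDensity V x * ψ x ^ 2) - (∫ x, refDensity V x * ψ x) ^ 2 := by
  have h1 : ∫ x, refDensity V x = 1 := by
    have := integral_refMeasure hV fun _ => 1
    simpa using this.symm
  rw [integral_refMeasure hV, integral_refMeasure hV]
  set m := ∫ x, refDensity V x * ψ x with hm
  have i0 := integrable_of_memLp_two (memLp_of_continuous (continuous_refDensity hV) 2)
  have i1 := integrable_refDensity_mul hV (integrable_of_memLp_two hψ)
  have i2 := integrable_refDensity_mul hV hψ.integrable_sq
  have e : ∀ x, refDensity V x * (ψ x - m) ^ 2 =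
      refDensity V x * ψ x ^ 2 + -(2 * m) * (refDensity V x * ψ x) + m ^ 2 * refDensity V x :=
    fun x => by ring
  simp only [e]
  rw [integral_add_mul_add_mul i2 i1 i0, h1, ← hm]
  ring

/-- The O(β) estimate at β = 0 is an equality. -/
theorem sigmaSq_zero (hV : IsC11 V) {ψ : Torus → ℝ} (hψ : MemH1 ψ) : sigmaSq 0 V ψ =
    (∫ x, refDensity V x * ψ x ^ 2) - (∫ x, refDensity V x * ψ x) ^ 2 := by
  obtain ⟨D, hD⟩ := exists_abs_sigmaSq_sub_le hV hψ
  have h := hD 0 le_rfl zero_le_one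
  have hz := eqDensity_zero_ae_eq (continuous_of_isC11 hV)
  have e : ∀ g : Torus → ℝ, ∫ x, eqDensity 0 V x * g x = ∫ x, refDensity V x * g x := fun g => by
    refine integral_congr_ae ?_
    filter_upwards [hz] with x hx
    rw [hx]
  rw [mul_zero, e, e] at h
  exact sub_eq_zero.1 (abs_nonpos_iff.1 h)

theorem tendsto_sigmaSq (hV : IsC11 V) {ψ : Torus → ℝ} (hψ : MemH1 ψ) :
    Tendsto (fun β => sigmaSq β V ψ) (𝓝[>] 0) (𝓝 (sigmaSq 0 V ψ)) := by
  have hVc := continuous_of_isC11 hV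
  obtain ⟨D, hD⟩ := exists_abs_sigmaSq_sub_le hV hψ
  have h1 := (tendsto_integral_eqDensity_mul hVc hψ.1.integrable_sq).sub
    ((tendsto_integral_eqDensity_mul hVc (integrable_of_memLp_two hψ.1)).pow 2)
  rw [← sigmaSq_zero hV hψ] at h1
  have h2 : Tendsto (fun β : ℝ => D * β) (𝓝[>] 0) (𝓝 0) := by
    have : Continuous fun β : ℝ => D * β := by fun_prop
    have := this.tendsto 0
    rw [mul_zero] at this
    exact this.mono_left nhdsWithin_le_nhds
  have h3 : Tendsto (fun β => sigmaSq β V ψ -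
      ((∫ x, eqDensity β V x * ψ x ^ 2) - (∫ x, eqDensity β V x * ψ x) ^ 2)) (𝓝[>] 0) (𝓝 0) := by
    refine squeeze_zero_norm' ?_ h2
    filter_upwards [self_mem_nhdsWithin, Ioc_mem_nhdsGT (zero_lt_one (α := ℝ))] with β hβ hβ1
    exact hD β (le_of_lt hβ) hβ1.2
  simpa using h3.add h1

end Limit

end HighTemp

end

/-- The first two conjuncts say that the equilibrium measure and the inverse operator, through which
`sigma` is defined, exist and are unique (and that the square root is that of a nonnegative number);
the last two are the limit and the identification of its value. -/
theorem mainTheorem5 (V : HighTemp.Torus → ℝ) (hV : HighTemp.IsC11 V)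
    (hprob : IsProbabilityMeasure (HighTemp.refMeasure V)) :
    (∀ β : ℝ, 0 ≤ β → ∃! μ : ProbabilityMeasure HighTemp.Torus, HighTemp.IsEquilibrium β V μ) ∧
    (∀ β : ℝ, 0 ≤ β → ∀ f : HighTemp.Torus → ℝ, HighTemp.MemHilb β V f →
      ∃ φ : HighTemp.Torus → ℝ, HighTemp.IsInvL β V f φ ∧
        (∀ φ₂ : HighTemp.Torus → ℝ, HighTemp.IsInvL β V f φ₂ →
          φ₂ =ᵐ[(volume : Measure HighTemp.Torus)] φ) ∧
        0 ≤ HighTemp.innerHilb β V f φ) ∧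
    ∀ ψ : HighTemp.Torus → ℝ, HighTemp.MemH1 ψ →
      Tendsto (fun β : ℝ => HighTemp.sigma β V ψ) (𝓝[>] 0) (𝓝 (HighTemp.sigma 0 V ψ)) ∧
      HighTemp.sigma 0 V ψ =
        Real.sqrt (∫ x, (ψ x - ∫ y, ψ y ∂(HighTemp.refMeasure V)) ^ 2 ∂(HighTemp.refMeasure V)) := by
  have hVc := HighTemp.continuous_of_isC11 hV
  refine ⟨fun β _ => HighTemp.existsUnique_isEquilibrium hVc β, fun β hβ f hf => ?_, fun ψ hψ => ?_⟩
  · obtain ⟨φ, hφ⟩ := HighTemp.exists_isInvL hV hβ hf.1.1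
    exact ⟨φ, hφ, fun φ₂ h₂ => hφ.ae_unique hV hβ h₂, hφ.innerHilb_nonneg hV hβ hf.1⟩
  · refine ⟨(Real.continuous_sqrt.tendsto _).comp (HighTemp.tendsto_sigmaSq hV hψ), ?_⟩
    -- The variance under the reference measure is rewritten as `sigmaSq` at β = 0, whose square
    -- root is `sigma` by definition.
    rw [HighTemp.integral_sq_sub_mean_refMeasure hVc hψ.1, ← HighTemp.sigmaSq_zero hV hψ]
    rfl
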